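/- Let $L$ be a nondegenerate even lattice of finite rank: a free abelian group of finite rank with a nondegenerate symmetric $\mathbb Z$-valued bilinear form $\langle\cdot,\cdot\rangle$ such that $\langle\alpha,\alpha\rangle\in2\mathbb Z$ for all $\alpha\in L$. Put $\mathfrak h=\mathbb C\otimes_{\mathbb Z}L$ with the $\mathbb C$-bilinear extension of the form, and $\widehat{\mathfrak h}^-=\mathfrak h\otimes t^{-1}\mathbb C[t^{-1}]$, and write $h(-n)=h\otimes t^{-n}$. Let $\varepsilon:L\times L\to\mathbb C^\times$ be a 2-cocycle with $\varepsilon(\alpha,\beta)\varepsilon(\beta,\alpha)^{-1}=(-1)^{\langle\alpha,\beta\rangle}$ and $\varepsilon(\alpha,0)=1=\varepsilon(0,\alpha)$ for $\alpha,\beta\in L$, and let $\mathbb C_\varepsilon[L]$ be the twisted group algebra with basis $e_\alpha$ $(\alpha\in L)$ and product $e_\alpha e_\beta=\varepsilon(\alpha,\beta)e_{\alpha+\beta}$. **The lattice vertex algebra.** Let $V_L=S(\widehat{\mathfrak h}^-)\otimes\mathbb C_\varepsilon[L]$. For $h\in\mathfrak h$ and $n\ge1$, let $h(-n)$ act on $V_L$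 by multiplication on $S(\widehat{\mathfrak h}^-)$, let $h(n)$ act by the derivation of $S(\widehat{\mathfrak h}^-)$ with $h'(-k)\mapsto n\,\delta_{n,k}\langle h,h'\rangle$, and let $h(0)$ act by $h(0)(u\otimes e_\beta)=\langle h,\beta\rangle\,u\otimes e_\beta$. Identify $h\in\mathfrak h$ with $h(-1)\otimes e_0$ and $e_\alpha$ with $1\otimes e_\alpha$. There is exactly one vertex algebra structure on $V_L$ with vacuum $\mathbf 1=1\otimes e_0$ and $$Y(h,z)=\sum_{n\in\mathbb Z}h(n)z^{-n-1},\qquad Y(e_\alpha,z)=\exp\Big(\sum_{n\ge1}\frac{\alpha(-n)}{n}z^{n}\Big)\exp\Big(-\sum_{n\ge1}\frac{\alpha(n)}{n}z^{-n}\Big)e_\alpha z^{\alpha}$$ for $h\in\mathfrak h$, $\alpha\in L$, where $e_\alpha z^\alpha(u\otimes e_\beta)=z^{\langle\alpha,\beta\rangle}\varepsilon(\alpha,\beta)\,u\otimes e_{\alpha+\beta}$. **The vertex bialgebra.** Let $B_L=S(\widehat{\mathfrak h}^-)\otimes\mathbb C[L]$ with the tensor product bialgebra structure, in which the $h(-n)$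 are primitive and the $e^\alpha$ are group-like. Let $\partial$ be the derivation of $B_L$ with $\partial(h(-n))=n\,h(-n-1)$ and $\partial(u\otimes e^\alpha)=\alpha(-1)u\otimes e^\alpha+\partial u\otimes e^\alpha$, and put $Y_{B_L}(a,x)b=(e^{x\partial}a)b$. Then $B_L$ is a commutative and cocommutative vertex bialgebra, that is, a commutative vertex algebra whose (cocommutative) comultiplication $\Delta:B_L\to B_L\otimes B_L$ and counit $\epsilon:B_L\to\mathbb C$ are homomorphisms of vertex algebras. **Theorem.** There is exactly one right $B_L$-comodule vertex algebra structure on $V_L$, that is, a vertex algebra homomorphism $\rho:V_L\to V_L\otimes B_L$ with $(\rho\otimes1)\rho=(1\otimes\Delta)\rho$ and $(1\otimes\epsilon)\rho=\mathrm{Id}$, such that $$\rho(h)=h\otimes1+\mathbf 1\otimes h(-1),\qquad\rho(e_\alpha)=e_\alpha\otimes e^\alpha\qquad(h\in\mathfrak h,\ \alpha\in L).$$ -/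

import Mathlib

open scoped TensorProduct

noncomputable section

/-! ### Vertex algebras -/

/-- The data underlying a vertex algebra over `ℂ`: a linear map `Y(·,x) : V → Hom(V, V((x)))` and a
vector `vac` (the vacuum `𝟏`). -/
@[ext]
structure VertexData (V : Type*) [AddCommGroup V] [Module ℂ V] where
  /-- the vertex operator map `v ↦ Y(v,x)` -/
  Y : V →ₗ[ℂ] VertexOperator ℂ V
  /-- the vacuum vector -/
  vac : V

namespace VertexData

variable {V W H : Type*} [AddCommGroup V] [Module ℂ V] [AddCommGroup W] [Module ℂ W]
  [AddCommGroup H] [Module ℂ H]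

/-- The mode `v_n`, where `Y(v,x) = ∑ₙ v_n x^{-n-1}`. -/
def mode (𝒱 : VertexData V) (v : V) (n : ℤ) : Module.End ℂ V :=
  VertexOperator.ncoeff (𝒱.Y v) n

/-- The axioms of a vertex algebra: vacuum property, creation property, and the Jacobi identity
written in components (the Borcherds identity). All sums are finite because
`Y(u,x)v ∈ V((x))`. -/
structure IsVertexAlgebra (𝒱 : VertexData V) : Prop where
  vacuum : ∀ (v : V) (n : ℤ), 𝒱.mode 𝒱.vac n v = if n = -1 then v else 0
  creation_regular : ∀ (v : V) (n : ℤ), 0 ≤ n → 𝒱.mode v n 𝒱.vac = 0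
  creation : ∀ v : V, 𝒱.mode v (-1) 𝒱.vac = v
  jacobi : ∀ (u v w : V) (l m n : ℤ),
    ∑ᶠ i : ℕ, Ring.choose m i • 𝒱.mode (𝒱.mode u (l + i) v) (m + n - i) w =
      ∑ᶠ i : ℕ, ((-1) ^ i * Ring.choose l i : ℤ) •
        (𝒱.mode u (m + l - i) (𝒱.mode v (n + i) w)
          - Int.negOnePow l • 𝒱.mode v (n + l - i) (𝒱.mode u (m + i) w))

/-- A vertex algebra is commutative if all the modes of all the vertex operators commute. -/
def IsCommutative (𝒱 : VertexData V) : Prop :=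
  ∀ (u v : V) (m n : ℤ), Commute (𝒱.mode u m) (𝒱.mode v n)

/-- Homomorphisms: linear maps with `f(𝟏) = 𝟏` and `f(Y(u,x)v) = Y(f(u),x)f(v)`. -/
structure IsHom (𝒱 : VertexData V) (𝒲 : VertexData W) (f : V →ₗ[ℂ] W) : Prop where
  map_vac : f 𝒱.vac = 𝒲.vac
  map_mode : ∀ (u v : V) (n : ℤ), f (𝒱.mode u n v) = 𝒲.mode (f u) n (f v)

/-! ### Tensor products of vertex algebras -/

/-- The coefficient of `x^n` in a series in `V((x))`. -/
def lcoeff (f : HahnModule ℤ ℂ V) (n : ℤ) : V := ((HahnModule.of ℂ).symm f).coeff n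

lemma lcoeff_add (f g : HahnModule ℤ ℂ V) (n : ℤ) :
    lcoeff (f + g) n = lcoeff f n + lcoeff g n := by
  simp [lcoeff]

lemma lcoeff_smul (c : ℂ) (f : HahnModule ℤ ℂ V) (n : ℤ) :
    lcoeff (c • f) n = c • lcoeff f n := rfl

lemma exists_lcoeff_eq_zero (f : HahnModule ℤ ℂ V) : ∃ N : ℤ, ∀ n < N, lcoeff f n = 0 :=
  ⟨((HahnModule.of ℂ).symm f).order, fun _ hn => HahnSeries.coeff_eq_zero_of_lt_order hn⟩

lemma finite_support_tmul (f : HahnModule ℤ ℂ V) (g : HahnModule ℤ ℂ W) (n : ℤ) :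
    (Function.support fun i : ℤ => lcoeff f i ⊗ₜ[ℂ] lcoeff g (n - i)).Finite := by
  obtain ⟨N, hN⟩ := exists_lcoeff_eq_zero f
  obtain ⟨M, hM⟩ := exists_lcoeff_eq_zero g
  refine (Set.finite_Icc N (n - M)).subset fun i hi => ?_
  by_contra h
  apply hi
  rcases lt_or_ge i N with h1 | h1
  · simp [hN i h1]
  · have h2 : n - i < M := by
      by_contra h3
      exact h ⟨h1, by omega⟩
    simp [hM _ h2]

/-- The product `V((x)) × W((x)) → (V ⊗ W)((x))` with
`(∑ᵢ vᵢ xⁱ, ∑ⱼ wⱼ xʲ) ↦ ∑ₙ (∑_{i+j=n} vᵢ ⊗ wⱼ) xⁿ`. -/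
def laurentTmul : HahnModule ℤ ℂ V →ₗ[ℂ] HahnModule ℤ ℂ W →ₗ[ℂ] HahnModule ℤ ℂ (V ⊗[ℂ] W) :=
  LinearMap.mk₂ ℂ
    (fun f g => HahnModule.of ℂ
      { coeff := fun n => ∑ᶠ i : ℤ, lcoeff f i ⊗ₜ[ℂ] lcoeff g (n - i)
        isPWO_support' := by
          obtain ⟨N, hN⟩ := exists_lcoeff_eq_zero f
          obtain ⟨M, hM⟩ := exists_lcoeff_eq_zero g
          refine (BddBelow.isWF ⟨N + M, fun n hn => ?_⟩).isPWO
          by_contra h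
          apply hn
          refine finsum_eq_zero_of_forall_eq_zero fun i => ?_
          rcases lt_or_ge i N with h1 | h1
          · simp [hN i h1]
          · have h2 : n - i < M := by omega
            simp [hM _ h2] })
    (fun f f' g => by
      ext n
      simp only [lcoeff_add, TensorProduct.add_tmul]
      exact finsum_add_distrib (finite_support_tmul f g n) (finite_support_tmul f' g n))
    (fun c f g => by
      ext n
      simp only [lcoeff_smul, ← TensorProduct.smul_tmul']
      exact (smul_finsum' c (finite_support_tmul f g n)).symm)
    (fun f g g' => by
      ext n
      simp only [lcoeff_add, TensorProduct.tmul_add]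
      exact finsum_add_distrib (finite_support_tmul f g n) (finite_support_tmul f g' n))
    (fun c f g => by
      ext n
      simp only [lcoeff_smul, TensorProduct.tmul_smul]
      exact (smul_finsum' c (finite_support_tmul f g n)).symm)

/-- The tensor product: `Y(u ⊗ a, x)(v ⊗ b) = Y(u,x)v ⊗ Y(a,x)b`, with vacuum `𝟏 ⊗ 𝟏`. -/
def tensor (𝒱 : VertexData V) (𝒲 : VertexData W) : VertexData (V ⊗[ℂ] W) where
  Y := LinearMap.compRight ℂ (TensorProduct.lift laurentTmul) ∘ₗ
    TensorProduct.homTensorHomMap (RingHom.id ℂ) V W (HahnModule ℤ ℂ V) (HahnModule ℤ ℂ W) ∘ₗ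
      TensorProduct.map 𝒱.Y 𝒲.Y
  vac := 𝒱.vac ⊗ₜ[ℂ] 𝒲.vac

/-! ### The Borcherds construction -/

/-- The operator coefficients of `b ↦ (e^{x∂}a)b`. -/
def borcherdsCoeff {A : Type*} [CommRing A] [Algebra ℂ A] (d : Derivation ℂ A A) (a : A) :
    ℤ → Module.End ℂ A
  | Int.ofNat n => LinearMap.mulLeft ℂ ((n.factorial : ℂ)⁻¹ • (d : A →ₗ[ℂ] A)^[n] a)
  | Int.negSucc _ => 0

/-- The commutative vertex algebra attached to a commutative algebra `A` with a derivation `∂`: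
`Y(a,x)b = (e^{x∂}a)b`, with vacuum `1`. -/
def borcherds {A : Type*} [CommRing A] [Algebra ℂ A] (d : Derivation ℂ A A) : VertexData A where
  Y :=
    { toFun := fun a => VertexOperator.of_coeff (borcherdsCoeff d a) fun b => by
        refine ⟨0, fun n hn => ?_⟩
        by_contra h
        apply hn
        obtain ⟨k, rfl⟩ := Int.eq_negSucc_of_lt_zero (not_le.mp h)
        simp [borcherdsCoeff]
      map_add' := fun a a' => by
        ext b n
        cases n with
        | ofNat n =>
          simp [VertexOperator.of_coeff, borcherdsCoeff, iterate_map_add, add_mul]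
        | negSucc n => simp [VertexOperator.of_coeff, borcherdsCoeff]
      map_smul' := fun c a => by
        ext b n
        have h (n : ℕ) : (d : A →ₗ[ℂ] A)^[n] (c • a) = c • (d : A →ₗ[ℂ] A)^[n] a := by
          rw [← Module.End.pow_apply, map_smul, Module.End.pow_apply]
        cases n with
        | ofNat n =>
          change ((n.factorial : ℂ)⁻¹ • (d : A →ₗ[ℂ] A)^[n] (c • a)) * b =
            c • (((n.factorial : ℂ)⁻¹ • (d : A →ₗ[ℂ] A)^[n] a) * b)
          rw [h, smul_comm, smul_mul_assoc]
        | negSucc n =>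
          change (0 : A) = c • (0 : A)
          rw [smul_zero] }
  vac := 1

/-- The one-dimensional vertex algebra `ℂ`. -/
def trivial : VertexData ℂ := borcherds (0 : Derivation ℂ ℂ ℂ)

/-! ### Vertex bialgebras and comodule vertex algebras -/

/-- A vertex bialgebra: a vertex algebra with a coalgebra structure whose comultiplication and
counit are homomorphisms of vertex algebras. -/
structure IsVertexBialgebra [Coalgebra ℂ H] (ℋ : VertexData H) : Prop where
  isVertexAlgebra : ℋ.IsVertexAlgebra
  comul_isHom : IsHom ℋ (ℋ.tensor ℋ) Coalgebra.comul
  counit_isHom : IsHom ℋ trivial Coalgebra.counit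

/-- `ρ : V → V ⊗ H` makes the vertex algebra `V` a right comodule vertex algebra over the vertex
bialgebra `H`. -/
structure IsRightComoduleVertexAlgebra [Coalgebra ℂ H] (𝒱 : VertexData V) (ℋ : VertexData H)
    (ρ : V →ₗ[ℂ] V ⊗[ℂ] H) : Prop where
  isVertexAlgebra : 𝒱.IsVertexAlgebra
  isVertexBialgebra : ℋ.IsVertexBialgebra
  isHom : IsHom 𝒱 (𝒱.tensor ℋ) ρ
  coassoc : (TensorProduct.assoc ℂ V H H).toLinearMap ∘ₗ ρ.rTensor H ∘ₗ ρ =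
    (Coalgebra.comul (R := ℂ) (A := H)).lTensor V ∘ₗ ρ
  counit : (TensorProduct.rid ℂ V).toLinearMap ∘ₗ
    (Coalgebra.counit (R := ℂ) (A := H)).lTensor V ∘ₗ ρ = LinearMap.id

end VertexData

/-! ### Derivations of symmetric algebras -/

/-- The algebra homomorphism `s ↦ s + D(s)ε` into the dual numbers, where `D` is the derivation of
`S(M)` extending `f`. -/
def symDerivAux {M : Type*} [AddCommGroup M] [Module ℂ M] (f : M →ₗ[ℂ] SymmetricAlgebra ℂ M) :
    SymmetricAlgebra ℂ M →ₐ[ℂ] TrivSqZeroExt (SymmetricAlgebra ℂ M) (SymmetricAlgebra ℂ M) :=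
  SymmetricAlgebra.lift
    ((TrivSqZeroExt.inlAlgHom ℂ (SymmetricAlgebra ℂ M) (SymmetricAlgebra ℂ M)).toLinearMap ∘ₗ
        SymmetricAlgebra.ι ℂ M +
      (TrivSqZeroExt.inrHom (SymmetricAlgebra ℂ M) (SymmetricAlgebra ℂ M)).restrictScalars ℂ ∘ₗ f)

lemma symDerivAux_fst {M : Type*} [AddCommGroup M] [Module ℂ M]
    (f : M →ₗ[ℂ] SymmetricAlgebra ℂ M) (s : SymmetricAlgebra ℂ M) :
    (symDerivAux f s).fst = s := by
  have h : (TrivSqZeroExt.fstHom ℂ (SymmetricAlgebra ℂ M) (SymmetricAlgebra ℂ M)).comp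
      (symDerivAux f) = AlgHom.id ℂ _ := by
    ext m
    simp [symDerivAux]
  exact congr($h s)

/-- The derivation of the symmetric algebra `S(M)` extending a linear map `f : M → S(M)`. -/
def symDeriv {M : Type*} [AddCommGroup M] [Module ℂ M] (f : M →ₗ[ℂ] SymmetricAlgebra ℂ M) :
    Derivation ℂ (SymmetricAlgebra ℂ M) (SymmetricAlgebra ℂ M) :=
  Derivation.mk'
    ((TrivSqZeroExt.sndHom (SymmetricAlgebra ℂ M) (SymmetricAlgebra ℂ M)).restrictScalars ℂ ∘ₗ
      (symDerivAux f).toLinearMap)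
    (fun a b => by simp [symDerivAux_fst, mul_comm])

lemma symDeriv_ι {M : Type*} [AddCommGroup M] [Module ℂ M] (f : M →ₗ[ℂ] SymmetricAlgebra ℂ M)
    (m : M) : symDeriv f (SymmetricAlgebra.ι ℂ M m) = f m := by
  simp [symDeriv, symDerivAux]

/-! ### The spaces attached to a lattice -/

namespace LatticeVA

variable (L : Type*) [AddCommGroup L]

/-- `𝔥 = ℂ ⊗_ℤ L`. -/
abbrev Cartan : Type _ := ℂ ⊗[ℤ] L

/-- `𝔥̂⁻ = 𝔥 ⊗ t⁻¹ℂ[t⁻¹]`; the function `Finsupp.single n h` stands for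
`h(-n-1) = h ⊗ t^{-n-1}`, where `n = 0, 1, 2, …`. -/
abbrev HeisMinus : Type _ := ℕ →₀ Cartan L

/-- `S(𝔥̂⁻)`. -/
abbrev Fock : Type _ := SymmetricAlgebra ℂ (HeisMinus L)

/-- The underlying space of `V_L = S(𝔥̂⁻) ⊗ ℂ_ε[L]`, where `Finsupp.single α 1` is the basis element
`e_α` of the twisted group algebra. -/
abbrev VSpace : Type _ := Fock L ⊗[ℂ] (L →₀ ℂ)

/-- The bialgebra `B_L = S(𝔥̂⁻) ⊗ ℂ[L]`. -/
abbrev BSpace : Type _ := Fock L ⊗[ℂ] AddMonoidAlgebra ℂ L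

variable {L}

/-- The element `h(-n-1)` of `S(𝔥̂⁻)`. -/
def neg (h : Cartan L) (n : ℕ) : Fock L := SymmetricAlgebra.ι ℂ (HeisMinus L) (Finsupp.single n h)

/-- The image of `α ∈ L` in `𝔥`. -/
def toCartan (α : L) : Cartan L := (1 : ℂ) ⊗ₜ[ℤ] α

/-! #### The lattice vertex algebra -/

/-- The element `e_α` of `V_L`. -/
def eV (α : L) : VSpace L := (1 : Fock L) ⊗ₜ[ℂ] Finsupp.single α (1 : ℂ)

/-- The element `h = h(-1) ⊗ 1` of `V_L`. -/
def hV (h : Cartan L) : VSpace L := neg h 0 ⊗ₜ[ℂ] Finsupp.single (0 : L) (1 : ℂ)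

variable (B : LinearMap.BilinForm ℤ L)

/-- The action of `h(n+1)` on `S(𝔥̂⁻)`: the derivation with
`h'(-k-1) ↦ (n+1) δ_{n,k} ⟨h,h'⟩`. -/
def annih (h : Cartan L) (n : ℕ) : Derivation ℂ (Fock L) (Fock L) :=
  symDeriv ((Algebra.linearMap ℂ (Fock L)) ∘ₗ
    (((n : ℂ) + 1) • (B.baseChange ℂ h ∘ₗ Finsupp.lapply n)))

/-- The action of `h(0)` on `ℂ_ε[L]`: `e_β ↦ ⟨h,β⟩ e_β`. -/
def zeroMode (h : Cartan L) : Module.End ℂ (L →₀ ℂ) :=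
  Finsupp.lsum ℂ fun β => B.baseChange ℂ h (toCartan β) • Finsupp.lsingle β

/-- The action of `h(n)`, `n ∈ ℤ`, on `V_L = S(𝔥̂⁻) ⊗ ℂ_ε[L]`. -/
def heis (h : Cartan L) : ℤ → Module.End ℂ (VSpace L)
  | Int.ofNat 0 => (zeroMode B h).lTensor (Fock L)
  | Int.ofNat (n + 1) => ((annih B h n : Derivation ℂ (Fock L) (Fock L)) :
      Fock L →ₗ[ℂ] Fock L).rTensor (L →₀ ℂ)
  | Int.negSucc n => (LinearMap.mulLeft ℂ (neg h n)).rTensor (L →₀ ℂ)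

/-- The exponential of a power series with zero constant term; the coefficient of `zⁿ` in
`X(z)ᵏ` vanishes for `k > n`. -/
def expSeries {A : Type*} [Ring A] [Algebra ℂ A] (X : PowerSeries A) : PowerSeries A :=
  PowerSeries.mk fun n =>
    ∑ k ∈ Finset.range (n + 1), (k.factorial : ℂ)⁻¹ • PowerSeries.coeff n (X ^ k)

/-- `E⁻(-α,z) = exp(∑_{n ≥ 1} (α(-n)/n) zⁿ)`, as a power series in `z`. -/
def Eminus (α : L) : PowerSeries (Module.End ℂ (VSpace L)) :=
  expSeries (PowerSeries.mk fun n : ℕ =>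
    if n = 0 then 0 else (n : ℂ)⁻¹ • heis B (toCartan α) (-(n : ℤ)))

/-- `E⁺(-α,z) = exp(∑_{n ≥ 1} (-α(n)/n) z⁻ⁿ)`, as a power series in `z⁻¹`. -/
def Eplus (α : L) : PowerSeries (Module.End ℂ (VSpace L)) :=
  expSeries (PowerSeries.mk fun n : ℕ =>
    if n = 0 then 0 else -((n : ℂ)⁻¹ • heis B (toCartan α) (n : ℤ)))

/-- The characterization of the lattice vertex algebra structure on `V_L`: it is a vertex algebra
with vacuum `1 ⊗ e_0`, `Y(h,z) = ∑ₙ h(n) z^{-n-1}`, and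
`Y(e_α,z) = E⁻(-α,z) E⁺(-α,z) e_α z^α`. The last equation is tested on the vectors `u ⊗ e_β`, on
which `e_α z^α` takes the value `ε(α,β) z^{⟨α,β⟩} u ⊗ e_{α+β}`. -/
structure IsLatticeVertexAlgebra (ε : L → L → ℂˣ) (𝒱 : VertexData (VSpace L)) : Prop where
  isVertexAlgebra : 𝒱.IsVertexAlgebra
  vac_eq : 𝒱.vac = eV 0
  Y_h : ∀ (h : Cartan L) (n : ℤ), 𝒱.mode (hV h) n = heis B h n
  Y_e : ∀ (α β : L) (u : Fock L) (m : ℤ),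
    HVertexOperator.coeff (𝒱.Y (eV α)) m (u ⊗ₜ[ℂ] Finsupp.single β 1) =
      ∑ᶠ p : ℕ × ℕ, if B α β + (p.1 : ℤ) - (p.2 : ℤ) = m then
        PowerSeries.coeff p.1 (Eminus B α) (PowerSeries.coeff p.2 (Eplus B α)
          ((ε α β : ℂ) • (u ⊗ₜ[ℂ] Finsupp.single (α + β) (1 : ℂ)))) else 0

/-! #### The vertex bialgebra `B_L` -/

/-- The element `e^α` of `B_L`. -/
def eB (α : L) : BSpace L := (1 : Fock L) ⊗ₜ[ℂ] AddMonoidAlgebra.single α (1 : ℂ)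

/-- The element `h(-1)` of `B_L`. -/
def hB (h : Cartan L) : BSpace L := neg h 0 ⊗ₜ[ℂ] (1 : AddMonoidAlgebra ℂ L)

/-- The derivation of `S(𝔥̂⁻)` with `h(-n) ↦ n h(-n-1)` for `n ≥ 1`. -/
def fockDeriv : Derivation ℂ (Fock L) (Fock L) :=
  symDeriv (SymmetricAlgebra.ι ℂ (HeisMinus L) ∘ₗ
    Finsupp.lsum ℂ fun n : ℕ => ((n : ℂ) + 1) • Finsupp.lsingle (n + 1))

/-- The linear map `ℂ[L] → B_L`, `e^α ↦ α(-1) ⊗ e^α`. -/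
def gradMap : AddMonoidAlgebra ℂ L →ₗ[ℂ] BSpace L :=
  (Finsupp.lsum ℂ fun α : L => LinearMap.toSpanSingleton ℂ (BSpace L)
    (neg (toCartan α) 0 ⊗ₜ[ℂ] AddMonoidAlgebra.single α (1 : ℂ))) ∘ₗ
      (AddMonoidAlgebra.coeffLinearEquiv ℂ).toLinearMap

/-- The linear map underlying the derivation `∂` of `B_L`:
`u ⊗ e^α ↦ α(-1)u ⊗ e^α + ∂u ⊗ e^α`. -/
def bDerivLin : BSpace L →ₗ[ℂ] BSpace L :=
  LinearMap.mul' ℂ (BSpace L) ∘ₗ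
      TensorProduct.map (Algebra.TensorProduct.includeLeft (R := ℂ) (S := ℂ) (A := Fock L)
        (B := AddMonoidAlgebra ℂ L)).toLinearMap gradMap +
    ((fockDeriv : Derivation ℂ (Fock L) (Fock L)) : Fock L →ₗ[ℂ] Fock L).rTensor (AddMonoidAlgebra ℂ L)

lemma bDerivLin_single (u : Fock L) (α : L) (c : ℂ) :
    bDerivLin (u ⊗ₜ[ℂ] AddMonoidAlgebra.single α c) =
      (neg (toCartan α) 0 * u + fockDeriv u) ⊗ₜ[ℂ] AddMonoidAlgebra.single α c := by
  simp [bDerivLin, gradMap, TensorProduct.add_tmul, mul_comm u, ← TensorProduct.tmul_smul]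

lemma neg_toCartan_add (α β : L) (n : ℕ) :
    neg (toCartan (α + β)) n = neg (toCartan α) n + neg (toCartan β) n := by
  simp [neg, toCartan, TensorProduct.tmul_add]

/-- The derivation `∂` of `B_L` with `h(-n) ↦ n h(-n-1)` for `n ≥ 1` and
`u ⊗ e^α ↦ α(-1)u ⊗ e^α + ∂u ⊗ e^α`. -/
def bDeriv : Derivation ℂ (BSpace L) (BSpace L) :=
  Derivation.mk' bDerivLin fun a b => by
    induction a using TensorProduct.induction_on with
    | zero => simp
    | add x y hx hy => simp only [add_mul, map_add, hx, hy, smul_eq_mul, mul_add]; ring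
    | tmul u f =>
    induction b using TensorProduct.induction_on with
    | zero => simp
    | add x y hx hy => simp only [add_mul, map_add, hx, hy, smul_eq_mul, mul_add]; ring
    | tmul v g =>
    induction f using AddMonoidAlgebra.induction_linear with
    | zero => simp
    | add x y hx hy =>
      simp only [add_mul, map_add, hx, hy, smul_eq_mul, mul_add, TensorProduct.tmul_add]; ring
    | single α c =>
    induction g using AddMonoidAlgebra.induction_linear with
    | zero => simp
    | add x y hx hy =>
      simp only [add_mul, map_add, hx, hy, smul_eq_mul, mul_add, TensorProduct.tmul_add]; ring
    | single β d =>
      simp only [Algebra.TensorProduct.tmul_mul_tmul, AddMonoidAlgebra.single_mul_single,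
        bDerivLin_single, smul_eq_mul, neg_toCartan_add, Derivation.leibniz]
      rw [add_comm β α, mul_comm d c, ← TensorProduct.add_tmul]
      congr 1
      ring

variable (L) in
/-- The vertex bialgebra `B_L`: `Y(a,x)b = (e^{x∂}a)b`, together with the coalgebra structure of the
bialgebra `S(𝔥̂⁻) ⊗ ℂ[L]`. -/
def vertexB : VertexData (BSpace L) := VertexData.borcherds bDeriv

end LatticeVA
end

/-!
Mutually local, translation covariant and creative fields generate a vertex algebra
(reconstruction), which applies to the fields `Y(h,z)` and `Y(e_α,z)` of `V_L` and to the fields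
`Y(u,x) ⊗ 1` and `1 ⊗ Y(a,x)` of a tensor product. As vector spaces `V_L = B_L`, with the same
translation operator, and the coaction `ρ` is the comultiplication of `B_L`; coassociativity and
counitality are therefore those of `B_L`. That `ρ` is a homomorphism has to be checked on the
generators `h` and `e_α` only, and for `h` the modes act by `h(n) ⊗ 1 + 1 ⊗ h(n)`. For `e_α`,
commuting with the Heisenberg modes reduces the claim to `ρ((e_α)_n e_γ)`; the leading modes are
compared directly and the others follow from `T e_γ = γ(-1) e_γ`, which gives the recursion
`T (e_α)_n e_γ = γ(-1) (e_α)_n e_γ - (⟨γ,α⟩ + n) (e_α)_{n-1} e_γ`.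
Uniqueness holds because `h` and `e_α` generate `V_L`.
-/

noncomputable section

namespace VertexData

open VertexOperator (ncoeff of_coeff ncoeff_of_coeff)

/-! ### Expansions of distributions in two variables -/

/-- The coefficient of `x^{l-i} y^i` in `(x - y)^l`. -/
def signedChoose (l : ℤ) (i : ℕ) : ℤ := (-1) ^ i * Ring.choose l i

@[simp] lemma signedChoose_zero_right (l : ℤ) : signedChoose l 0 = 1 := by simp [signedChoose]

@[simp] lemma signedChoose_zero_succ (i : ℕ) : signedChoose 0 (i + 1) = 0 := by
  simp [signedChoose, Ring.choose_zero_succ]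

@[simp] lemma signedChoose_one_right (l : ℤ) : signedChoose l 1 = -l := by simp [signedChoose]

@[simp] lemma signedChoose_neg_one (i : ℕ) : signedChoose (-1) i = 1 := by
  simp [signedChoose, Ring.choose_neg, Ring.choose_natCast, Int.coe_negOnePow_natCast, ← mul_pow,
    Units.smul_def]

lemma signedChoose_succ_succ (l : ℤ) (i : ℕ) :
    signedChoose (l + 1) (i + 1) = signedChoose l (i + 1) - signedChoose l i := by
  simp only [signedChoose, Ring.choose_succ_succ, pow_succ]
  ring

lemma succ_mul_signedChoose_succ (l : ℤ) (i : ℕ) :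
    (i + 1 : ℤ) * signedChoose l (i + 1) = -(l - i) * signedChoose l i := by
  have h := Ring.choose_smul_choose l (Nat.le_succ i)
  simp only [Nat.succ_eq_add_one, Nat.choose_succ_self_right, nsmul_eq_mul, Nat.cast_add,
    Nat.cast_one, Nat.add_sub_cancel_left, Ring.choose_one_right] at h
  simp only [signedChoose, pow_succ]
  linear_combination (-(-1) ^ i) * h

lemma neg_mul_sum_signedChoose (l : ℤ) (p : ℕ) :
    -l * ∑ j ∈ Finset.range p, signedChoose l j = p * signedChoose l p := by
  induction p with
  | zero => simp
  | succ p ih =>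
    have h := succ_mul_signedChoose_succ l p
    rw [Finset.sum_range_succ, mul_add, ih]
    push_cast
    rw [h]
    ring

section Expand

variable {V W : Type*} [AddCommGroup V] [AddCommGroup W]

/-- A family `f m n` stands for the distribution `∑ f m n x^{-m-1} y^{-n-1}`; it is truncated if
`f m n` vanishes for large `n`, uniformly in `m`. -/
def IsTruncated (f : ℤ → ℤ → V) : Prop := ∃ N : ℤ, ∀ m n, N ≤ n → f m n = 0

/-- The coefficients of `(x - y)^l f(x, y)`, where `(x - y)^l` is expanded in nonnegative powers
of `y`. The sum has finite support when `f` is truncated. -/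
def expand (l : ℤ) (f : ℤ → ℤ → V) (m n : ℤ) : V :=
  ∑ᶠ i : ℕ, signedChoose l i • f (m + l - i) (n + i)

namespace IsTruncated

variable {f g : ℤ → ℤ → V}

lemma exists_bound (hf : IsTruncated f) (n : ℤ) : ∃ K : ℕ, ∀ m k, n + K ≤ k → f m k = 0 := by
  obtain ⟨N, hN⟩ := hf
  exact ⟨(N - n).toNat, fun m k hk => hN m k (by omega)⟩

lemma sub (hf : IsTruncated f) (hg : IsTruncated g) : IsTruncated fun m n => f m n - g m n := by
  obtain ⟨N, hN⟩ := hf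
  obtain ⟨M, hM⟩ := hg
  exact ⟨max N M, fun m n h => by
    simp only [hN m n (le_of_max_le_left h), hM m n (le_of_max_le_right h), sub_zero]⟩

lemma map {F : Type*} [FunLike F V W] [AddMonoidHomClass F V W] (hf : IsTruncated f) (φ : F) :
    IsTruncated fun m n => φ (f m n) := by
  obtain ⟨N, hN⟩ := hf
  exact ⟨N, fun m n h => by simp only [hN m n h, map_zero]⟩

lemma shift (hf : IsTruncated f) (a b : ℤ) : IsTruncated fun m n => f (m + a) (n + b) := by
  obtain ⟨N, hN⟩ := hf
  exact ⟨N - b, fun m n h => hN _ _ (by omega)⟩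

end IsTruncated

lemma expand_eq_sum_range {f : ℤ → ℤ → V} {n : ℤ} {K : ℕ}
    (hf : ∀ m k, n + K ≤ k → f m k = 0) (l m : ℤ) :
    expand l f m n = ∑ i ∈ Finset.range K, signedChoose l i • f (m + l - i) (n + i) := by
  refine finsum_eq_sum_of_support_subset _ fun i hi => ?_
  by_contra h
  simp only [Finset.coe_range, Set.mem_Iio, not_lt] at h
  exact hi (by simp only [hf _ _ (show n + (K : ℤ) ≤ n + i by omega), smul_zero])

lemma IsTruncated.finite_support {f : ℤ → ℤ → V} (hf : IsTruncated f) (l m n : ℤ) :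
    (Function.support fun i : ℕ => signedChoose l i • f (m + l - i) (n + i)).Finite := by
  obtain ⟨K, hK⟩ := hf.exists_bound n
  refine (Finset.range K).finite_toSet.subset fun i hi => ?_
  by_contra h
  simp only [Finset.coe_range, Set.mem_Iio, not_lt] at h
  exact hi (by simp only [hK _ _ (show n + (K : ℤ) ≤ n + i by omega), smul_zero])

lemma expand_add {f g : ℤ → ℤ → V} (hf : IsTruncated f) (hg : IsTruncated g) (l m n : ℤ) :
    expand l (fun m n => f m n + g m n) m n = expand l f m n + expand l g m n := by
  simp only [expand, smul_add]
  exact finsum_add_distrib (hf.finite_support l m n) (hg.finite_support l m n)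

lemma expand_sub {f g : ℤ → ℤ → V} (hf : IsTruncated f) (hg : IsTruncated g) (l m n : ℤ) :
    expand l (fun m n => f m n - g m n) m n = expand l f m n - expand l g m n := by
  simp only [expand, smul_sub]
  exact finsum_sub_distrib (hf.finite_support l m n) (hg.finite_support l m n)

lemma map_expand {F : Type*} [FunLike F V W] [AddMonoidHomClass F V W] {f : ℤ → ℤ → V}
    (hf : IsTruncated f) (φ : F) (l m n : ℤ) :
    φ (expand l f m n) = expand l (fun m n => φ (f m n)) m n := by
  have h := AddMonoidHom.map_finsum (AddMonoidHomClass.toAddMonoidHom φ)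
    (hf.finite_support l m n)
  simpa [expand] using h

lemma expand_zero (l m n : ℤ) : expand l (fun _ _ => (0 : V)) m n = 0 := by simp [expand]

lemma expand_zero_left (f : ℤ → ℤ → V) (m n : ℤ) : expand 0 f m n = f m n := by
  rw [expand, finsum_eq_single _ 0]
  · simp
  · intro i hi
    obtain ⟨j, rfl⟩ := Nat.exists_eq_succ_of_ne_zero hi
    rw [Nat.succ_eq_add_one, signedChoose_zero_succ, zero_smul]

lemma expand_succ {f : ℤ → ℤ → V} (hf : IsTruncated f) (l m n : ℤ) :
    expand (l + 1) f m n = expand l f (m + 1) n - expand l f m (n + 1) := by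
  obtain ⟨K, hK⟩ := hf.exists_bound n
  rw [expand_eq_sum_range (K := K + 1) (fun m k hk => hK m k (by push_cast at hk; omega)),
    expand_eq_sum_range (K := K + 1) (fun m k hk => hK m k (by push_cast at hk; omega)),
    expand_eq_sum_range (K := K) (fun m k hk => hK m k (by omega)),
    Finset.sum_range_succ', Finset.sum_range_succ' _ K, add_sub_right_comm (Finset.sum _ _),
    ← Finset.sum_sub_distrib]
  congr 1
  · refine Finset.sum_congr rfl fun i _ => ?_
    rw [signedChoose_succ_succ, sub_smul]
    congr 3 <;> push_cast <;> ring_nf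
  · simp only [signedChoose_zero_right]
    congr 2
    ring

/-- The derivation `∂_x + ∂_y` kills `x - y`, hence commutes with multiplication by
`(x - y)^l`. -/
lemma expand_deriv {f : ℤ → ℤ → V} (hf : IsTruncated f) (l m n : ℤ) :
    expand l (fun m n => m • f (m - 1) n + n • f m (n - 1)) m n =
      m • expand l f (m - 1) n + n • expand l f m (n - 1) := by
  obtain ⟨K, hK⟩ := hf.exists_bound (n - 1)
  -- the error terms in the comparison of the summands telescope
  let e (i : ℕ) : V := ((i : ℤ) * signedChoose l i) • f (m + l - i) (n - 1 + i)
  have summand_eq (i : ℕ) : signedChoose l i •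
        ((m + l - i) • f (m + l - i - 1) (n + i) + (n + i) • f (m + l - i) (n + i - 1)) =
      m • (signedChoose l i • f (m - 1 + l - i) (n + i)) +
        n • (signedChoose l i • f (m + l - i) (n - 1 + i)) + (e i - e (i + 1)) := by
    simp only [e]
    push_cast
    rw [succ_mul_signedChoose_succ, show m + l - (i : ℤ) - 1 = m - 1 + l - i by ring,
      show n + (i : ℤ) - 1 = n - 1 + i by ring, show m + l - ((i : ℤ) + 1) = m - 1 + l - i by ring,
      show n - 1 + ((i : ℤ) + 1) = n + i by ring]
    module
  have e_zero : e 0 = 0 := by simp [e]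
  have e_last : e (K + 1) = 0 := by
    simp only [e, hK _ _ (show n - 1 + (K : ℤ) ≤ n - 1 + (K + 1 : ℕ) by push_cast; omega),
      smul_zero]
  rw [expand_eq_sum_range (K := K + 1) (fun m k hk => by
      rw [hK _ _ (by push_cast at hk; omega), hK _ _ (by push_cast at hk; omega)]; simp),
    expand_eq_sum_range (K := K + 1) (fun m k hk => hK m k (by push_cast at hk; omega)),
    expand_eq_sum_range (K := K + 1) (fun m k hk => hK m k (by push_cast at hk; omega)),
    Finset.sum_congr rfl fun i _ => summand_eq i, Finset.sum_add_distrib, Finset.sum_add_distrib,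
    Finset.sum_range_sub', Finset.smul_sum, Finset.smul_sum, e_zero, e_last, sub_zero, add_zero]

variable {f : ℤ → ℤ → V}

lemma IsTruncated.expand (hf : IsTruncated f) (l : ℤ) : IsTruncated (expand l f) := by
  obtain ⟨N, hN⟩ := hf
  refine ⟨N, fun m n hn => ?_⟩
  rw [VertexData.expand, finsum_eq_zero_of_forall_eq_zero]
  intro i
  rw [hN _ _ (by omega), smul_zero]

lemma expand_expand (hf : IsTruncated f) (l : ℤ) (N : ℕ) (m n : ℤ) :
    expand N (expand l f) m n = expand (l + N) f m n := by
  induction N generalizing m n with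
  | zero => rw [Nat.cast_zero, expand_zero_left, add_zero]
  | succ N ih =>
    push_cast
    rw [expand_succ (hf.expand l), ih, ih, ← add_assoc, expand_succ hf]

lemma expand_swap (hf : IsTruncated f) (hf' : IsTruncated fun n m => f m n)
    (N : ℕ) (m n : ℤ) :
    expand N (fun n m => f m n) n m = Int.negOnePow N • expand N f m n := by
  induction N generalizing m n with
  | zero => simp [expand_zero_left]
  | succ N ih =>
    push_cast
    rw [expand_succ hf', ih, ih, expand_succ hf, Int.negOnePow_succ, Units.neg_smul, smul_sub,
      neg_sub]

end Expand

/-! ### Distributions in three variables -/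

lemma pow_sub_apply_eq_zero {R M : Type*} [Ring R] [AddCommGroup M] [Module R M]
    {a b : Module.End R M} (hab : Commute a b) {v : M} {K N : ℕ} (ha : (a ^ K) v = 0)
    (hb : (b ^ N) v = 0) : ((b - a) ^ (N + K)) v = 0 := by
  have hba : Commute b (-a) := hab.symm.neg_right
  rw [sub_eq_add_neg, hba.add_pow, LinearMap.sum_apply]
  refine Finset.sum_eq_zero fun i _ => ?_
  rw [← nsmul_eq_mul', LinearMap.smul_apply]
  rcases le_or_gt N i with hi | hi
  · rw [(hba.pow_pow _ _).eq, Module.End.mul_apply, Module.End.pow_map_zero_of_le hi hb, map_zero,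
      smul_zero]
  · rw [neg_pow, Module.End.mul_apply, Module.End.mul_apply,
      Module.End.pow_map_zero_of_le (show K ≤ N + K - i by omega) ha, map_zero, map_zero,
      smul_zero]

lemma pow_apply_of_apply_eq_succ {X : Type*} [AddCommGroup X] {D : Module.End ℤ X} {F : ℤ → X}
    (h : ∀ l, D (F l) = F (l + 1)) (l : ℤ) (K : ℕ) : (D ^ K) (F l) = F (l + K) := by
  induction K with
  | zero => simp
  | succ K ih => rw [pow_succ', Module.End.mul_apply, ih, h, Nat.cast_succ, add_assoc]

section ThreeVariables

variable (V : Type*) [AddCommGroup V]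

/-- Multiplication by `x` on distributions `∑ F m n k x^{-m-1} y^{-n-1} z^{-k-1}`. -/
def mulX : Module.End ℤ (ℤ → ℤ → ℤ → V) where
  toFun F m n k := F (m + 1) n k
  map_add' _ _ := rfl
  map_smul' _ _ := rfl

/-- Multiplication by `y` on distributions `∑ F m n k x^{-m-1} y^{-n-1} z^{-k-1}`. -/
def mulY : Module.End ℤ (ℤ → ℤ → ℤ → V) where
  toFun F m n k := F m (n + 1) k
  map_add' _ _ := rfl
  map_smul' _ _ := rfl

/-- Multiplication by `z` on distributions `∑ F m n k x^{-m-1} y^{-n-1} z^{-k-1}`. -/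
def mulZ : Module.End ℤ (ℤ → ℤ → ℤ → V) where
  toFun F m n k := F m n (k + 1)
  map_add' _ _ := rfl
  map_smul' _ _ := rfl

/-- The exchange of `x` and `y` on distributions in three variables. -/
def swapXY : Module.End ℤ (ℤ → ℤ → ℤ → V) where
  toFun F m n k := F n m k
  map_add' _ _ := rfl
  map_smul' _ _ := rfl

lemma commute_mulX_mulY : Commute (mulX V) (mulY V) := rfl

lemma commute_mulX_mulZ : Commute (mulX V) (mulZ V) := rfl

lemma commute_mulY_mulZ : Commute (mulY V) (mulZ V) := rfl

lemma commute_mulX_sub_mulZ_mulY_sub_mulZ :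
    Commute (mulX V - mulZ V) (mulY V - mulZ V) :=
  ((commute_mulX_mulY V).sub_right (commute_mulX_mulZ V)).sub_left
    ((commute_mulY_mulZ V).symm.sub_right (.refl _))

lemma commute_mulX_sub_mulY_mulX_sub_mulZ :
    Commute (mulX V - mulY V) (mulX V - mulZ V) :=
  ((Commute.refl _).sub_right (commute_mulX_mulZ V)).sub_left
    ((commute_mulX_mulY V).symm.sub_right (commute_mulY_mulZ V))

lemma commute_mulX_sub_mulY_mulY_sub_mulZ :
    Commute (mulX V - mulY V) (mulY V - mulZ V) :=
  ((commute_mulX_mulY V).sub_right (commute_mulX_mulZ V)).sub_left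
    ((Commute.refl _).sub_right (commute_mulY_mulZ V))

lemma semiconjBy_swapXY_pow (N : ℕ) :
    SemiconjBy (swapXY V) ((mulX V - mulZ V) ^ N) ((mulY V - mulZ V) ^ N) :=
  have h : SemiconjBy (swapXY V) (mulX V - mulZ V) (mulY V - mulZ V) := rfl
  h.pow_right N

lemma semiconjBy_swapXY_pow' (N : ℕ) :
    SemiconjBy (swapXY V) ((mulY V - mulZ V) ^ N) ((mulX V - mulZ V) ^ N) :=
  have h : SemiconjBy (swapXY V) (mulY V - mulZ V) (mulX V - mulZ V) := rfl
  h.pow_right N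

variable {V}

/-- The distribution `(x - y)^l F(x, y, z)`, with `(x - y)^l` expanded in nonnegative powers
of `y`. -/
def expand₃ (l : ℤ) (F : ℤ → ℤ → ℤ → V) (m n k : ℤ) : V := expand l (fun m n => F m n k) m n

/-- An operator on distributions in three variables which preserves truncated ones and commutes
with multiplication by the expansion of `(x - y)^l`. -/
structure PreservesExpand (l : ℤ) (D : Module.End ℤ (ℤ → ℤ → ℤ → V)) : Prop where
  isTruncated : ∀ {F : ℤ → ℤ → ℤ → V}, (∀ k, IsTruncated fun m n => F m n k) →
    ∀ k, IsTruncated fun m n => D F m n k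
  map_expand₃ : ∀ {F : ℤ → ℤ → ℤ → V}, (∀ k, IsTruncated fun m n => F m n k) →
    D (expand₃ l F) = expand₃ l (D F)

lemma preservesExpand_mulX (l : ℤ) : PreservesExpand l (mulX V) where
  isTruncated hF k := by simpa [mulX] using (hF k).shift 1 0
  map_expand₃ _ := by
    funext m n k
    exact finsum_congr fun i => by simp only [mulX, LinearMap.coe_mk, AddHom.coe_mk]; ring_nf

lemma preservesExpand_mulY (l : ℤ) : PreservesExpand l (mulY V) where
  isTruncated hF k := by simpa [mulY] using (hF k).shift 0 1
  map_expand₃ _ := by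
    funext m n k
    exact finsum_congr fun i => by simp only [mulY, LinearMap.coe_mk, AddHom.coe_mk]; ring_nf

lemma preservesExpand_mulZ (l : ℤ) : PreservesExpand l (mulZ V) where
  isTruncated hF k := hF (k + 1)
  map_expand₃ _ := rfl

namespace PreservesExpand

variable {l : ℤ} {D D' : Module.End ℤ (ℤ → ℤ → ℤ → V)}

lemma sub (hD : PreservesExpand l D) (hD' : PreservesExpand l D') :
    PreservesExpand l (D - D') where
  isTruncated hF k := (hD.isTruncated hF k).sub (hD'.isTruncated hF k)
  map_expand₃ hF := by
    rw [LinearMap.sub_apply, hD.map_expand₃ hF, hD'.map_expand₃ hF]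
    funext m n k
    exact (expand_sub (hD.isTruncated hF k) (hD'.isTruncated hF k) l m n).symm

lemma mul (hD : PreservesExpand l D) (hD' : PreservesExpand l D') :
    PreservesExpand l (D * D') where
  isTruncated hF := hD.isTruncated (hD'.isTruncated hF)
  map_expand₃ hF := by
    rw [Module.End.mul_apply, hD'.map_expand₃ hF, hD.map_expand₃ (hD'.isTruncated hF)]
    rfl

lemma pow (hD : PreservesExpand l D) (N : ℕ) : PreservesExpand l (D ^ N) := by
  induction N with
  | zero => exact ⟨fun hF => hF, fun _ => rfl⟩
  | succ N ih =>
    rw [pow_succ]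
    exact ih.mul hD

end PreservesExpand

end ThreeVariables

/-! ### Products of fields -/

section Fields

variable {R V : Type*} [CommRing R] [AddCommGroup V] [Module R V]

lemma exists_ncoeff_eq_zero (A : VertexOperator R V) (v : V) :
    ∃ N : ℤ, ∀ n, N ≤ n → ncoeff A n v = 0 :=
  ⟨-((HahnModule.of R).symm (A v)).order, fun n hn =>
    HahnSeries.coeff_eq_zero_of_lt_order (show -n - 1 < _ by omega)⟩

lemma ncoeff_injective :
    Function.Injective (ncoeff : VertexOperator R V → ℤ → Module.End R V) := by
  intro A B h
  apply HVertexOperator.coeff_inj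
  funext n
  simpa using congrFun h (-n - 1)

/-- The vertex operator with given modes. -/
def ofModes (f : ℤ → Module.End R V) (hf : ∀ v, ∃ N : ℤ, ∀ n, N ≤ n → f n v = 0) :
    VertexOperator R V :=
  of_coeff (fun n => f (-n - 1)) fun v => by
    obtain ⟨N, hN⟩ := hf v
    refine ⟨-N, fun n hn => ?_⟩
    by_contra h
    exact hn (hN _ (by omega))

@[simp] lemma ncoeff_ofModes (f : ℤ → Module.End R V)
    (hf : ∀ v, ∃ N : ℤ, ∀ n, N ≤ n → f n v = 0) (n : ℤ) : ncoeff (ofModes f hf) n = f n := by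
  rw [ofModes, ncoeff_of_coeff]
  congr 1
  ring

lemma isTruncated_comp (A B : VertexOperator R V) (w : V) :
    IsTruncated fun m n => ncoeff A m (ncoeff B n w) := by
  obtain ⟨N, hN⟩ := exists_ncoeff_eq_zero B w
  exact ⟨N, fun m n h => by simp only [hN n h, map_zero]⟩

/-- The coefficients of `(x - y)^l A(x) B(y)`, expanded in nonnegative powers of `y`. -/
def orderedProd (l m n : ℤ) :
    VertexOperator R V →ₗ[R] VertexOperator R V →ₗ[R] Module.End R V :=
  LinearMap.mk₂ R
    (fun A B =>
      { toFun w := expand l (fun m n => ncoeff A m (ncoeff B n w)) m n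
        map_add' v w := by
          simpa only [map_add] using
            expand_add (isTruncated_comp A B v) (isTruncated_comp A B w) l m n
        map_smul' c w := by
          simpa only [map_smul, LinearMap.lsmul_apply, RingHom.id_apply] using
            (map_expand (isTruncated_comp A B w) (LinearMap.lsmul R V c) l m n).symm })
    (fun A A' B => LinearMap.ext fun w =>
      expand_add (isTruncated_comp A B w) (isTruncated_comp A' B w) l m n)
    (fun c A B => LinearMap.ext fun w =>
      (map_expand (isTruncated_comp A B w) (LinearMap.lsmul R V c) l m n).symm)
    (fun A B B' => LinearMap.ext fun w =>
      have h (m n : ℤ) : ncoeff A m (ncoeff (B + B') n w) =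
          ncoeff A m (ncoeff B n w) + ncoeff A m (ncoeff B' n w) := map_add (ncoeff A m) _ _
      (congrArg (expand l · m n) (funext₂ h)).trans
        (expand_add (isTruncated_comp A B w) (isTruncated_comp A B' w) l m n))
    (fun c A B => LinearMap.ext fun w =>
      have h (m n : ℤ) : ncoeff A m (ncoeff (c • B) n w) =
          LinearMap.lsmul R V c (ncoeff A m (ncoeff B n w)) := map_smul (ncoeff A m) _ _
      (congrArg (expand l · m n) (funext₂ h)).trans
        (map_expand (isTruncated_comp A B w) (LinearMap.lsmul R V c) l m n).symm)

lemma orderedProd_apply (l m n : ℤ) (A B : VertexOperator R V) (w : V) :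
    orderedProd l m n A B w = expand l (fun m n => ncoeff A m (ncoeff B n w)) m n := rfl

/-- The coefficients of `(x - y)^l A(x) B(y) - (-y + x)^l B(y) A(x)`. -/
def borcherdsProd (l m n : ℤ) :
    VertexOperator R V →ₗ[R] VertexOperator R V →ₗ[R] Module.End R V :=
  orderedProd l m n - Int.negOnePow l • (orderedProd l n m).flip

lemma borcherdsProd_apply (l m n : ℤ) (A B : VertexOperator R V) :
    borcherdsProd l m n A B = orderedProd l m n A B - Int.negOnePow l • orderedProd l n m B A := rfl

lemma orderedProd_zero (m n : ℤ) (A B : VertexOperator R V) :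
    orderedProd 0 m n A B = ncoeff A m * ncoeff B n :=
  LinearMap.ext fun w => expand_zero_left (fun m n => ncoeff A m (ncoeff B n w)) m n

lemma orderedProd_succ (l m n : ℤ) (A B : VertexOperator R V) :
    orderedProd (l + 1) m n A B = orderedProd l (m + 1) n A B - orderedProd l m (n + 1) A B :=
  LinearMap.ext fun w => expand_succ (isTruncated_comp A B w) l m n

lemma borcherdsProd_zero (m n : ℤ) (A B : VertexOperator R V) :
    borcherdsProd 0 m n A B = ncoeff A m * ncoeff B n - ncoeff B n * ncoeff A m := by
  simp [borcherdsProd_apply, orderedProd_zero]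

lemma borcherdsProd_succ (l m n : ℤ) (A B : VertexOperator R V) :
    borcherdsProd (l + 1) m n A B =
      borcherdsProd l (m + 1) n A B - borcherdsProd l m (n + 1) A B := by
  simp only [borcherdsProd_apply, orderedProd_succ, Int.negOnePow_succ, smul_sub, Units.neg_smul]
  abel

lemma borcherdsProd_swap (l m n : ℤ) (A B : VertexOperator R V) :
    borcherdsProd l n m B A = -(Int.negOnePow l • borcherdsProd l m n A B) := by
  simp only [borcherdsProd_apply, smul_sub, smul_smul, Int.units_mul_self, one_smul]
  abel

lemma exists_borcherdsProd_eq_zero (l m : ℤ) (A B : VertexOperator R V) (w : V) :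
    ∃ N : ℤ, ∀ n, N ≤ n → borcherdsProd l m n A B w = 0 := by
  obtain ⟨N, hN⟩ := exists_ncoeff_eq_zero B w
  obtain ⟨K, hK⟩ := (isTruncated_comp B A w).exists_bound m
  choose M hM using fun i : ℕ => exists_ncoeff_eq_zero B (ncoeff A (m + i) w)
  obtain ⟨M', hM'⟩ := ((Finset.range K).image M).exists_le
  refine ⟨max N (M' + K - l), fun n hn => ?_⟩
  have hAB : orderedProd l m n A B w = 0 := by
    rw [orderedProd_apply, expand_eq_sum_range (K := 0) fun m k hk => by
      rw [hN k (by push_cast at hk; omega), map_zero], Finset.sum_range_zero]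
  have hBA : orderedProd l n m B A w = 0 := by
    rw [orderedProd_apply, expand_eq_sum_range hK]
    refine Finset.sum_eq_zero fun i hi => ?_
    have h₁ := hM' (M i) (Finset.mem_image_of_mem _ hi)
    have h₂ := Finset.mem_range.mp hi
    rw [hM i _ (by omega), smul_zero]
  rw [borcherdsProd_apply, LinearMap.sub_apply, LinearMap.smul_apply, hAB, hBA, smul_zero,
    sub_zero]

/-- The `l`-th product `A(y)_l B(y) = Res_x ((x - y)^l A(x) B(y) - (-y + x)^l B(y) A(x))`. -/
def nprod (A B : VertexOperator R V) (l : ℤ) : VertexOperator R V :=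
  ofModes (fun n => borcherdsProd l 0 n A B) (exists_borcherdsProd_eq_zero l 0 A B)

@[simp] lemma ncoeff_nprod (A B : VertexOperator R V) (l n : ℤ) :
    ncoeff (nprod A B l) n = borcherdsProd l 0 n A B :=
  ncoeff_ofModes _ _ n

variable (R V) in
/-- The identity field. -/
def idField : VertexOperator R V :=
  ofModes (fun n => if n = -1 then 1 else 0) fun _ =>
    ⟨0, fun n hn => by rw [if_neg (by omega), LinearMap.zero_apply]⟩

@[simp] lemma ncoeff_idField (n : ℤ) : ncoeff (idField R V) n = if n = -1 then 1 else 0 :=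
  ncoeff_ofModes _ _ n

/-! ### Locality -/

/-- Two vertex operators are local if `(x - y)^N [A(x), B(y)] = 0` for some `N`. -/
def IsLocal (A B : VertexOperator R V) : Prop := ∃ N : ℕ, ∀ m n : ℤ, borcherdsProd N m n A B = 0

namespace IsLocal

variable {A A' B C : VertexOperator R V}

lemma exists_forall_le (h : IsLocal A B) :
    ∃ N : ℕ, ∀ l : ℤ, N ≤ l → ∀ m n : ℤ, borcherdsProd l m n A B = 0 := by
  obtain ⟨N, hN⟩ := h
  refine ⟨N, fun l hl => Int.leInduction hN (fun l _ ih m n => ?_) l hl⟩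
  rw [borcherdsProd_succ, ih, ih, sub_zero]

lemma symm (h : IsLocal A B) : IsLocal B A := by
  obtain ⟨N, hN⟩ := h
  exact ⟨N, fun m n => by rw [borcherdsProd_swap, hN, smul_zero, neg_zero]⟩

lemma of_commute (h : ∀ m n, Commute (ncoeff A m) (ncoeff B n)) : IsLocal A B :=
  ⟨0, fun m n => by rw [Nat.cast_zero, borcherdsProd_zero, (h m n).eq, sub_self]⟩

lemma idField_left (A : VertexOperator R V) : IsLocal (idField R V) A :=
  of_commute fun m n => by
    rw [ncoeff_idField]
    split_ifs
    exacts [.one_left _, .zero_left _]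

lemma add (h : IsLocal A B) (h' : IsLocal A' B) : IsLocal (A + A') B := by
  obtain ⟨N, hN⟩ := h.exists_forall_le
  obtain ⟨M, hM⟩ := h'.exists_forall_le
  exact ⟨max N M, fun m n => by
    rw [map_add, LinearMap.add_apply, hN _ (by simp), hM _ (by simp), add_zero]⟩

lemma smul (c : R) (h : IsLocal A B) : IsLocal (c • A) B := by
  obtain ⟨N, hN⟩ := h
  exact ⟨N, fun m n => by rw [map_smul, LinearMap.smul_apply, hN, smul_zero]⟩

end IsLocal

section Dong

variable {A B C : VertexOperator R V}

/-- The coefficients of `[(x - y)^l A(x) B(y), C(z)] w`, with `(x - y)^l` expanded in nonnegative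
powers of `y`. -/
def orderedComm (A B C : VertexOperator R V) (l : ℤ) (w : V) (m n k : ℤ) : V :=
  orderedProd l m n A B (ncoeff C k w) - ncoeff C k (orderedProd l m n A B w)

lemma isTruncated_orderedComm (A B C : VertexOperator R V) (w : V) (k : ℤ) :
    IsTruncated fun m n => orderedComm A B C 0 w m n k := by
  simpa only [orderedComm, orderedProd_zero, Module.End.mul_apply] using
    (isTruncated_comp A B (ncoeff C k w)).sub ((isTruncated_comp A B w).map (ncoeff C k))

lemma orderedComm_eq_expand₃ (A B C : VertexOperator R V) (l : ℤ) (w : V) :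
    orderedComm A B C l w = expand₃ l (orderedComm A B C 0 w) := by
  funext m n k
  have h := isTruncated_comp A B w
  rw [orderedComm, orderedProd_apply, orderedProd_apply, map_expand h,
    ← expand_sub (isTruncated_comp A B _) (h.map _)]
  simp only [expand₃, orderedComm, orderedProd_zero, Module.End.mul_apply]

/-- `[A(x) B(y), C(z)] = A(x) [B(y), C(z)] + [A(x), C(z)] B(y)`, and the two summands are killed
by `(y - z)^N` and `(x - z)^N` respectively. -/
lemma mulX_sub_mulZ_pow_mul_orderedComm {N : ℕ} (hA : ∀ m n, borcherdsProd N m n A C = 0)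
    (hB : ∀ m n, borcherdsProd N m n B C = 0) (l : ℤ) (w : V) :
    ((mulX V - mulZ V) ^ N * (mulY V - mulZ V) ^ N) (orderedComm A B C l w) = 0 := by
  let G (j m n k : ℤ) : V := ncoeff A m (borcherdsProd j n k B C w)
  let H (j m n k : ℤ) : V := borcherdsProd j m k A C (ncoeff B n w)
  have hG : ((mulY V - mulZ V) ^ N) (G 0) = 0 := by
    rw [pow_apply_of_apply_eq_succ (F := G) fun j => by
      funext m n k
      simp [mulY, mulZ, G, borcherdsProd_succ]]
    funext m n k
    simp [G, hB]
  have hH : ((mulX V - mulZ V) ^ N) (H 0) = 0 := by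
    rw [pow_apply_of_apply_eq_succ (F := H) fun j => by
      funext m n k
      simp [mulX, mulZ, H, borcherdsProd_succ]]
    funext m n k
    simp [H, hA]
  have hGH : orderedComm A B C 0 w = G 0 + H 0 := by
    funext m n k
    simp [orderedComm, G, H, borcherdsProd_zero, orderedProd_zero]
  have hcomm := (commute_mulX_sub_mulZ_mulY_sub_mulZ V).pow_pow N N
  have hD := (((preservesExpand_mulX l).sub (preservesExpand_mulZ l)).pow N).mul
    (((preservesExpand_mulY l).sub (preservesExpand_mulZ (V := V) l)).pow N)
  rw [orderedComm_eq_expand₃, hD.map_expand₃ (isTruncated_orderedComm A B C w), hGH, map_add,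
    Module.End.mul_apply, hG, map_zero, hcomm.eq, Module.End.mul_apply, hH, map_zero, add_zero]
  exact funext fun m => funext fun n => funext fun _ => expand_zero l m n

/-- The coefficients of `[(x - y)^l A(x) B(y) - (-y + x)^l B(y) A(x), C(z)] w`. -/
def borcherdsComm (A B C : VertexOperator R V) (l : ℤ) (w : V) (m n k : ℤ) : V :=
  borcherdsProd l m n A B (ncoeff C k w) - ncoeff C k (borcherdsProd l m n A B w)

lemma mulX_sub_mulY_borcherdsComm (A B C : VertexOperator R V) (l : ℤ) (w : V) :
    (mulX V - mulY V) (borcherdsComm A B C l w) = borcherdsComm A B C (l + 1) w := by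
  funext m n k
  simp only [mulX, mulY, borcherdsComm, borcherdsProd_succ, map_sub, LinearMap.coe_mk,
    AddHom.coe_mk, LinearMap.sub_apply, Pi.sub_apply]
  abel

lemma borcherdsComm_eq (A B C : VertexOperator R V) (l : ℤ) (w : V) :
    borcherdsComm A B C l w = orderedComm A B C l w -
      ((Int.negOnePow l : ℤˣ) : ℤ) • swapXY V (orderedComm B A C l w) := by
  funext m n k
  simp only [borcherdsComm, borcherdsProd_apply, orderedComm, swapXY, Pi.sub_apply, Pi.smul_apply,
    LinearMap.coe_mk, AddHom.coe_mk, Units.smul_def, LinearMap.sub_apply, LinearMap.smul_apply,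
    map_sub, map_zsmul, smul_sub]
  abel

lemma mulX_sub_mulZ_pow_mul_borcherdsComm {N : ℕ} (hA : ∀ m n, borcherdsProd N m n A C = 0)
    (hB : ∀ m n, borcherdsProd N m n B C = 0) (l : ℤ) (w : V) :
    ((mulX V - mulZ V) ^ N * (mulY V - mulZ V) ^ N) (borcherdsComm A B C l w) = 0 := by
  have hswap : ((mulX V - mulZ V) ^ N * (mulY V - mulZ V) ^ N) (swapXY V (orderedComm B A C l w)) =
      swapXY V (((mulX V - mulZ V) ^ N * (mulY V - mulZ V) ^ N) (orderedComm B A C l w)) := by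
    have h := (semiconjBy_swapXY_pow V N).mul_right (semiconjBy_swapXY_pow' V N)
    rw [← ((commute_mulX_sub_mulZ_mulY_sub_mulZ V).pow_pow N N).eq] at h
    exact (LinearMap.congr_fun h.eq _).symm
  rw [borcherdsComm_eq, map_sub, map_smul, hswap, mulX_sub_mulZ_pow_mul_orderedComm hA hB,
    mulX_sub_mulZ_pow_mul_orderedComm hB hA, map_zero, smul_zero, sub_zero]

lemma mulY_sub_mulZ_pow_borcherdsComm (A B C : VertexOperator R V) (l : ℤ) (w : V) (j : ℕ)
    (n k : ℤ) :
    ((mulY V - mulZ V) ^ j) (borcherdsComm A B C l w) 0 n k =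
      borcherdsProd j n k (nprod A B l) C w := by
  induction j generalizing n k with
  | zero => simp [borcherdsProd_zero, borcherdsComm]
  | succ j ih =>
    rw [pow_succ', Module.End.mul_apply, Nat.cast_succ, borcherdsProd_succ, LinearMap.sub_apply,
      LinearMap.sub_apply, ← ih, ← ih]
    rfl

/-- Dong's lemma. -/
theorem IsLocal.nprod (hAB : IsLocal A B) (hAC : IsLocal A C) (hBC : IsLocal B C) (l : ℤ) :
    IsLocal (nprod A B l) C := by
  obtain ⟨N₁, h₁⟩ := hAB.exists_forall_le
  obtain ⟨N₂, h₂⟩ := hAC.exists_forall_le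
  obtain ⟨N₃, h₃⟩ := hBC.exists_forall_le
  set N := max N₂ N₃
  set K := ((N₁ : ℤ) - l).toNat
  refine ⟨N + K + N, fun n k => LinearMap.ext fun w => ?_⟩
  set Q := borcherdsComm A B C l w
  have hXY : ((mulX V - mulY V) ^ K) Q = 0 := by
    rw [pow_apply_of_apply_eq_succ (F := fun j => borcherdsComm A B C j w) fun j =>
      mulX_sub_mulY_borcherdsComm A B C j w]
    funext m n k
    simp [borcherdsComm, h₁ (l + K) (by omega)]
  have hXZ : ((mulX V - mulZ V) ^ N) (((mulY V - mulZ V) ^ N) Q) = 0 :=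
    mulX_sub_mulZ_pow_mul_borcherdsComm (h₂ N (by simp [N])) (h₃ N (by simp [N])) l w
  have hXY' : ((mulX V - mulY V) ^ K) (((mulY V - mulZ V) ^ N) Q) = 0 := by
    have hcomm := (commute_mulX_sub_mulY_mulY_sub_mulZ V).pow_pow K N
    rw [← Module.End.mul_apply, hcomm.eq, Module.End.mul_apply, hXY, map_zero]
  -- `y - z = (x - z) - (x - y)`
  have hYZ := pow_sub_apply_eq_zero (commute_mulX_sub_mulY_mulX_sub_mulZ V) hXY' hXZ
  rw [sub_sub_sub_cancel_left, ← Module.End.mul_apply, ← pow_add] at hYZ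
  rw [← mulY_sub_mulZ_pow_borcherdsComm, hYZ]
  rfl

end Dong

lemma borcherdsProd_commutator {A B : VertexOperator R V} {H : Module.End R V} {a b : R} {k : ℤ}
    (hA : ∀ n, H * ncoeff A n = ncoeff A n * H + a • ncoeff A (n + k))
    (hB : ∀ n, H * ncoeff B n = ncoeff B n * H + b • ncoeff B (n + k)) (N : ℕ) (m n : ℤ) :
    H * borcherdsProd N m n A B = borcherdsProd N m n A B * H +
      a • borcherdsProd N (m + k) n A B + b • borcherdsProd N m (n + k) A B := by
  induction N generalizing m n with
  | zero =>
    simp only [Nat.cast_zero, borcherdsProd_zero, mul_sub, sub_mul, ← mul_assoc, hA, hB]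
    simp only [add_mul, mul_assoc, hA, hB, mul_add, smul_sub, mul_smul_comm, smul_mul_assoc]
    abel
  | succ N ih =>
    simp only [Nat.cast_succ, borcherdsProd_succ, mul_sub, sub_mul, ih, smul_sub,
      add_right_comm _ k 1]
    abel

end Fields

/-! ### Translation covariant and creative fields -/

section Covariant

variable {R V : Type*} [CommRing R] [AddCommGroup V] [Module R V] {T : Module.End R V} {vac : V}
  {A B : VertexOperator R V}

/-- The vertex operator is translation covariant: `[T, A(x)] = A'(x)`. -/
def IsCovariant (T : Module.End R V) (A : VertexOperator R V) : Prop :=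
  ∀ n : ℤ, T * ncoeff A n = ncoeff A n * T - n • ncoeff A (n - 1)

/-- `A(x)vac` has no negative powers of `x`. -/
def IsCreative (vac : V) (A : VertexOperator R V) : Prop :=
  ∀ n : ℤ, 0 ≤ n → ncoeff A n vac = 0

lemma IsCovariant.apply (hA : IsCovariant T A) (n : ℤ) (w : V) :
    T (ncoeff A n w) = ncoeff A n (T w) - n • ncoeff A (n - 1) w :=
  LinearMap.congr_fun (hA n) w

lemma IsCovariant.mul_orderedProd (hA : IsCovariant T A) (hB : IsCovariant T B) (l m n : ℤ) :
    T * orderedProd l m n A B = orderedProd l m n A B * T -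
      (m • orderedProd l (m - 1) n A B + n • orderedProd l m (n - 1) A B) := by
  ext w
  have h := isTruncated_comp A B w
  have h' : IsTruncated fun m n : ℤ => m • ncoeff A (m - 1) (ncoeff B n w) +
      n • ncoeff A m (ncoeff B (n - 1) w) := by
    obtain ⟨N, hN⟩ := exists_ncoeff_eq_zero B w
    exact ⟨N + 1, fun m n h => by simp [hN n (by omega), hN (n - 1) (by omega)]⟩
  simp only [Module.End.mul_apply, LinearMap.sub_apply, LinearMap.add_apply, LinearMap.smul_apply,
    orderedProd_apply]
  rw [map_expand h, ← expand_deriv h, ← expand_sub (isTruncated_comp A B (T w)) h']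
  congr 1
  funext m n
  rw [hA.apply, hB.apply, map_sub, map_zsmul]
  abel

lemma IsCovariant.nprod (hA : IsCovariant T A) (hB : IsCovariant T B) (l : ℤ) :
    IsCovariant T (nprod A B l) := by
  intro n
  rw [ncoeff_nprod, ncoeff_nprod, borcherdsProd_apply, borcherdsProd_apply, mul_sub, sub_mul,
    mul_smul_comm, smul_mul_assoc, hA.mul_orderedProd hB, hB.mul_orderedProd hA]
  simp only [Units.smul_def, zero_smul, zero_add, add_zero, smul_sub,
    smul_comm n ((Int.negOnePow l : ℤˣ) : ℤ)]
  abel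

lemma IsCovariant.add (hA : IsCovariant T A) (hB : IsCovariant T B) : IsCovariant T (A + B) := by
  intro n
  simp only [map_add, Pi.add_apply, mul_add, add_mul, hA n, hB n, smul_add]
  abel

lemma IsCovariant.smul (c : R) (hA : IsCovariant T A) : IsCovariant T (c • A) := by
  intro n
  simp only [map_smul, Pi.smul_apply, mul_smul_comm, smul_mul_assoc, hA n, smul_sub,
    smul_comm n c]

lemma IsCovariant.idField : IsCovariant T (idField R V) := by
  intro n
  simp only [ncoeff_idField]
  rcases eq_or_ne n 0 with rfl | hn
  · simp
  · rw [if_neg (show ¬ n - 1 = -1 by omega)]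
    split_ifs <;> simp

lemma orderedProd_apply_vac (hB : IsCreative vac B) (l m : ℤ) {n : ℤ} (hn : 0 ≤ n) :
    orderedProd l m n A B vac = 0 := by
  rw [orderedProd_apply, expand_eq_sum_range (K := 0) fun m k hk => by
    rw [hB k (by push_cast at hk; omega), map_zero], Finset.sum_range_zero]

lemma orderedProd_neg_one_apply_vac (hB : IsCreative vac B) (l m : ℤ) :
    orderedProd l m (-1) A B vac = ncoeff A (m + l) (ncoeff B (-1) vac) := by
  rw [orderedProd_apply, expand_eq_sum_range (K := 1) fun m k hk => by
    rw [hB k (by push_cast at hk; omega), map_zero]]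
  simp

lemma ncoeff_nprod_neg_one_apply_vac (hA : IsCreative vac A) (hB : IsCreative vac B) (l : ℤ) :
    ncoeff (nprod A B l) (-1) vac = ncoeff A l (ncoeff B (-1) vac) := by
  rw [ncoeff_nprod, borcherdsProd_apply, LinearMap.sub_apply, LinearMap.smul_apply,
    orderedProd_neg_one_apply_vac hB, orderedProd_apply_vac hA _ _ le_rfl, smul_zero, sub_zero,
    zero_add]

lemma IsCreative.nprod (hA : IsCreative vac A) (hB : IsCreative vac B) (l : ℤ) :
    IsCreative vac (nprod A B l) := by
  intro n hn
  rw [ncoeff_nprod, borcherdsProd_apply, LinearMap.sub_apply, LinearMap.smul_apply,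
    orderedProd_apply_vac hB _ _ hn, orderedProd_apply_vac hA _ _ le_rfl, smul_zero, sub_zero]

lemma IsCreative.add (hA : IsCreative vac A) (hB : IsCreative vac B) : IsCreative vac (A + B) :=
  fun n hn => by simp [hA n hn, hB n hn]

lemma IsCreative.smul (c : R) (hA : IsCreative vac A) : IsCreative vac (c • A) :=
  fun n hn => by simp [hA n hn]

lemma IsCreative.idField : IsCreative vac (idField R V) :=
  fun n hn => by rw [ncoeff_idField, if_neg (by omega), LinearMap.zero_apply]

/-- A covariant field is determined on the vacuum by its value at `x = 0`, since
`n A_{n-1} vac = -T A_n vac`. -/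
lemma IsCovariant.ncoeff_vac_eq_zero [IsAddTorsionFree V] (hT : T vac = 0) (hA : IsCovariant T A)
    (hA' : IsCreative vac A) (h : ncoeff A (-1) vac = 0) (n : ℤ) : ncoeff A n vac = 0 := by
  rcases le_or_gt (-1) n with hn | hn
  · rcases hn.eq_or_lt with rfl | hn
    exacts [h, hA' n hn]
  · induction n, hn.le using Int.leInductionDown with
    | base => exact h
    | pred n hn' ih =>
      have ih' : ncoeff A n vac = 0 := hn'.eq_or_lt.elim (fun hn' => hn' ▸ h) ih
      have hn := hA.apply n vac
      rw [ih', hT, map_zero, map_zero, zero_sub, eq_comm, neg_eq_zero] at hn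
      exact (IsAddTorsionFree.zsmul_eq_zero_iff_right (by omega)).mp hn

/-- Goddard's uniqueness argument: on the vacuum, `(x - y)^N A(x) B(y)` equals
`(x - y)^N B(y) A(x)`. -/
lemma IsLocal.ncoeff_ncoeff_vac_eq_zero (hAB : IsLocal A B) (hB : IsCreative vac B)
    (h : ∀ n, ncoeff A n vac = 0) (n : ℤ) : ncoeff A n (ncoeff B (-1) vac) = 0 := by
  obtain ⟨N, hN⟩ := hAB
  have hBA : orderedProd N (-1) (n - N) B A vac = 0 := by
    rw [orderedProd_apply, expand_eq_sum_range (K := 0) fun m k _ => by rw [h k, map_zero],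
      Finset.sum_range_zero]
  have hAB := LinearMap.congr_fun (hN (n - N) (-1)) vac
  rwa [borcherdsProd_apply, LinearMap.sub_apply, LinearMap.smul_apply, hBA,
    orderedProd_neg_one_apply_vac hB, smul_zero, sub_zero, sub_add_cancel] at hAB

lemma eq_zero_of_isLocal [IsAddTorsionFree V] {F : Set (VertexOperator R V)} (hT : T vac = 0)
    (hF : ∀ B ∈ F, IsCreative vac B) (hF' : ∀ v, ∃ B ∈ F, ncoeff B (-1) vac = v)
    (hcov : IsCovariant T A) (hcre : IsCreative vac A) (hloc : ∀ B ∈ F, IsLocal A B)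
    (h : ncoeff A (-1) vac = 0) : A = 0 := by
  refine ncoeff_injective (funext fun n => LinearMap.ext fun v => ?_)
  obtain ⟨B, hB, rfl⟩ := hF' v
  rw [(hloc B hB).ncoeff_ncoeff_vac_eq_zero (hF B hB) (hcov.ncoeff_vac_eq_zero hT hcre h), map_zero]
  rfl

end Covariant

/-! ### The Jacobi identity -/

lemma eq_zero_of_recurrence {V : Type*} [AddCommGroup V] {F : ℤ → ℤ → ℤ → V} {N : ℤ}
    (hF : ∀ l m n, F (l + 1) m n = F l (m + 1) n - F l m (n + 1)) (h₀ : ∀ l n, F l 0 n = 0)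
    (hN : ∀ l, N ≤ l → F l = 0) (l : ℤ) : F l = 0 := by
  rcases le_total N l with hl | hl
  · exact hN l hl
  · induction l, hl using Int.leInductionDown with
    | base => exact hN N le_rfl
    | pred l _ ih =>
      have hrec (m n : ℤ) : F (l - 1) (m + 1) n = F (l - 1) m (n + 1) := by
        have h := hF (l - 1) m n
        rw [sub_add_cancel, ih] at h
        exact sub_eq_zero.mp h.symm
      funext m n
      induction m using Int.induction_on generalizing n with
      | zero => exact h₀ _ _
      | succ m ihm => rw [hrec, ihm]; rfl
      | pred m ihm =>
        have h := hrec (-m - 1) (n - 1)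
        rw [sub_add_cancel, sub_add_cancel, ihm] at h
        exact h.symm

section Jacobi

variable {V : Type*} [AddCommGroup V] [Module ℂ V] (𝒱 : VertexData V)

@[simp] lemma mode_add_left (u v : V) (n : ℤ) : 𝒱.mode (u + v) n = 𝒱.mode u n + 𝒱.mode v n := by
  simp [mode]

@[simp] lemma mode_smul_left (c : ℂ) (v : V) (n : ℤ) : 𝒱.mode (c • v) n = c • 𝒱.mode v n := by
  simp [mode]

@[simp] lemma mode_zero_left (n : ℤ) : 𝒱.mode 0 n = 0 := by simp [mode]

variable {𝒱} in
lemma ext_mode {𝒲 : VertexData V} (h : ∀ v n, 𝒱.mode v n = 𝒲.mode v n)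
    (h' : 𝒱.vac = 𝒲.vac) : 𝒱 = 𝒲 :=
  VertexData.ext (LinearMap.ext fun v => ncoeff_injective (funext (h v))) h'

/-- The left hand side of the Jacobi identity in components. -/
def iterateProd (l m n : ℤ) (u v w : V) : V :=
  ∑ᶠ i : ℕ, Ring.choose m i • 𝒱.mode (𝒱.mode u (l + i) v) (m + n - i) w

lemma iterateProd_eq_sum_range {u v : V} {l : ℤ} {K : ℕ}
    (hK : ∀ k, l + K ≤ k → 𝒱.mode u k v = 0) (m n : ℤ) (w : V) :
    𝒱.iterateProd l m n u v w =
      ∑ i ∈ Finset.range K, Ring.choose m i • 𝒱.mode (𝒱.mode u (l + i) v) (m + n - i) w := by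
  refine finsum_eq_sum_of_support_subset _ fun i hi => ?_
  by_contra h
  simp only [Finset.coe_range, Set.mem_Iio, not_lt] at h
  exact hi (by simp [hK (l + i) (by omega)])

lemma iterateProd_zero (l n : ℤ) (u v w : V) :
    𝒱.iterateProd l 0 n u v w = 𝒱.mode (𝒱.mode u l v) n w := by
  rw [iterateProd, finsum_eq_single _ 0]
  · simp
  · intro i hi
    obtain ⟨j, rfl⟩ := Nat.exists_eq_succ_of_ne_zero hi
    rw [Nat.succ_eq_add_one, Ring.choose_zero_succ, zero_smul]

lemma iterateProd_succ (l m n : ℤ) (u v w : V) :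
    𝒱.iterateProd (l + 1) m n u v w =
      𝒱.iterateProd l (m + 1) n u v w - 𝒱.iterateProd l m (n + 1) u v w := by
  obtain ⟨N, hN⟩ := exists_ncoeff_eq_zero (𝒱.Y u) v
  set K := (N - l).toNat
  have hK : N ≤ l + K := by omega
  rw [eq_sub_iff_add_eq,
    𝒱.iterateProd_eq_sum_range (l := l + 1) (K := K) fun k hk => hN k (by omega),
    𝒱.iterateProd_eq_sum_range (l := l) (K := K + 1) fun k hk => hN k (by push_cast at hk; omega),
    𝒱.iterateProd_eq_sum_range (l := l) (K := K + 1) fun k hk => hN k (by push_cast at hk; omega),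
    Finset.sum_range_succ', Finset.sum_range_succ' _ K, ← add_assoc, ← Finset.sum_add_distrib]
  congr 1
  · refine Finset.sum_congr rfl fun i _ => ?_
    rw [Ring.choose_succ_succ, add_smul]
    congr 3 <;> push_cast <;> ring_nf
  · simp only [Ring.choose_zero_right]
    congr 3
    push_cast
    ring

lemma finsum_jacobi_eq_borcherdsProd (u v w : V) (l m n : ℤ) :
    ∑ᶠ i : ℕ, ((-1) ^ i * Ring.choose l i : ℤ) •
        (𝒱.mode u (m + l - i) (𝒱.mode v (n + i) w)
          - Int.negOnePow l • 𝒱.mode v (n + l - i) (𝒱.mode u (m + i) w)) =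
      borcherdsProd l m n (𝒱.Y u) (𝒱.Y v) w := by
  have huv := isTruncated_comp (𝒱.Y u) (𝒱.Y v) w
  have hvu := isTruncated_comp (𝒱.Y v) (𝒱.Y u) w
  let φ : V →+ V := DistribSMul.toAddMonoidHom V (Int.negOnePow l)
  have h : Int.negOnePow l • orderedProd l n m (𝒱.Y v) (𝒱.Y u) w =
      expand l (fun n m => φ (ncoeff (𝒱.Y v) n (ncoeff (𝒱.Y u) m w))) n m := map_expand hvu φ l n m
  rw [borcherdsProd_apply, LinearMap.sub_apply, LinearMap.smul_apply, h, orderedProd_apply,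
    expand, expand, ← finsum_sub_distrib (huv.finite_support l m n)
      ((hvu.map φ).finite_support l n m)]
  simp only [smul_sub]
  rfl

lemma isVertexAlgebra_iff : 𝒱.IsVertexAlgebra ↔
    𝒱.Y 𝒱.vac = idField ℂ V ∧ (∀ v, IsCreative 𝒱.vac (𝒱.Y v)) ∧
    (∀ v, 𝒱.mode v (-1) 𝒱.vac = v) ∧ ∀ u v w l m n,
      𝒱.iterateProd l m n u v w = borcherdsProd l m n (𝒱.Y u) (𝒱.Y v) w := by
  have hvac : 𝒱.Y 𝒱.vac = idField ℂ V ↔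
      ∀ v n, 𝒱.mode 𝒱.vac n v = if n = -1 then v else 0 := by
    rw [← ncoeff_injective.eq_iff, funext_iff, forall_comm]
    refine forall_congr' fun n => ?_
    rw [ncoeff_idField, LinearMap.ext_iff]
    exact forall_congr' fun v => by split_ifs <;> rfl
  simp_rw [← finsum_jacobi_eq_borcherdsProd]
  exact ⟨fun h => ⟨hvac.mpr h.vacuum, h.creation_regular, h.creation, h.jacobi⟩,
    fun ⟨h₁, h₂, h₃, h₄⟩ => ⟨hvac.mp h₁, h₂, h₃, h₄⟩⟩

variable {𝒱}

/-- Both sides of the Jacobi identity satisfy the same recurrence in `l`, `m`, `n`, vanish for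
large `l`, and agree for `m = 0`. -/
lemma iterateProd_eq_borcherdsProd {u v : V} (hloc : IsLocal (𝒱.Y u) (𝒱.Y v))
    (hassoc : ∀ l, 𝒱.Y (𝒱.mode u l v) = nprod (𝒱.Y u) (𝒱.Y v) l) (l m n : ℤ) (w : V) :
    𝒱.iterateProd l m n u v w = borcherdsProd l m n (𝒱.Y u) (𝒱.Y v) w := by
  obtain ⟨N, hN⟩ := hloc.exists_forall_le
  obtain ⟨M, hM⟩ := exists_ncoeff_eq_zero (𝒱.Y u) v
  let F (l m n : ℤ) : V :=
    𝒱.iterateProd l m n u v w - borcherdsProd l m n (𝒱.Y u) (𝒱.Y v) w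
  have hF (l m n : ℤ) : F (l + 1) m n = F l (m + 1) n - F l m (n + 1) := by
    simp only [F, iterateProd_succ, borcherdsProd_succ, LinearMap.sub_apply]
    abel
  have h₀ (l n : ℤ) : F l 0 n = 0 := by
    simp only [F, iterateProd_zero]
    rw [mode, hassoc, ncoeff_nprod, sub_self]
  have hF' (l : ℤ) (hl : max (N : ℤ) M ≤ l) : F l = 0 := by
    funext m n
    simp only [F]
    rw [hN l (le_of_max_le_left hl), 𝒱.iterateProd_eq_sum_range (K := 0) fun k hk =>
      hM k (by have := le_of_max_le_right hl; omega)]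
    simp
  exact sub_eq_zero.mp (congrFun₂ (eq_zero_of_recurrence hF h₀ hF' l) m n)

/-- A state-field correspondence with mutually local fields which are creative and covariant with
respect to the translation operator `T`. -/
structure IsLocalFieldAlgebra (T : Module.End ℂ V) (𝒱 : VertexData V) : Prop where
  translation_vac : T 𝒱.vac = 0
  isCovariant : ∀ v, IsCovariant T (𝒱.Y v)
  isCreative : ∀ v, IsCreative 𝒱.vac (𝒱.Y v)
  creation : ∀ v, 𝒱.mode v (-1) 𝒱.vac = v
  isLocal : ∀ u v, IsLocal (𝒱.Y u) (𝒱.Y v)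

namespace IsLocalFieldAlgebra

variable {T : Module.End ℂ V} (h : IsLocalFieldAlgebra T 𝒱)
include h

lemma Y_ncoeff_vac {A : VertexOperator ℂ V} (hcov : IsCovariant T A) (hcre : IsCreative 𝒱.vac A)
    (hloc : ∀ v, IsLocal A (𝒱.Y v)) : 𝒱.Y (ncoeff A (-1) 𝒱.vac) = A := by
  have := IsAddTorsionFree.of_isTorsionFree ℂ V
  refine (sub_eq_zero.mp (eq_zero_of_isLocal (F := Set.range 𝒱.Y) h.translation_vac ?_
    (fun v => ⟨_, ⟨v, rfl⟩, h.creation v⟩) (T := T) ?_ ?_ ?_ ?_)).symm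
  · rintro _ ⟨v, rfl⟩
    exact h.isCreative v
  · rw [sub_eq_add_neg, ← neg_one_smul ℂ]
    exact hcov.add ((h.isCovariant _).smul _)
  · rw [sub_eq_add_neg, ← neg_one_smul ℂ]
    exact hcre.add ((h.isCreative _).smul _)
  · rintro _ ⟨v, rfl⟩
    rw [sub_eq_add_neg, ← neg_one_smul ℂ]
    exact (hloc v).add ((h.isLocal _ v).smul _)
  · rw [map_sub, Pi.sub_apply, LinearMap.sub_apply, sub_eq_zero]
    exact (h.creation _).symm

lemma Y_vac : 𝒱.Y 𝒱.vac = idField ℂ V := by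
  simpa using h.Y_ncoeff_vac .idField .idField fun v => .idField_left _

lemma Y_mode (u v : V) (l : ℤ) : 𝒱.Y (𝒱.mode u l v) = nprod (𝒱.Y u) (𝒱.Y v) l := by
  have huv := h.Y_ncoeff_vac ((h.isCovariant u).nprod (h.isCovariant v) l)
    ((h.isCreative u).nprod (h.isCreative v) l) fun w =>
      (h.isLocal u v).nprod (h.isLocal u w) (h.isLocal v w) l
  rw [ncoeff_nprod_neg_one_apply_vac (h.isCreative u) (h.isCreative v)] at huv
  rw [← huv]
  exact congrArg (fun w => 𝒱.Y (𝒱.mode u l w)) (h.creation v).symm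

theorem isVertexAlgebra : 𝒱.IsVertexAlgebra :=
  𝒱.isVertexAlgebra_iff.mpr ⟨h.Y_vac, h.isCreative, h.creation, fun u v w l m n =>
    iterateProd_eq_borcherdsProd (h.isLocal u v) (h.Y_mode u v) l m n w⟩

end IsLocalFieldAlgebra

end Jacobi

/-! ### Reconstruction -/

section Reconstruction

variable {R V : Type*} [CommRing R] [AddCommGroup V] [Module R V]
  {S : Set (VertexOperator R V)} {A B : VertexOperator R V}

/-- The fields obtained from the set `S` and the identity field by `n`-th products and linear
combinations. -/
inductive Generated (S : Set (VertexOperator R V)) : VertexOperator R V → Prop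
  | one : Generated S (idField R V)
  | nprod {A B : VertexOperator R V} (l : ℤ) (hA : A ∈ S) (hB : Generated S B) :
    Generated S (nprod A B l)
  | add {A B : VertexOperator R V} (hA : Generated S A) (hB : Generated S B) :
    Generated S (A + B)
  | smul {A : VertexOperator R V} (c : R) (hA : Generated S A) : Generated S (c • A)

namespace Generated

lemma isLocal_of_mem (hS : ∀ A ∈ S, ∀ B ∈ S, IsLocal A B) (hA : Generated S A) (hB : B ∈ S) :
    IsLocal A B := by
  induction hA generalizing B with
  | one => exact .idField_left _
  | nprod l hA _ ih => exact (ih hA).symm.nprod (hS _ hA _ hB) (ih hB) l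
  | add _ _ ih ih' => exact (ih hB).add (ih' hB)
  | smul c _ ih => exact (ih hB).smul c

lemma isLocal (hS : ∀ A ∈ S, ∀ B ∈ S, IsLocal A B) (hA : Generated S A) (hB : Generated S B) :
    IsLocal A B := by
  induction hA with
  | one => exact .idField_left _
  | nprod l hA hA' ih =>
    exact (hA'.isLocal_of_mem hS hA).symm.nprod (hB.isLocal_of_mem hS hA).symm ih l
  | add _ _ ih ih' => exact ih.add ih'
  | smul c _ ih => exact ih.smul c

lemma isCovariant {T : Module.End R V} (hS : ∀ A ∈ S, IsCovariant T A) (hA : Generated S A) :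
    IsCovariant T A := by
  induction hA with
  | one => exact .idField
  | nprod l hA _ ih => exact (hS _ hA).nprod ih l
  | add _ _ ih ih' => exact ih.add ih'
  | smul c _ ih => exact ih.smul c

lemma isCreative {vac : V} (hS : ∀ A ∈ S, IsCreative vac A) (hA : Generated S A) :
    IsCreative vac A := by
  induction hA with
  | one => exact .idField
  | nprod l hA _ ih => exact (hS _ hA).nprod ih l
  | add _ _ ih ih' => exact ih.add ih'
  | smul c _ ih => exact ih.smul c

end Generated

variable (S) in
/-- The module of fields generated by `S`. -/
def generated : Submodule R (VertexOperator R V) where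
  carrier := {A | Generated S A}
  add_mem' hA hB := hA.add hB
  zero_mem' := by simpa using Generated.smul (S := S) 0 .one
  smul_mem' c _ hA := hA.smul c

variable (S) in
/-- The map `A ↦ A(x)vac|_{x = 0}` on the fields generated by `S`. -/
def evalVac (vac : V) : generated S →ₗ[R] V where
  toFun A := ncoeff A.1 (-1) vac
  map_add' A B := by simp
  map_smul' c A := by simp

lemma evalVac_surjective {vac : V} (hcre : ∀ A ∈ S, IsCreative vac A)
    (hgen : ∀ p : Submodule R V, vac ∈ p →
      (∀ A ∈ S, ∀ (n : ℤ), ∀ v ∈ p, ncoeff A n v ∈ p) → p = ⊤) :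
    Function.Surjective (evalVac S vac) := by
  rw [← LinearMap.range_eq_top]
  refine hgen _ ⟨⟨idField R V, .one⟩, ?_⟩ ?_
  · simp [evalVac]
  · rintro A hA n _ ⟨B, rfl⟩
    exact ⟨⟨nprod A B.1 n, .nprod n hA B.2⟩,
      ncoeff_nprod_neg_one_apply_vac (hcre A hA) (B.2.isCreative hcre) n⟩

lemma evalVac_injective [IsAddTorsionFree V] {vac : V} {T : Module.End R V} (hT : T vac = 0)
    (hloc : ∀ A ∈ S, ∀ B ∈ S, IsLocal A B) (hcov : ∀ A ∈ S, IsCovariant T A)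
    (hcre : ∀ A ∈ S, IsCreative vac A) (hsurj : Function.Surjective (evalVac S vac)) :
    Function.Injective (evalVac S vac) := by
  rw [injective_iff_map_eq_zero]
  intro A hA
  refine Subtype.ext (eq_zero_of_isLocal (F := {B | Generated S B}) hT
    (fun B hB => hB.isCreative hcre) (fun v => ?_) (A.2.isCovariant hcov) (A.2.isCreative hcre)
    (fun B hB => A.2.isLocal hloc hB) hA)
  obtain ⟨B, rfl⟩ := hsurj v
  exact ⟨B, B.2, rfl⟩

end Reconstruction

/-- The reconstruction theorem. -/
theorem exists_isVertexAlgebra {V : Type*} [AddCommGroup V] [Module ℂ V] {vac : V}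
    {T : Module.End ℂ V} {S : Set (VertexOperator ℂ V)} (hT : T vac = 0)
    (hloc : ∀ A ∈ S, ∀ B ∈ S, IsLocal A B) (hcov : ∀ A ∈ S, IsCovariant T A)
    (hcre : ∀ A ∈ S, IsCreative vac A)
    (hgen : ∀ p : Submodule ℂ V, vac ∈ p →
      (∀ A ∈ S, ∀ (n : ℤ), ∀ v ∈ p, ncoeff A n v ∈ p) → p = ⊤) :
    ∃ 𝒱 : VertexData V, 𝒱.IsVertexAlgebra ∧ 𝒱.vac = vac ∧
      ∀ A ∈ S, 𝒱.Y (ncoeff A (-1) vac) = A := by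
  have := IsAddTorsionFree.of_isTorsionFree ℂ V
  have hsurj := evalVac_surjective hcre hgen
  let e := LinearEquiv.ofBijective _ ⟨evalVac_injective hT hloc hcov hcre hsurj, hsurj⟩
  let 𝒱 : VertexData V := ⟨(generated S).subtype ∘ₗ e.symm.toLinearMap, vac⟩
  have hY (v : V) : Generated S (𝒱.Y v) := (e.symm v).2
  have h𝒱 : IsLocalFieldAlgebra T 𝒱 :=
    { translation_vac := hT
      isCovariant := fun v => (hY v).isCovariant hcov
      isCreative := fun v => (hY v).isCreative hcre
      creation := e.apply_symm_apply
      isLocal := fun u v => (hY u).isLocal hloc (hY v) }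
  exact ⟨𝒱, h𝒱.isVertexAlgebra, rfl, fun A hA => h𝒱.Y_ncoeff_vac (hcov A hA) (hcre A hA) fun v =>
    ((hY v).isLocal_of_mem hloc hA).symm⟩

/-! ### Consequences of the axioms -/

section Axioms

variable {R V W : Type*} [CommRing R] [AddCommGroup V] [Module R V] [AddCommGroup W] [Module R W]

lemma map_borcherdsProd {f : V →ₗ[R] W} {A B : VertexOperator R V} {A' B' : VertexOperator R W}
    (hA : ∀ n w, f (ncoeff A n w) = ncoeff A' n (f w))
    (hB : ∀ n w, f (ncoeff B n w) = ncoeff B' n (f w)) (l m n : ℤ) (w : V) :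
    f (borcherdsProd l m n A B w) = borcherdsProd l m n A' B' (f w) := by
  simp only [borcherdsProd_apply, LinearMap.sub_apply, LinearMap.smul_apply, map_sub,
    Units.smul_def, map_zsmul, orderedProd_apply, map_expand (isTruncated_comp _ _ w), hA, hB]

end Axioms

variable {V W : Type*} [AddCommGroup V] [Module ℂ V] [AddCommGroup W] [Module ℂ W]
  {𝒱 : VertexData V} {𝒲 : VertexData W}

/-- The translation operator `v ↦ v_{-2}𝟏`. -/
def translation (𝒱 : VertexData V) : Module.End ℂ V where
  toFun v := 𝒱.mode v (-2) 𝒱.vac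
  map_add' u v := by rw [mode_add_left, LinearMap.add_apply]
  map_smul' c v := by rw [mode_smul_left, LinearMap.smul_apply, RingHom.id_apply]

namespace IsVertexAlgebra

lemma mode_mode (h𝒱 : 𝒱.IsVertexAlgebra) (u v : V) (l n : ℤ) :
    𝒱.mode (𝒱.mode u l v) n = borcherdsProd l 0 n (𝒱.Y u) (𝒱.Y v) := by
  ext w
  rw [← iterateProd_zero]
  exact (𝒱.isVertexAlgebra_iff.mp h𝒱).2.2.2 u v w l 0 n

lemma isLocal (h𝒱 : 𝒱.IsVertexAlgebra) (u v : V) : IsLocal (𝒱.Y u) (𝒱.Y v) := by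
  obtain ⟨N, hN⟩ := exists_ncoeff_eq_zero (𝒱.Y u) v
  refine ⟨N.toNat, fun m n => LinearMap.ext fun w => ?_⟩
  rw [← (𝒱.isVertexAlgebra_iff.mp h𝒱).2.2.2,
    𝒱.iterateProd_eq_sum_range (K := 0) fun k hk => hN k (by omega)]
  rfl

lemma isCovariant (h𝒱 : 𝒱.IsVertexAlgebra) (u : V) : IsCovariant 𝒱.translation (𝒱.Y u) := by
  intro n
  ext v
  change 𝒱.mode (𝒱.mode u n v) (-2) 𝒱.vac =
    𝒱.mode u n (𝒱.mode v (-2) 𝒱.vac) - n • 𝒱.mode u (n - 1) v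
  rw [h𝒱.mode_mode, borcherdsProd_apply, LinearMap.sub_apply, LinearMap.smul_apply,
    orderedProd_apply_vac (h𝒱.creation_regular u) _ _ le_rfl, smul_zero, sub_zero,
    orderedProd_apply, expand_eq_sum_range (K := 2) fun m k hk => by
      rw [show ncoeff (𝒱.Y v) k 𝒱.vac = 0 from
        h𝒱.creation_regular v k (by push_cast at hk; omega), map_zero]]
  have hv : ncoeff (𝒱.Y v) (-1) 𝒱.vac = v := h𝒱.creation v
  simp [Finset.sum_range_succ, hv, mode, sub_eq_add_neg]

lemma isLocalFieldAlgebra (h𝒱 : 𝒱.IsVertexAlgebra) :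
    IsLocalFieldAlgebra 𝒱.translation 𝒱 where
  translation_vac := by
    change 𝒱.mode 𝒱.vac (-2) 𝒱.vac = 0
    rw [h𝒱.vacuum, if_neg (by decide)]
  isCovariant := h𝒱.isCovariant
  isCreative := h𝒱.creation_regular
  creation := h𝒱.creation
  isLocal := h𝒱.isLocal

lemma map_mode_mode (h𝒱 : 𝒱.IsVertexAlgebra) (h𝒲 : 𝒲.IsVertexAlgebra) (f : V →ₗ[ℂ] W) {u v : V}
    (hu : ∀ n w, f (𝒱.mode u n w) = 𝒲.mode (f u) n (f w))
    (hv : ∀ n w, f (𝒱.mode v n w) = 𝒲.mode (f v) n (f w)) (l n : ℤ) (w : V) :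
    f (𝒱.mode (𝒱.mode u l v) n w) = 𝒲.mode (f (𝒱.mode u l v)) n (f w) := by
  rw [hu, h𝒱.mode_mode, h𝒲.mode_mode]
  exact map_borcherdsProd hu hv l 0 n w

end IsVertexAlgebra

lemma IsLocalFieldAlgebra.translation_eq {T : Module.End ℂ V} (h𝒱 : IsLocalFieldAlgebra T 𝒱) :
    𝒱.translation = T := by
  refine LinearMap.ext fun v => ?_
  have h := (h𝒱.isCovariant v).apply (-1) 𝒱.vac
  rw [← mode, h𝒱.creation, h𝒱.translation_vac, map_zero, neg_one_zsmul, zero_sub, neg_neg] at h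
  exact h.symm

/-! ### Tensor products -/

section TensorFields

lemma exists_eq_zero_of_tmul {X : Type*} [AddCommGroup X] [Module ℂ X]
    {f : ℤ → V ⊗[ℂ] W →ₗ[ℂ] X}
    (hf : ∀ v w, ∃ N : ℤ, ∀ n, N ≤ n → f n (v ⊗ₜ w) = 0) (x : V ⊗[ℂ] W) :
    ∃ N : ℤ, ∀ n, N ≤ n → f n x = 0 := by
  induction x using TensorProduct.induction_on with
  | zero => exact ⟨0, fun n _ => map_zero _⟩
  | tmul v w => exact hf v w
  | add x y hx hy =>
    obtain ⟨N, hN⟩ := hx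
    obtain ⟨M, hM⟩ := hy
    exact ⟨max N M, fun n hn => by
      rw [map_add, hN n (le_of_max_le_left hn), hM n (le_of_max_le_right hn), add_zero]⟩

variable (W) in
/-- The vertex operator `A(x) ⊗ 1`. -/
def opRTensor (A : VertexOperator ℂ V) : VertexOperator ℂ (V ⊗[ℂ] W) :=
  ofModes (fun n => (ncoeff A n).rTensor W) <| exists_eq_zero_of_tmul fun v w =>
    (exists_ncoeff_eq_zero A v).imp fun _ hN n hn => by
      rw [LinearMap.rTensor_tmul, hN n hn, TensorProduct.zero_tmul]

variable (V) in
/-- The vertex operator `1 ⊗ A(x)`. -/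
def opLTensor (A : VertexOperator ℂ W) : VertexOperator ℂ (V ⊗[ℂ] W) :=
  ofModes (fun n => (ncoeff A n).lTensor V) <| exists_eq_zero_of_tmul fun v w =>
    (exists_ncoeff_eq_zero A w).imp fun _ hN n hn => by
      rw [LinearMap.lTensor_tmul, hN n hn, TensorProduct.tmul_zero]

@[simp] lemma ncoeff_opRTensor (A : VertexOperator ℂ V) (n : ℤ) :
    ncoeff (opRTensor W A) n = (ncoeff A n).rTensor W :=
  ncoeff_ofModes _ _ n

@[simp] lemma ncoeff_opLTensor (A : VertexOperator ℂ W) (n : ℤ) :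
    ncoeff (opLTensor V A) n = (ncoeff A n).lTensor V :=
  ncoeff_ofModes _ _ n

lemma IsLocal.opRTensor {A B : VertexOperator ℂ V} (h : IsLocal A B) :
    IsLocal (opRTensor W A) (opRTensor W B) := by
  obtain ⟨N, hN⟩ := h
  refine ⟨N, fun m n => TensorProduct.ext' fun v w => ?_⟩
  have hvw := map_borcherdsProd (f := (TensorProduct.mk ℂ V W).flip w) (A := A) (B := B)
    (A' := VertexData.opRTensor W A) (B' := VertexData.opRTensor W B) (by simp) (by simp) N m n v
  rw [hN, LinearMap.zero_apply, map_zero] at hvw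
  exact hvw.symm

lemma IsLocal.opLTensor {A B : VertexOperator ℂ W} (h : IsLocal A B) :
    IsLocal (opLTensor V A) (opLTensor V B) := by
  obtain ⟨N, hN⟩ := h
  refine ⟨N, fun m n => TensorProduct.ext' fun v w => ?_⟩
  have hvw := map_borcherdsProd (f := TensorProduct.mk ℂ V W v) (A := A) (B := B)
    (A' := VertexData.opLTensor V A) (B' := VertexData.opLTensor V B) (by simp) (by simp) N m n w
  rw [hN, LinearMap.zero_apply, map_zero] at hvw
  exact hvw.symm

lemma isLocal_opRTensor_opLTensor (A : VertexOperator ℂ V) (B : VertexOperator ℂ W) :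
    IsLocal (opRTensor W A) (opLTensor V B) :=
  .of_commute fun m n => by
    rw [ncoeff_opRTensor, ncoeff_opLTensor]
    exact TensorProduct.ext' fun v w => rfl

lemma IsCovariant.opRTensor {T : Module.End ℂ V} {A : VertexOperator ℂ V} (hA : IsCovariant T A)
    (T' : Module.End ℂ W) : IsCovariant (T.rTensor W + T'.lTensor V) (opRTensor W A) :=
  fun n => TensorProduct.ext' fun v w => by
    simp only [ncoeff_opRTensor, Module.End.mul_apply, LinearMap.add_apply, LinearMap.sub_apply,
      LinearMap.smul_apply, LinearMap.rTensor_tmul, LinearMap.lTensor_tmul, map_add, hA.apply,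
      TensorProduct.sub_tmul, TensorProduct.smul_tmul']
    abel

lemma IsCovariant.opLTensor {T' : Module.End ℂ W} {A : VertexOperator ℂ W} (hA : IsCovariant T' A)
    (T : Module.End ℂ V) : IsCovariant (T.rTensor W + T'.lTensor V) (opLTensor V A) :=
  fun n => TensorProduct.ext' fun v w => by
    simp only [ncoeff_opLTensor, Module.End.mul_apply, LinearMap.add_apply, LinearMap.sub_apply,
      LinearMap.smul_apply, LinearMap.rTensor_tmul, LinearMap.lTensor_tmul, map_add, hA.apply,
      TensorProduct.tmul_sub, TensorProduct.tmul_smul]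
    abel

lemma IsCreative.opRTensor {vac : V} {A : VertexOperator ℂ V} (hA : IsCreative vac A) (vac' : W) :
    IsCreative (vac ⊗ₜ[ℂ] vac') (opRTensor W A) :=
  fun n hn => by simp [hA n hn]

lemma IsCreative.opLTensor {vac' : W} {A : VertexOperator ℂ W} (hA : IsCreative vac' A) (vac : V) :
    IsCreative (vac ⊗ₜ[ℂ] vac') (opLTensor V A) :=
  fun n hn => by simp [hA n hn]

end TensorFields

section Tensor

lemma finsum_int_eq_finsum_nat {M : Type*} [AddCommMonoid M] {f : ℤ → M}
    (hf : ∀ n < 0, f n = 0) : ∑ᶠ n : ℤ, f n = ∑ᶠ n : ℕ, f n := by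
  rw [← finsum_mem_univ, ← finsum_mem_range (f := f) (g := ((↑) : ℕ → ℤ)) Nat.cast_injective]
  refine finsum_mem_inter_support_eq' f _ _ fun n hn => iff_of_true (Set.mem_univ n) ?_
  exact ⟨n.toNat, Int.toNat_of_nonneg (not_lt.mp fun h => hn (hf n h))⟩

lemma finsum_int_eq_add {M : Type*} [AddCommMonoid M] {f : ℤ → M}
    (hf : (Function.support f).Finite) :
    ∑ᶠ j, f j = ∑ᶠ i : ℕ, f i + ∑ᶠ i : ℕ, f (-1 - i) := by
  have h : Set.range (fun i : ℕ => (i : ℤ)) ∪ Set.range (fun i : ℕ => (-1 - i : ℤ)) =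
      Set.univ := by
    ext j
    simp only [Set.mem_union, Set.mem_range, Set.mem_univ, iff_true]
    rcases le_or_gt 0 j with h | h
    · exact Or.inl ⟨j.toNat, by omega⟩
    · exact Or.inr ⟨(-1 - j).toNat, by omega⟩
  rw [← finsum_mem_univ, ← h, finsum_mem_union' _ (hf.inter_of_right _) (hf.inter_of_right _),
    finsum_mem_range fun a b h => by simpa using h, finsum_mem_range fun a b h => by simpa using h]
  rw [Set.disjoint_left]
  rintro _ ⟨i, rfl⟩ ⟨j, hj⟩
  simp only at hj
  omega

lemma finite_support_mode_tmul (𝒱 : VertexData V) (𝒲 : VertexData W) (u v : V) (a b : W) (n : ℤ) :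
    (Function.support fun j : ℤ => 𝒱.mode u j v ⊗ₜ[ℂ] 𝒲.mode a (n - 1 - j) b).Finite := by
  obtain ⟨N, hN⟩ := exists_ncoeff_eq_zero (𝒱.Y u) v
  obtain ⟨M, hM⟩ := exists_ncoeff_eq_zero (𝒲.Y a) b
  refine (Set.finite_Icc (n - 1 - M) N).subset fun j hj => ?_
  by_contra h
  rw [Set.mem_Icc, not_and_or] at h
  apply hj
  rcases h with h | h
  · simp [mode, hM (n - 1 - j) (by omega)]
  · simp [mode, hN j (by omega)]

lemma tensor_mode_tmul (𝒱 : VertexData V) (𝒲 : VertexData W) (u v : V) (a b : W) (n : ℤ) :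
    (𝒱.tensor 𝒲).mode (u ⊗ₜ a) n (v ⊗ₜ b) =
      ∑ᶠ j : ℤ, 𝒱.mode u j v ⊗ₜ[ℂ] 𝒲.mode a (n - 1 - j) b := by
  have h : (𝒱.tensor 𝒲).mode (u ⊗ₜ a) n (v ⊗ₜ b) =
      ∑ᶠ i : ℤ, lcoeff (𝒱.Y u v) i ⊗ₜ[ℂ] lcoeff (𝒲.Y a b) (-n - 1 - i) := rfl
  rw [h, ← finsum_comp_equiv (Equiv.subLeft (-1 : ℤ))]
  refine finsum_congr fun j => ?_
  simp only [Equiv.subLeft_apply]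
  change _ = lcoeff (𝒱.Y u v) (-j - 1) ⊗ₜ[ℂ] lcoeff (𝒲.Y a b) (-(n - 1 - j) - 1)
  congr 2 <;> ring

lemma tensor_Y_tmul (𝒱 : VertexData V) (𝒲 : VertexData W) (u : V) (a : W) :
    (𝒱.tensor 𝒲).Y (u ⊗ₜ a) = nprod (opRTensor W (𝒱.Y u)) (opLTensor V (𝒲.Y a)) (-1) := by
  refine ncoeff_injective (funext fun n => TensorProduct.ext' fun v b => ?_)
  refine (tensor_mode_tmul 𝒱 𝒲 u v a b n).trans ?_
  rw [finsum_int_eq_add (finite_support_mode_tmul 𝒱 𝒲 u v a b n), ncoeff_nprod,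
    borcherdsProd_apply, LinearMap.sub_apply, LinearMap.smul_apply, orderedProd_apply,
    orderedProd_apply, expand, expand, add_comm]
  simp only [signedChoose_neg_one, one_smul, ncoeff_opRTensor, ncoeff_opLTensor,
    LinearMap.rTensor_tmul, LinearMap.lTensor_tmul, Int.negOnePow_neg, Int.negOnePow_one,
    Units.neg_smul, sub_neg_eq_add, mode]
  congr 1 <;> exact finsum_congr fun i => by ring_nf

lemma isLocal_tensor_Y {C : VertexOperator ℂ (V ⊗[ℂ] W)}
    (h𝒱 : ∀ u, IsLocal (opRTensor W (𝒱.Y u)) C) (h𝒲 : ∀ a, IsLocal (opLTensor V (𝒲.Y a)) C)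
    (x : V ⊗[ℂ] W) : IsLocal ((𝒱.tensor 𝒲).Y x) C := by
  induction x using TensorProduct.induction_on with
  | zero => simpa using (h𝒱 0).smul 0
  | add x y hx hy => simpa only [map_add] using hx.add hy
  | tmul u a =>
    rw [tensor_Y_tmul]
    exact (isLocal_opRTensor_opLTensor _ _).nprod (h𝒱 u) (h𝒲 a) (-1)

lemma IsLocalFieldAlgebra.tensor {T : Module.End ℂ V} {T' : Module.End ℂ W}
    (h𝒱 : IsLocalFieldAlgebra T 𝒱) (h𝒲 : IsLocalFieldAlgebra T' 𝒲) :
    IsLocalFieldAlgebra (T.rTensor W + T'.lTensor V) (𝒱.tensor 𝒲) where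
  translation_vac := by simp [VertexData.tensor, h𝒱.translation_vac, h𝒲.translation_vac]
  isCovariant x := by
    induction x using TensorProduct.induction_on with
    | zero => simp [IsCovariant]
    | add x y hx hy => simpa only [map_add] using hx.add hy
    | tmul u a =>
      rw [tensor_Y_tmul]
      exact ((h𝒱.isCovariant u).opRTensor T').nprod ((h𝒲.isCovariant a).opLTensor T) (-1)
  isCreative x := by
    induction x using TensorProduct.induction_on with
    | zero => simp [IsCreative]
    | add x y hx hy => simpa only [map_add] using hx.add hy
    | tmul u a =>
      rw [tensor_Y_tmul]
      exact ((h𝒱.isCreative u).opRTensor 𝒲.vac).nprod ((h𝒲.isCreative a).opLTensor 𝒱.vac) (-1)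
  creation x := by
    induction x using TensorProduct.induction_on with
    | zero => simp
    | add x y hx hy => rw [mode_add_left, LinearMap.add_apply, hx, hy]
    | tmul u a =>
      have hu : ncoeff (𝒱.Y u) (-1) 𝒱.vac = u := h𝒱.creation u
      have ha : ncoeff (𝒲.Y a) (-1) 𝒲.vac = a := h𝒲.creation a
      rw [mode, tensor_Y_tmul]
      refine (ncoeff_nprod_neg_one_apply_vac ((h𝒱.isCreative u).opRTensor 𝒲.vac)
        ((h𝒲.isCreative a).opLTensor 𝒱.vac) (-1)).trans ?_
      simp [hu, ha]
  isLocal x y := isLocal_tensor_Y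
    (fun u => (isLocal_tensor_Y (fun v => (h𝒱.isLocal v u).opRTensor)
      (fun b => (isLocal_opRTensor_opLTensor _ _).symm) y).symm)
    (fun a => (isLocal_tensor_Y (fun v => isLocal_opRTensor_opLTensor _ _)
      (fun b => (h𝒲.isLocal b a).opLTensor) y).symm) x

theorem IsVertexAlgebra.tensor (h𝒱 : 𝒱.IsVertexAlgebra) (h𝒲 : 𝒲.IsVertexAlgebra) :
    (𝒱.tensor 𝒲).IsVertexAlgebra :=
  (h𝒱.isLocalFieldAlgebra.tensor h𝒲.isLocalFieldAlgebra).isVertexAlgebra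

lemma IsVertexAlgebra.tensor_translation (h𝒱 : 𝒱.IsVertexAlgebra) (h𝒲 : 𝒲.IsVertexAlgebra) :
    (𝒱.tensor 𝒲).translation = 𝒱.translation.rTensor W + 𝒲.translation.lTensor V :=
  (h𝒱.isLocalFieldAlgebra.tensor h𝒲.isLocalFieldAlgebra).translation_eq

lemma tensor_mode_tmul_vac (𝒱 : VertexData V) {𝒲 : VertexData W} (h𝒲 : 𝒲.IsVertexAlgebra)
    (u v : V) (b : W) (n : ℤ) :
    (𝒱.tensor 𝒲).mode (u ⊗ₜ 𝒲.vac) n (v ⊗ₜ b) = 𝒱.mode u n v ⊗ₜ b := by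
  rw [tensor_mode_tmul, finsum_eq_single _ n]
  · rw [h𝒲.vacuum, if_pos (by ring)]
  · intro j hj
    rw [h𝒲.vacuum, if_neg (by omega), TensorProduct.tmul_zero]

lemma tensor_mode_vac_tmul {𝒱 : VertexData V} (h𝒱 : 𝒱.IsVertexAlgebra) (𝒲 : VertexData W)
    (v : V) (a b : W) (n : ℤ) :
    (𝒱.tensor 𝒲).mode (𝒱.vac ⊗ₜ a) n (v ⊗ₜ b) = v ⊗ₜ 𝒲.mode a n b := by
  rw [tensor_mode_tmul, finsum_eq_single _ (-1)]
  · rw [h𝒱.vacuum, if_pos rfl, show n - 1 - -1 = n by ring]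
  · intro j hj
    rw [h𝒱.vacuum, if_neg hj, TensorProduct.zero_tmul]

end Tensor

/-! ### The Borcherds construction -/

section Borcherds

variable {A A' : Type*} [CommRing A] [Algebra ℂ A] [CommRing A'] [Algebra ℂ A']

lemma borcherds_mode_of_nonneg (d : Derivation ℂ A A) (a : A) {n : ℤ} (hn : 0 ≤ n) :
    (borcherds d).mode a n = 0 := by
  have h : (borcherds d).mode a n = borcherdsCoeff d a (-n - 1) := rfl
  obtain ⟨k, hk⟩ := Int.eq_negSucc_of_lt_zero (show -n - 1 < 0 by omega)
  rw [h, hk]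
  rfl

lemma borcherds_mode_neg_one_sub (d : Derivation ℂ A A) (a : A) (k : ℕ) :
    (borcherds d).mode a (-1 - k) =
      LinearMap.mulLeft ℂ ((k.factorial : ℂ)⁻¹ • (d : A →ₗ[ℂ] A)^[k] a) := by
  have h : (borcherds d).mode a (-1 - k) = borcherdsCoeff d a (-(-1 - k) - 1) := rfl
  rw [h, show -(-1 - (k : ℤ)) - 1 = Int.ofNat k by simp]
  rfl

lemma nonneg_or_eq_neg_one_sub (n : ℤ) : 0 ≤ n ∨ ∃ k : ℕ, n = -1 - k :=
  (le_or_gt 0 n).imp_right fun h => ⟨(-1 - n).toNat, by omega⟩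

lemma borcherds_mode_eq_mulLeft (d : Derivation ℂ A A) (a : A) (n : ℤ) :
    (borcherds d).mode a n = LinearMap.mulLeft ℂ ((borcherds d).mode a n 1) := by
  obtain hn | ⟨k, rfl⟩ := nonneg_or_eq_neg_one_sub n
  · simp [borcherds_mode_of_nonneg d a hn]
  · simp [borcherds_mode_neg_one_sub]

theorem borcherds_isCommutative (d : Derivation ℂ A A) : (borcherds d).IsCommutative :=
  fun a b m n => by
    rw [borcherds_mode_eq_mulLeft d a, borcherds_mode_eq_mulLeft d b]
    exact LinearMap.ext fun c => mul_left_comm _ _ c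

lemma borcherds_isCovariant (d : Derivation ℂ A A) (a : A) :
    IsCovariant (d : A →ₗ[ℂ] A) ((borcherds d).Y a) := by
  intro n
  ext b
  change d ((borcherds d).mode a n b) =
    (borcherds d).mode a n (d b) - n • (borcherds d).mode a (n - 1) b
  obtain hn | ⟨k, rfl⟩ := nonneg_or_eq_neg_one_sub n
  · rcases hn.eq_or_lt with rfl | hn'
    · simp [borcherds_mode_of_nonneg]
    · rw [borcherds_mode_of_nonneg d a hn, borcherds_mode_of_nonneg d a (by omega)]
      simp
  · have hk : (-1 - k : ℤ) • (((k + 1).factorial : ℂ)⁻¹ • (d : A →ₗ[ℂ] A)^[k + 1] a) =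
        -((k.factorial : ℂ)⁻¹ • d ((d : A →ₗ[ℂ] A)^[k] a)) := by
      rw [← Int.cast_smul_eq_zsmul ℂ, smul_smul, ← neg_smul, Function.iterate_succ_apply',
        Nat.factorial_succ]
      congr 1
      push_cast
      field_simp
      ring
    rw [show (-1 - k - 1 : ℤ) = -1 - (k + 1 : ℕ) by push_cast; ring]
    simp only [borcherds_mode_neg_one_sub, LinearMap.mulLeft_apply]
    rw [← smul_mul_assoc, hk, Derivation.leibniz, Derivation.map_smul, smul_eq_mul, smul_eq_mul,
      mul_comm b]
    ring

lemma borcherds_isLocalFieldAlgebra (d : Derivation ℂ A A) :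
    IsLocalFieldAlgebra (d : A →ₗ[ℂ] A) (borcherds d) where
  translation_vac := d.map_one_eq_zero
  isCovariant := borcherds_isCovariant d
  isCreative a n hn := LinearMap.congr_fun (borcherds_mode_of_nonneg d a hn) 1
  creation a := by
    change (borcherds d).mode a (-1) 1 = a
    simpa using LinearMap.congr_fun (borcherds_mode_neg_one_sub d a 0) 1
  isLocal a b := .of_commute (borcherds_isCommutative d a b)

theorem borcherds_isVertexAlgebra (d : Derivation ℂ A A) : (borcherds d).IsVertexAlgebra :=
  (borcherds_isLocalFieldAlgebra d).isVertexAlgebra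

lemma borcherds_isHom {d : Derivation ℂ A A} {d' : Derivation ℂ A' A'} (f : A →ₐ[ℂ] A')
    (h : ∀ a, f (d a) = d' (f a)) : IsHom (borcherds d) (borcherds d') f.toLinearMap where
  map_vac := map_one f
  map_mode a b n := by
    obtain hn | ⟨k, rfl⟩ := nonneg_or_eq_neg_one_sub n
    · simp [borcherds_mode_of_nonneg, hn]
    · have hk : f ((d : A →ₗ[ℂ] A)^[k] a) = (d' : A' →ₗ[ℂ] A')^[k] (f a) :=
        (Function.Semiconj.iterate_right (f := f) h k) a
      simp only [borcherds_mode_neg_one_sub, LinearMap.mulLeft_apply, AlgHom.toLinearMap_apply,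
        map_mul, map_smul, hk]

/-- The derivation `d ⊗ 1 + 1 ⊗ d'` of `A ⊗ A'`. -/
def tensorDeriv (d : Derivation ℂ A A) (d' : Derivation ℂ A' A') :
    Derivation ℂ (A ⊗[ℂ] A') (A ⊗[ℂ] A') :=
  Derivation.mk' ((d : A →ₗ[ℂ] A).rTensor A' + (d' : A' →ₗ[ℂ] A').lTensor A) fun x y => by
    induction x using TensorProduct.induction_on with
    | zero => simp
    | add x x' hx hx' => simp only [add_mul, map_add, hx, hx', smul_eq_mul, mul_add]; ring
    | tmul a a' =>
      induction y using TensorProduct.induction_on with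
      | zero => simp
      | add y y' hy hy' => simp only [add_mul, map_add, hy, hy', smul_eq_mul, mul_add]; ring
      | tmul b b' =>
        simp only [LinearMap.add_apply, Algebra.TensorProduct.tmul_mul_tmul,
          LinearMap.rTensor_tmul, LinearMap.lTensor_tmul, Derivation.coeFn_coe,
          Derivation.leibniz, smul_eq_mul, mul_add, TensorProduct.add_tmul,
          TensorProduct.tmul_add]
        rw [mul_comm b a, mul_comm b, mul_comm b' a', mul_comm b']
        abel

lemma tensorDeriv_tmul (d : Derivation ℂ A A) (d' : Derivation ℂ A' A') (a : A) (b : A') :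
    tensorDeriv d d' (a ⊗ₜ b) = d a ⊗ₜ b + a ⊗ₜ d' b := rfl

lemma rTensor_mulLeft (a : A) :
    (LinearMap.mulLeft ℂ a).rTensor A' = LinearMap.mulLeft ℂ (a ⊗ₜ[ℂ] (1 : A')) := by
  rw [LinearMap.mulLeft_tmul, LinearMap.mulLeft_one, LinearMap.rTensor]

lemma lTensor_mulLeft (a : A') :
    (LinearMap.mulLeft ℂ a).lTensor A = LinearMap.mulLeft ℂ ((1 : A) ⊗ₜ[ℂ] a) := by
  rw [LinearMap.mulLeft_tmul, LinearMap.mulLeft_one, LinearMap.lTensor]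

/-- Both sides have the same translation operator, and the modes on the right hand side are
multiplication operators, so the fields on both sides are mutually local. -/
lemma borcherds_tensor (d : Derivation ℂ A A) (d' : Derivation ℂ A' A') :
    (borcherds d).tensor (borcherds d') = borcherds (tensorDeriv d d') := by
  have h := (borcherds_isLocalFieldAlgebra d).tensor (borcherds_isLocalFieldAlgebra d')
  have h' := borcherds_isLocalFieldAlgebra (tensorDeriv d d')
  have hR (x : A ⊗[ℂ] A') (a : A) :
      IsLocal (opRTensor A' ((borcherds d).Y a)) ((borcherds (tensorDeriv d d')).Y x) :=
    .of_commute fun m n => by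
      rw [ncoeff_opRTensor, ← mode, ← mode, borcherds_mode_eq_mulLeft d,
        borcherds_mode_eq_mulLeft (tensorDeriv d d'), rTensor_mulLeft]
      exact LinearMap.ext (mul_left_comm _ _)
  have hL (x : A ⊗[ℂ] A') (a : A') :
      IsLocal (opLTensor A ((borcherds d').Y a)) ((borcherds (tensorDeriv d d')).Y x) :=
    .of_commute fun m n => by
      rw [ncoeff_opLTensor, ← mode, ← mode, borcherds_mode_eq_mulLeft d',
        borcherds_mode_eq_mulLeft (tensorDeriv d d'), lTensor_mulLeft]
      exact LinearMap.ext (mul_left_comm _ _)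
  refine VertexData.ext (LinearMap.ext fun x => ?_) rfl
  have hx : ncoeff ((borcherds (tensorDeriv d d')).Y x) (-1) 1 = x := h'.creation x
  exact (congrArg _ hx.symm).trans <| h.Y_ncoeff_vac (h'.isCovariant x) (h'.isCreative x) fun y =>
    (isLocal_tensor_Y (hR x) (hL x) y).symm

end Borcherds

/-! ### Highest weight vectors -/

/-- `a` is a highest weight vector of weight `c` for the modes of `u`: `u_0 a = c a` and `u_n a = 0`
for `n > 0`. -/
structure IsHighestWeight (𝒱 : VertexData V) (u a : V) (c : ℂ) : Prop where
  mode_zero : 𝒱.mode u 0 a = c • a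
  mode_pos : ∀ n, 0 < n → 𝒱.mode u n a = 0

section HighestWeight

variable {𝒱 : VertexData V} {𝒲 : VertexData W} {f : V →ₗ[ℂ] W} {u a v : V} {c : ℂ}

lemma IsHighestWeight.map (ha : 𝒱.IsHighestWeight u a c)
    (hu : ∀ n w, f (𝒱.mode u n w) = 𝒲.mode (f u) n (f w)) : 𝒲.IsHighestWeight (f u) (f a) c where
  mode_zero := by rw [← hu, ha.mode_zero, map_smul]
  mode_pos n hn := by rw [← hu, ha.mode_pos n hn, map_zero]

lemma IsHighestWeight.commutator (ha : 𝒱.IsHighestWeight u a c) (h𝒱 : 𝒱.IsVertexAlgebra)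
    (m n : ℤ) (w : V) :
    𝒱.mode u m (𝒱.mode a n w) = 𝒱.mode a n (𝒱.mode u m w) + c • 𝒱.mode a (n + m) w := by
  have h := h𝒱.jacobi u a w 0 m n
  rw [finsum_eq_single _ 0, finsum_eq_single _ 0] at h
  · simp only [Ring.choose_zero_right, Nat.cast_zero, add_zero, one_smul, ha.mode_zero, sub_zero,
      pow_zero, mul_one, Int.negOnePow_zero, mode_smul_left, LinearMap.smul_apply] at h
    rw [add_comm n m, h]
    abel
  · intro i hi
    obtain ⟨j, rfl⟩ := Nat.exists_eq_succ_of_ne_zero hi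
    rw [Nat.succ_eq_add_one, Ring.choose_zero_succ, mul_zero, zero_smul]
  · intro i hi
    rw [ha.mode_pos _ (by omega), mode_zero_left, LinearMap.zero_apply, smul_zero]

lemma IsHighestWeight.map_mode_mode (ha : 𝒱.IsHighestWeight u a c) (h𝒱 : 𝒱.IsVertexAlgebra)
    (h𝒲 : 𝒲.IsVertexAlgebra) (hu : ∀ n w, f (𝒱.mode u n w) = 𝒲.mode (f u) n (f w))
    (hv : ∀ n, f (𝒱.mode a n v) = 𝒲.mode (f a) n (f v)) (m n : ℤ) :
    f (𝒱.mode a n (𝒱.mode u m v)) = 𝒲.mode (f a) n (f (𝒱.mode u m v)) := by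
  rw [← sub_eq_iff_eq_add.mpr (ha.commutator h𝒱 m n v), map_sub, map_smul, hu, hv, hv,
    (ha.map hu).commutator h𝒲, hu, add_sub_cancel_right]

lemma IsHighestWeight.translation_mode (ha : 𝒱.IsHighestWeight u a c) (h𝒱 : 𝒱.IsVertexAlgebra)
    (hv : 𝒱.translation v = 𝒱.mode u (-1) v) (n : ℤ) :
    𝒱.translation (𝒱.mode a n v) = 𝒱.mode u (-1) (𝒱.mode a n v) - (c + n) • 𝒱.mode a (n - 1) v := by
  have h : 𝒱.translation (𝒱.mode a n v) =
      𝒱.mode a n (𝒱.translation v) - n • 𝒱.mode a (n - 1) v := (h𝒱.isCovariant a).apply n v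
  rw [h, hv, ha.commutator h𝒱, add_smul, Int.cast_smul_eq_zsmul, ← sub_eq_add_neg]
  abel

lemma IsHighestWeight.map_mode_sub_one (ha : 𝒱.IsHighestWeight u a c) (h𝒱 : 𝒱.IsVertexAlgebra)
    (h𝒲 : 𝒲.IsVertexAlgebra) (hf : ∀ w, f (𝒱.translation w) = 𝒲.translation (f w))
    (hu : ∀ n w, f (𝒱.mode u n w) = 𝒲.mode (f u) n (f w))
    (hv : 𝒱.translation v = 𝒱.mode u (-1) v) {n : ℤ} (hn : c + n ≠ 0)
    (h : f (𝒱.mode a n v) = 𝒲.mode (f a) n (f v)) :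
    f (𝒱.mode a (n - 1) v) = 𝒲.mode (f a) (n - 1) (f v) := by
  have h𝒱v := congrArg f (ha.translation_mode h𝒱 hv n)
  have h𝒲v := (ha.map hu).translation_mode h𝒲 (v := f v) (by rw [← hf, hv, hu]) n
  rw [map_sub, map_smul, hf, hu, h, h𝒲v, sub_right_inj] at h𝒱v
  exact (smul_right_injective _ hn h𝒱v).symm

end HighestWeight

/-! ### Coactions -/

section Coaction

variable {C : Type*} [AddCommGroup C] [Module ℂ C] [Coalgebra ℂ C]

/-- The right coaction on `V` obtained from the comultiplication of `C` by a linear equivalence. -/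
def coactionOfEquiv (e : C ≃ₗ[ℂ] V) : V →ₗ[ℂ] V ⊗[ℂ] C :=
  e.toLinearMap.rTensor C ∘ₗ Coalgebra.comul ∘ₗ e.symm.toLinearMap

lemma coactionOfEquiv_apply (e : C ≃ₗ[ℂ] V) (c : C) :
    coactionOfEquiv e (e c) = e.toLinearMap.rTensor C (Coalgebra.comul c) := by
  simp [coactionOfEquiv]

lemma coactionOfEquiv_coassoc (e : C ≃ₗ[ℂ] V) :
    (TensorProduct.assoc ℂ V C C).toLinearMap ∘ₗ (coactionOfEquiv e).rTensor C ∘ₗ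
      coactionOfEquiv e =
        (Coalgebra.comul (R := ℂ) (A := C)).lTensor V ∘ₗ coactionOfEquiv e := by
  have h_comp : coactionOfEquiv e ∘ₗ e.toLinearMap = e.toLinearMap.rTensor C ∘ₗ Coalgebra.comul :=
    LinearMap.ext (coactionOfEquiv_apply e)
  refine LinearMap.ext fun v => ?_
  obtain ⟨c, rfl⟩ := e.surjective v
  calc TensorProduct.assoc ℂ V C C ((coactionOfEquiv e).rTensor C (coactionOfEquiv e (e c)))
      = TensorProduct.assoc ℂ V C C ((e.toLinearMap.rTensor C).rTensor C
          (Coalgebra.comul.rTensor C (Coalgebra.comul c))) := by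
        rw [coactionOfEquiv_apply, ← LinearMap.rTensor_comp_apply, h_comp,
          LinearMap.rTensor_comp_apply]
    _ = e.toLinearMap.rTensor (C ⊗[ℂ] C) (TensorProduct.assoc ℂ C C C
          (Coalgebra.comul.rTensor C (Coalgebra.comul c))) := by
        simp [LinearMap.rTensor_tensor]
    _ = Coalgebra.comul.lTensor V (coactionOfEquiv e (e c)) := by
        rw [Coalgebra.coassoc_apply, coactionOfEquiv_apply]
        exact congr($((LinearMap.rTensor_comp_lTensor _ _ _).trans
          (LinearMap.lTensor_comp_rTensor _ _ _).symm) (Coalgebra.comul c))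

lemma coactionOfEquiv_counit (e : C ≃ₗ[ℂ] V) :
    (TensorProduct.rid ℂ V).toLinearMap ∘ₗ (Coalgebra.counit (R := ℂ) (A := C)).lTensor V ∘ₗ
      coactionOfEquiv e = LinearMap.id := by
  refine LinearMap.ext fun v => ?_
  obtain ⟨c, rfl⟩ := e.surjective v
  have h : (Coalgebra.counit (R := ℂ) (A := C)).lTensor V (coactionOfEquiv e (e c)) =
      e c ⊗ₜ 1 := by
    rw [coactionOfEquiv_apply, ← LinearMap.comp_apply, LinearMap.lTensor_comp_rTensor,
      ← LinearMap.rTensor_comp_lTensor, LinearMap.comp_apply, Coalgebra.lTensor_counit_comul,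
      LinearMap.rTensor_tmul, LinearEquiv.coe_coe]
  simp only [LinearMap.comp_apply, LinearEquiv.coe_coe, h, TensorProduct.rid_tmul, one_smul,
    LinearMap.id_apply]

end Coaction

end VertexData

namespace LatticeVA

open VertexData
open VertexOperator (ncoeff)

variable {L : Type*} [AddCommGroup L] {B : LinearMap.BilinForm ℤ L}

/-! ### The vertex bialgebra `B_L` -/

lemma fock_induction {p : Fock L → Prop} (zero : p 0) (one : p 1)
    (add : ∀ u v, p u → p v → p (u + v)) (smul : ∀ (c : ℂ) u, p u → p (c • u))
    (neg_mul : ∀ (h : Cartan L) (n : ℕ) u, p u → p (neg h n * u)) (u : Fock L) : p u := by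
  have ι_mul (x : HeisMinus L) (v : Fock L) (hv : p v) :
      p (SymmetricAlgebra.ι ℂ (HeisMinus L) x * v) := by
    induction x using Finsupp.induction_linear with
    | zero => simpa using zero
    | add x y hx hy => rw [map_add, add_mul]; exact add _ _ hx hy
    | single n h => exact neg_mul h n v hv
  suffices h : ∀ v, p v → p (u * v) by simpa using h 1 one
  induction u using SymmetricAlgebra.induction with
  | algebraMap c => intro v hv; rw [← Algebra.smul_def]; exact smul c v hv
  | ι x => exact ι_mul x
  | mul a b ha hb => intro v hv; rw [mul_assoc]; exact ha _ (hb v hv)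
  | add a b ha hb => intro v hv; rw [add_mul]; exact add _ _ (ha v hv) (hb v hv)

lemma fockDeriv_neg (h : Cartan L) (n : ℕ) :
    fockDeriv (neg h n) = ((n : ℂ) + 1) • neg h (n + 1) := by
  rw [fockDeriv, neg, symDeriv_ι]
  simp [neg, ← map_smul]

lemma neg_zero_left (n : ℕ) : neg (0 : Cartan L) n = 0 := by simp [neg]

lemma bDeriv_tmul_single (u : Fock L) (α : L) (c : ℂ) :
    bDeriv (u ⊗ₜ[ℂ] AddMonoidAlgebra.single α c) =
      (neg (toCartan α) 0 * u + fockDeriv u) ⊗ₜ[ℂ] AddMonoidAlgebra.single α c :=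
  bDerivLin_single u α c

lemma bDeriv_neg (h : Cartan L) (n : ℕ) :
    bDeriv (neg h n ⊗ₜ[ℂ] (1 : AddMonoidAlgebra ℂ L)) =
      ((n : ℂ) + 1) • (neg h (n + 1) ⊗ₜ[ℂ] (1 : AddMonoidAlgebra ℂ L)) := by
  rw [AddMonoidAlgebra.one_def, bDeriv_tmul_single, fockDeriv_neg, toCartan,
    TensorProduct.tmul_zero, neg_zero_left, zero_mul, zero_add, TensorProduct.smul_tmul']

lemma bDeriv_eB (α : L) :
    bDeriv (eB α) = (neg (toCartan α) 0 ⊗ₜ[ℂ] (1 : AddMonoidAlgebra ℂ L)) * eB α := by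
  rw [eB, bDeriv_tmul_single, Algebra.TensorProduct.tmul_mul_tmul]
  simp [fockDeriv]

lemma bSpace_induction {p : BSpace L → Prop} (zero : p 0) (eB : ∀ α, p (eB α))
    (add : ∀ u v, p u → p v → p (u + v)) (smul : ∀ (c : ℂ) u, p u → p (c • u))
    (neg_mul : ∀ (h : Cartan L) (n : ℕ) x, p x → p ((neg h n ⊗ₜ[ℂ] 1) * x)) (x : BSpace L) :
    p x := by
  induction x using TensorProduct.induction_on with
  | zero => exact zero
  | add x y hx hy => exact add x y hx hy
  | tmul u f =>
    induction f using AddMonoidAlgebra.induction_linear with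
    | zero => simpa using zero
    | add f g hf hg => rw [TensorProduct.tmul_add]; exact add _ _ hf hg
    | single α c =>
      induction u using fock_induction with
      | zero => simpa using zero
      | one =>
        have h := smul c _ (eB α)
        rwa [LatticeVA.eB, ← TensorProduct.tmul_smul, AddMonoidAlgebra.smul_single, smul_eq_mul,
          mul_one] at h
      | add u v hu hv => rw [TensorProduct.add_tmul]; exact add _ _ hu hv
      | smul a u hu => rw [← TensorProduct.smul_tmul']; exact smul _ _ hu
      | neg_mul h n u hu =>
        have h := neg_mul h n _ hu
        rwa [Algebra.TensorProduct.tmul_mul_tmul, one_mul] at h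

lemma comul_neg (h : Cartan L) (n : ℕ) :
    Coalgebra.comul (R := ℂ) (neg h n ⊗ₜ[ℂ] (1 : AddMonoidAlgebra ℂ L)) =
      (neg h n ⊗ₜ[ℂ] (1 : AddMonoidAlgebra ℂ L)) ⊗ₜ[ℂ] (1 : BSpace L) +
        (1 : BSpace L) ⊗ₜ[ℂ] (neg h n ⊗ₜ[ℂ] (1 : AddMonoidAlgebra ℂ L)) := by
  rw [TensorProduct.comul_tmul, neg, SymmetricAlgebra.comul_ι, Bialgebra.comul_one,
    Algebra.TensorProduct.one_def, TensorProduct.add_tmul, map_add]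
  rfl

lemma comul_eB (α : L) : Coalgebra.comul (R := ℂ) (eB α) = eB α ⊗ₜ[ℂ] eB α := by
  rw [eB, TensorProduct.comul_tmul, Bialgebra.comul_one, AddMonoidAlgebra.comul_single,
    Algebra.TensorProduct.one_def, CommSemiring.comul_apply, TensorProduct.map_tmul]
  rfl

lemma counit_neg (h : Cartan L) (n : ℕ) :
    Coalgebra.counit (R := ℂ) (neg h n ⊗ₜ[ℂ] (1 : AddMonoidAlgebra ℂ L)) = 0 := by
  rw [TensorProduct.counit_tmul, neg, SymmetricAlgebra.counit_ι, smul_zero]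

lemma comul_bDeriv (x : BSpace L) :
    Coalgebra.comul (R := ℂ) (bDeriv x) = tensorDeriv bDeriv bDeriv (Coalgebra.comul x) := by
  induction x using bSpace_induction with
  | zero => simp
  | eB α =>
    rw [bDeriv_eB, Bialgebra.comul_mul, comul_neg, comul_eB, tensorDeriv_tmul, bDeriv_eB,
      add_mul, Algebra.TensorProduct.tmul_mul_tmul, Algebra.TensorProduct.tmul_mul_tmul, one_mul]
  | add x y hx hy => simp only [map_add, hx, hy]
  | smul c x hx => simp only [Derivation.map_smul, map_smul, hx]
  | neg_mul h n x hx =>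
    simp only [Derivation.leibniz, Bialgebra.comul_mul, map_add, smul_eq_mul, hx, bDeriv_neg,
      map_smul, comul_neg, tensorDeriv_tmul, Derivation.map_one_eq_zero,
      TensorProduct.tmul_zero, TensorProduct.zero_tmul, add_zero, zero_add,
      TensorProduct.tmul_smul, ← TensorProduct.smul_tmul', smul_add]

lemma counit_bDeriv (x : BSpace L) : Coalgebra.counit (R := ℂ) (bDeriv x) = 0 := by
  induction x using bSpace_induction with
  | zero => simp
  | eB α => rw [bDeriv_eB, Bialgebra.counit_mul, counit_neg, zero_mul]
  | add x y hx hy => simp only [map_add, hx, hy, add_zero]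
  | smul c x hx => simp only [Derivation.map_smul, map_smul, hx, smul_zero]
  | neg_mul h n x hx =>
    simp only [Derivation.leibniz, Bialgebra.counit_mul, map_add, smul_eq_mul, hx, bDeriv_neg,
      map_smul, counit_neg, mul_zero, add_zero]

theorem vertexB_isVertexBialgebra : (vertexB L).IsVertexBialgebra where
  isVertexAlgebra := borcherds_isVertexAlgebra (bDeriv (L := L))
  comul_isHom := by
    unfold vertexB
    rw [borcherds_tensor]
    exact borcherds_isHom (A := BSpace L) (A' := BSpace L ⊗[ℂ] BSpace L)
      (Bialgebra.comulAlgHom ℂ (BSpace L)) (comul_bDeriv (L := L))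
  counit_isHom := borcherds_isHom (A := BSpace L) (Bialgebra.counitAlgHom ℂ (BSpace L))
    (counit_bDeriv (L := L))

/-! ### Exponential sequences -/

section ExpSeq

variable {R : Type*} [Ring R] [Algebra ℂ R]

/-- `E` is the sequence of coefficients of `exp(∑_{k ≥ 0} X k z^{k+1} / (k+1))`, expressed by the
differential equation satisfied by the exponential. -/
structure IsExpSeq (X : ℕ → R) (E : ℤ → R) : Prop where
  zero : E 0 = 1
  of_neg : ∀ n < 0, E n = 0
  recurrence : ∀ n : ℕ, (n : ℂ) • E n = ∑ k ∈ Finset.range n, X k * E (n - 1 - k)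

/-- The Euler operator `z d/dz`. -/
def euler (F : PowerSeries R) : PowerSeries R :=
  PowerSeries.mk fun n => (n : ℂ) • PowerSeries.coeff n F

lemma euler_mul (F G : PowerSeries R) : euler (F * G) = euler F * G + F * euler G := by
  ext n
  simp only [euler, PowerSeries.coeff_mk, map_add, PowerSeries.coeff_mul, Finset.smul_sum,
    ← Finset.sum_add_distrib]
  refine Finset.sum_congr rfl fun p hp => ?_
  rw [Finset.HasAntidiagonal.mem_antidiagonal] at hp
  rw [← hp, smul_mul_assoc, mul_smul_comm, ← add_smul]
  push_cast
  rfl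

lemma commute_euler {F : PowerSeries R}
    (hF : ∀ i j, Commute (PowerSeries.coeff i F) (PowerSeries.coeff j F)) :
    Commute F (euler F) := by
  ext n
  rw [PowerSeries.coeff_mul, PowerSeries.coeff_mul, ← Finset.Nat.sum_antidiagonal_swap]
  refine Finset.sum_congr rfl fun p _ => ?_
  simp only [euler, PowerSeries.coeff_mk, Prod.fst_swap, Prod.snd_swap, mul_smul_comm,
    smul_mul_assoc, (hF p.2 p.1).eq]

lemma euler_pow_succ {F : PowerSeries R} (hF : Commute F (euler F)) (j : ℕ) :
    euler (F ^ (j + 1)) = ((j : ℂ) + 1) • (euler F * F ^ j) := by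
  induction j with
  | zero => simp
  | succ j ih =>
    rw [pow_succ', euler_mul, ih, mul_smul_comm, ← mul_assoc, hF.eq, mul_assoc, ← pow_succ']
    push_cast
    module

lemma coeff_expSeries_eq_sum {F : PowerSeries R} (h0 : PowerSeries.coeff 0 F = 0) {n N : ℕ}
    (h : n < N) : PowerSeries.coeff n (expSeries F) =
      ∑ j ∈ Finset.range N, (j.factorial : ℂ)⁻¹ • PowerSeries.coeff n (F ^ j) := by
  rw [expSeries, PowerSeries.coeff_mk]
  refine Finset.sum_subset (Finset.range_mono h) fun j _ hj => ?_
  have hnj : n < j := by simpa using hj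
  have horder : (n : ℕ∞) < (F ^ j).order :=
    lt_of_lt_of_le (by exact_mod_cast hnj) (PowerSeries.le_order_pow_of_constantCoeff_eq_zero j
      (by rwa [← PowerSeries.coeff_zero_eq_constantCoeff_apply]))
  rw [PowerSeries.coeff_of_lt_order n horder, smul_zero]

lemma succ_smul_coeff_pow_succ {F : PowerSeries R} (hF : Commute F (euler F)) (j n : ℕ) :
    ((n : ℂ) + 1) • PowerSeries.coeff (n + 1) (F ^ (j + 1)) =
      ((j : ℂ) + 1) • ∑ k ∈ Finset.range (n + 1),
        (((k : ℂ) + 1) • PowerSeries.coeff (k + 1) F) * PowerSeries.coeff (n - k) (F ^ j) := by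
  have h := congrArg (PowerSeries.coeff (n + 1)) (euler_pow_succ hF j)
  rw [euler, PowerSeries.coeff_mk, Nat.cast_succ, PowerSeries.coeff_smul,
    PowerSeries.coeff_mul, Finset.Nat.sum_antidiagonal_succ,
    Finset.Nat.sum_antidiagonal_eq_sum_range_succ_mk] at h
  rw [h]
  simp [euler]

/-- The coefficients of `z (exp F)' = z F' exp F`. -/
lemma succ_smul_coeff_expSeries {F : PowerSeries R} (h0 : PowerSeries.coeff 0 F = 0)
    (hF : Commute F (euler F)) (n : ℕ) :
    ((n : ℂ) + 1) • PowerSeries.coeff (n + 1) (expSeries F) =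
      ∑ k ∈ Finset.range (n + 1), (((k : ℂ) + 1) • PowerSeries.coeff (k + 1) F) *
        PowerSeries.coeff (n - k) (expSeries F) := by
  have hterm (j : ℕ) : ((n : ℂ) + 1) • (((j + 1).factorial : ℂ)⁻¹ •
      PowerSeries.coeff (n + 1) (F ^ (j + 1))) =
      ∑ k ∈ Finset.range (n + 1), (((k : ℂ) + 1) • PowerSeries.coeff (k + 1) F) *
        ((j.factorial : ℂ)⁻¹ • PowerSeries.coeff (n - k) (F ^ j)) := by
    have hj : ((j : ℂ) + 1) ≠ 0 := by exact_mod_cast j.succ_ne_zero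
    rw [smul_comm, succ_smul_coeff_pow_succ hF, Nat.factorial_succ, smul_smul, Finset.smul_sum]
    refine Finset.sum_congr rfl fun k _ => ?_
    rw [mul_smul_comm]
    congr 1
    push_cast
    field_simp
  rw [coeff_expSeries_eq_sum h0 (Nat.lt_succ_self (n + 1)), Finset.sum_range_succ', smul_add,
    Finset.smul_sum, Finset.sum_congr rfl fun j _ => hterm j, Finset.sum_comm]
  simp only [pow_zero, PowerSeries.coeff_one, if_neg (Nat.succ_ne_zero n), smul_zero, add_zero]
  refine Finset.sum_congr rfl fun k _ => ?_
  rw [← Finset.mul_sum, coeff_expSeries_eq_sum h0 (by omega : n - k < n + 1)]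

lemma isExpSeq_expSeries {X : ℕ → R} (hX : ∀ j k, Commute (X (j + 1)) (X (k + 1))) :
    IsExpSeq (fun k => X (k + 1)) fun n => if 0 ≤ n then PowerSeries.coeff n.toNat
      (expSeries (PowerSeries.mk fun n => if n = 0 then 0 else (n : ℂ)⁻¹ • X n)) else 0 := by
  set F : PowerSeries R := PowerSeries.mk fun n => if n = 0 then 0 else (n : ℂ)⁻¹ • X n
  have hF0 : PowerSeries.coeff 0 F = 0 := by simp [F]
  have hF_succ (k : ℕ) : PowerSeries.coeff (k + 1) F = ((k : ℂ) + 1)⁻¹ • X (k + 1) := by simp [F]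
  have hF_smul (k : ℕ) : X (k + 1) = ((k : ℂ) + 1) • PowerSeries.coeff (k + 1) F := by
    rw [hF_succ, smul_inv_smul₀ (by exact_mod_cast k.succ_ne_zero)]
  have hcomm (i j : ℕ) : Commute (PowerSeries.coeff i F) (PowerSeries.coeff j F) := by
    rcases i with _ | i
    · rw [hF0]; exact Commute.zero_left _
    rcases j with _ | j
    · rw [hF0]; exact Commute.zero_right _
    rw [hF_succ, hF_succ]
    exact ((hX i j).smul_left _).smul_right _
  refine ⟨by simp [coeff_expSeries_eq_sum hF0 one_pos], fun n hn => if_neg (by omega), ?_⟩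
  rintro (_ | n)
  · simp
  rw [if_pos (by omega), Int.toNat_natCast, Nat.cast_succ,
    succ_smul_coeff_expSeries hF0 (commute_euler hcomm)]
  refine Finset.sum_congr rfl fun k hk => ?_
  rw [Finset.mem_range] at hk
  rw [if_pos (by omega), hF_smul, show (((n + 1 : ℕ) : ℤ) - 1 - k).toNat = n - k by omega]

lemma isExpSeq_expSeries_neg {X : ℕ → R} (hX : ∀ j k, Commute (X (j + 1)) (X (k + 1))) :
    IsExpSeq (fun k => -X (k + 1)) fun n => if 0 ≤ n then PowerSeries.coeff n.toNat
      (expSeries (PowerSeries.mk fun n => if n = 0 then 0 else -((n : ℂ)⁻¹ • X n))) else 0 := by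
  simpa only [smul_neg] using
    isExpSeq_expSeries (X := fun k => -X k) fun j k => (hX j k).neg_right.neg_left

lemma eq_zero_of_smul_eq_sum_mul {X : ℕ → R} {D : ℤ → R} (hneg : ∀ n < 0, D n = 0)
    (hzero : D 0 = 0)
    (hrec : ∀ n : ℕ, (n : ℂ) • D n = ∑ k ∈ Finset.range n, X k * D (n - 1 - k)) (n : ℤ) :
    D n = 0 := by
  rcases lt_or_ge n 0 with hn | hn
  · exact hneg n hn
  obtain ⟨n, rfl⟩ := Int.eq_ofNat_of_zero_le hn
  induction n using Nat.strong_induction_on with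
  | _ n ih =>
    rcases Nat.eq_zero_or_pos n with rfl | hpos
    · exact hzero
    have hn0 : (n : ℂ) ≠ 0 := by exact_mod_cast hpos.ne'
    refine smul_right_injective R hn0 ?_
    beta_reduce
    rw [hrec, smul_zero]
    refine Finset.sum_eq_zero fun k hk => ?_
    rw [Finset.mem_range] at hk
    rw [show (n - 1 - k : ℤ) = (n - 1 - k : ℕ) by omega, ih _ (by omega) (by omega), mul_zero]

namespace IsExpSeq

variable {X : ℕ → R} {E : ℤ → R}

lemma recurrence_sub (hE : IsExpSeq X E) (j n : ℕ) :
    ((n : ℂ) - (j + 1)) • E (n - (j + 1)) =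
      ∑ k ∈ Finset.range n, X k * E (n - (j + 1) - 1 - k) := by
  rcases le_or_gt (j + 1) n with h | h
  · have hrec := hE.recurrence (n - (j + 1))
    rw [Nat.cast_sub h, Nat.cast_sub h] at hrec
    push_cast at hrec
    rw [hrec]
    refine Finset.sum_subset (Finset.range_mono (Nat.sub_le _ _)) fun k _ hk => ?_
    rw [Finset.mem_range] at hk
    rw [hE.of_neg _ (by omega), mul_zero]
  · rw [hE.of_neg _ (by omega), smul_zero, Finset.sum_eq_zero]
    intro k _
    rw [hE.of_neg _ (by omega), mul_zero]

lemma commutator (hE : IsExpSeq X E) {H : R} {j : ℕ} {c : ℂ}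
    (hX : ∀ k, H * X k = X k * H + if k = j then (((j : ℂ) + 1) * c) • 1 else 0) (n : ℤ) :
    H * E n = E n * H + c • E (n - (j + 1)) := by
  rw [← sub_eq_zero, ← sub_sub]
  refine eq_zero_of_smul_eq_sum_mul (X := X)
    (D := fun n => H * E n - E n * H - c • E (n - (j + 1))) (fun n hn => ?_) ?_ (fun n => ?_) n
  · simp [hE.of_neg n hn, hE.of_neg (n - (j + 1)) (by omega)]
  · simp only [hE.zero, hE.of_neg (0 - (j + 1)) (by omega), mul_one, one_mul, sub_self, smul_zero]
  have hHX (k : ℕ) : H * (X k * E (n - 1 - k)) = X k * (H * E (n - 1 - k)) +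
      if k = j then (((j : ℂ) + 1) * c) • E (n - 1 - k) else 0 := by
    rw [← mul_assoc, hX, add_mul, mul_assoc]
    split_ifs <;> simp
  have hj : (if j ∈ Finset.range n then (((j : ℂ) + 1) * c) • E (n - 1 - j) else 0) =
      (((j : ℂ) + 1) * c) • E (n - (j + 1)) := by
    rw [show (n - 1 - j : ℤ) = n - (j + 1) by ring]
    split_ifs with h
    · rfl
    · rw [Finset.mem_range] at h
      rw [hE.of_neg _ (by omega), smul_zero]
  calc (n : ℂ) • (H * E n - E n * H - c • E (n - (j + 1)))
      = ∑ k ∈ Finset.range n, X k * (H * E (n - 1 - k)) -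
          ∑ k ∈ Finset.range n, X k * (E (n - 1 - k) * H) -
          c • (((n : ℂ) - (j + 1)) • E (n - (j + 1))) := by
        rw [smul_sub, smul_sub, ← mul_smul_comm, ← smul_mul_assoc, hE.recurrence, Finset.mul_sum,
          Finset.sum_congr rfl fun k _ => hHX k, Finset.sum_add_distrib, Finset.sum_ite_eq', hj,
          Finset.sum_mul]
        simp only [mul_assoc]
        module
    _ = ∑ k ∈ Finset.range n, X k * (H * E (n - 1 - k) - E (n - 1 - k) * H -
          c • E (n - 1 - k - (j + 1))) := by
        rw [hE.recurrence_sub, Finset.smul_sum, ← Finset.sum_sub_distrib, ← Finset.sum_sub_distrib]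
        refine Finset.sum_congr rfl fun k _ => ?_
        rw [mul_sub, mul_sub, mul_smul_comm,
          show (n - 1 - k - (j + 1) : ℤ) = n - (j + 1) - 1 - k by ring]

lemma commute (hE : IsExpSeq X E) {H : R} (hX : ∀ k, Commute H (X k)) (n : ℤ) :
    Commute H (E n) := by
  have h := hE.commutator (H := H) (j := 0) (c := 0) (fun k => by simp [(hX k).eq]) n
  simpa [Commute, SemiconjBy] using h

lemma sum_succ_smul_sub (hE : IsExpSeq X E) (n : ℕ) :
    ∑ k ∈ Finset.range n, (((k : ℂ) + 1) • (X (k + 1) * E (n - 1 - k)) -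
      (k : ℂ) • (X k * E (n - k))) = (n : ℂ) • X n := by
  have h := Finset.sum_range_sub (fun k : ℕ => (k : ℂ) • (X k * E (n - k))) n
  simp only [Nat.cast_succ, sub_add_eq_sub_sub, sub_right_comm _ _ (1 : ℤ)] at h
  simpa [hE.zero, sub_right_comm _ _ (1 : ℤ)] using h

lemma derivation (hE : IsExpSeq X E) (hX : ∀ k, Commute (X 0) (X k)) {T : R}
    (hT : ∀ k : ℕ, T * X k = X k * T + ((k : ℂ) + 1) • X (k + 1)) (n : ℤ) :
    T * E n = E n * T - X 0 * E n + ((n : ℂ) + 1) • E (n + 1) := by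
  rw [← sub_eq_zero]
  refine eq_zero_of_smul_eq_sum_mul (X := X)
    (D := fun n => T * E n - (E n * T - X 0 * E n + ((n : ℂ) + 1) • E (n + 1)))
    (fun n hn => ?_) ?_ (fun n => ?_) n
  · rcases eq_or_ne n (-1) with rfl | h
    · simp [hE.of_neg (-1) hn]
    · simp [hE.of_neg n hn, hE.of_neg (n + 1) (by omega)]
  · have h := hE.recurrence 1
    simp only [Nat.cast_one, one_smul, Finset.sum_range_one, Nat.cast_zero, sub_self,
      hE.zero, mul_one] at h
    simp [hE.zero, h]
  have hTX (k : ℕ) : T * (X k * E (n - 1 - k)) =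
      X k * (T * E (n - 1 - k)) + ((k : ℂ) + 1) • (X (k + 1) * E (n - 1 - k)) := by
    rw [← mul_assoc, hT, add_mul, mul_assoc, smul_mul_assoc]
  have hsucc : ((n : ℂ) + 1) • E (n + 1) = ∑ k ∈ Finset.range n, X k * E (n - k) + X n := by
    have h := hE.recurrence (n + 1)
    rw [Finset.sum_range_succ] at h
    push_cast at h
    simpa [hE.zero] using h
  calc (n : ℂ) • (T * E n - (E n * T - X 0 * E n + ((n : ℂ) + 1) • E (n + 1)))
      = ∑ k ∈ Finset.range n, (X k * (T * E (n - 1 - k)) - X k * E (n - 1 - k) * T +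
          X 0 * (X k * E (n - 1 - k)) - (n : ℂ) • (X k * E (n - k)) +
          ((k : ℂ) + 1) • (X (k + 1) * E (n - 1 - k))) - (n : ℂ) • X n := by
        rw [hsucc, smul_sub, smul_add, smul_sub, ← mul_smul_comm, ← smul_mul_assoc,
          ← mul_smul_comm, hE.recurrence, Finset.mul_sum, Finset.sum_congr rfl fun k _ => hTX k]
        simp only [Finset.sum_add_distrib, Finset.sum_sub_distrib, Finset.sum_mul, Finset.mul_sum,
          ← Finset.smul_sum, smul_add]
        abel
    _ = ∑ k ∈ Finset.range n, X k * (T * E (n - 1 - k) - (E (n - 1 - k) * T -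
          X 0 * E (n - 1 - k) + (((n - 1 - k : ℤ) : ℂ) + 1) • E (n - 1 - k + 1))) := by
        rw [← hE.sum_succ_smul_sub n, ← Finset.sum_sub_distrib]
        refine Finset.sum_congr rfl fun k _ => ?_
        rw [show (n - 1 - k + 1 : ℤ) = n - k by ring, mul_sub, mul_add, mul_sub, mul_smul_comm,
          ← mul_assoc (X k) (X 0), ← (hX k).eq, mul_assoc (X 0), mul_assoc (X k) _ T]
        push_cast
        module

end IsExpSeq

end ExpSeq

variable (B)

/-! ### The Heisenberg operators -/

lemma heis_zero_tmul (h : Cartan L) (u : Fock L) (β : L) (c : ℂ) :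
    heis B h 0 (u ⊗ₜ[ℂ] Finsupp.single β c) =
      B.baseChange ℂ h (toCartan β) • (u ⊗ₜ[ℂ] Finsupp.single β c) := by
  change u ⊗ₜ[ℂ] (zeroMode B h (Finsupp.single β c)) = _
  rw [zeroMode, Finsupp.lsum_single, LinearMap.smul_apply, TensorProduct.tmul_smul]
  rfl

lemma heis_pos_tmul (h : Cartan L) (n : ℕ) (u : Fock L) (f : L →₀ ℂ) :
    heis B h (n + 1) (u ⊗ₜ[ℂ] f) = annih B h n u ⊗ₜ[ℂ] f := rfl

lemma heis_neg_tmul (h : Cartan L) (n : ℕ) (u : Fock L) (f : L →₀ ℂ) :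
    heis B h (-(n + 1)) (u ⊗ₜ[ℂ] f) = (neg h n * u) ⊗ₜ[ℂ] f := by
  rw [← Int.negSucc_eq]
  rfl

lemma annih_neg (h h' : Cartan L) (n k : ℕ) :
    annih B h n (neg h' k) =
      algebraMap ℂ (Fock L) (if k = n then ((n : ℂ) + 1) * B.baseChange ℂ h h' else 0) := by
  rw [annih, neg, symDeriv_ι]
  simp only [LinearMap.comp_apply, LinearMap.smul_apply, Finsupp.lapply_apply,
    Finsupp.single_apply, Algebra.linearMap_apply, smul_eq_mul]
  split_ifs <;> simp

lemma annih_neg_mul (h h' : Cartan L) (n k : ℕ) (u : Fock L) :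
    annih B h n (neg h' k * u) = neg h' k * annih B h n u +
      (if k = n then ((n : ℂ) + 1) * B.baseChange ℂ h h' else 0) • u := by
  rw [Derivation.leibniz, annih_neg, smul_eq_mul, smul_eq_mul, mul_comm u, Algebra.smul_def]

lemma annih_comm (h h' : Cartan L) (n k : ℕ) (u : Fock L) :
    annih B h n (annih B h' k u) = annih B h' k (annih B h n u) := by
  induction u using fock_induction with
  | zero => simp
  | one => simp
  | add u v hu hv => simp only [map_add, hu, hv]
  | smul c u hu => simp only [Derivation.map_smul, hu]
  | neg_mul h'' j u hu =>
    simp only [annih_neg_mul, map_add, Derivation.map_smul, hu]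
    abel

variable {B}

lemma vSpace_induction_tmul {p : VSpace L → Prop} (zero : p 0)
    (add : ∀ v w, p v → p w → p (v + w)) (tmul : ∀ u β, p (u ⊗ₜ[ℂ] Finsupp.single β (1 : ℂ)))
    (v : VSpace L) : p v := by
  induction v using TensorProduct.induction_on with
  | zero => exact zero
  | add x y hx hy => exact add x y hx hy
  | tmul u f =>
    induction f using Finsupp.induction_linear with
    | zero => simpa using zero
    | add f g hf hg => rw [TensorProduct.tmul_add]; exact add _ _ hf hg
    | single α c =>
      have h := tmul (c • u) α
      rwa [TensorProduct.smul_tmul, Finsupp.smul_single, smul_eq_mul, mul_one] at h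

lemma vSpace_induction {p : VSpace L → Prop} (zero : p 0) (eV : ∀ α, p (eV α))
    (add : ∀ v w, p v → p w → p (v + w)) (smul : ∀ (c : ℂ) v, p v → p (c • v))
    (heis : ∀ (h : Cartan L) (n : ℕ) v, p v → p (heis B h (-(n + 1)) v)) (v : VSpace L) :
    p v := by
  induction v using vSpace_induction_tmul with
  | zero => exact zero
  | add x y hx hy => exact add x y hx hy
  | tmul u α =>
    induction u using fock_induction with
    | zero => simpa using zero
    | one => exact eV α
    | add u v hu hv => rw [TensorProduct.add_tmul]; exact add _ _ hu hv
    | smul a u hu => rw [← TensorProduct.smul_tmul']; exact smul _ _ hu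
    | neg_mul h n u hu =>
      have h := heis h n _ hu
      rwa [heis_neg_tmul] at h

lemma baseChange_comm (hsymm : B.IsSymm) (h h' : Cartan L) :
    B.baseChange ℂ h h' = B.baseChange ℂ h' h :=
  (LinearMap.BilinForm.IsSymm.baseChange ℂ (B₂ := B) ⟨fun x y => hsymm.eq x y⟩).eq h h'

lemma int_cases (m : ℤ) : (∃ k : ℕ, m = k + 1) ∨ m = 0 ∨ ∃ k : ℕ, m = -(k + 1) := by
  rcases lt_trichotomy m 0 with h | h | h
  · exact Or.inr (Or.inr ⟨(-m - 1).toNat, by omega⟩)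
  · exact Or.inr (Or.inl h)
  · exact Or.inl ⟨(m - 1).toNat, by omega⟩

lemma heis_commutator_of_pos (h h' : Cartan L) (j : ℕ) (n : ℤ) (v : VSpace L) :
    heis B h (j + 1) (heis B h' n v) = heis B h' n (heis B h (j + 1) v) +
      (if j + 1 + n = 0 then ((j : ℂ) + 1) * B.baseChange ℂ h h' else 0) • v := by
  induction v using vSpace_induction_tmul with
  | zero => simp
  | add v w hv hw => simp only [map_add, hv, hw, smul_add]; abel
  | tmul u β =>
    rcases int_cases n with ⟨k, rfl⟩ | rfl | ⟨k, rfl⟩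
    · rw [if_neg (by omega), zero_smul, add_zero]
      simp only [heis_pos_tmul, annih_comm B h h']
    · rw [if_neg (by omega), zero_smul, add_zero]
      simp only [heis_pos_tmul, heis_zero_tmul, map_smul]
    · simp only [heis_pos_tmul, heis_neg_tmul, annih_neg_mul, TensorProduct.add_tmul,
        ← TensorProduct.smul_tmul']
      congr 2
      exact if_congr (by omega) rfl rfl

lemma commute_heis_of_nonpos (h h' : Cartan L) {m n : ℤ} (hm : m ≤ 0) (hn : n ≤ 0) :
    Commute (heis B h m) (heis B h' n) := by
  refine LinearMap.ext fun v => ?_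
  simp only [Module.End.mul_apply]
  induction v using vSpace_induction_tmul with
  | zero => simp only [map_zero]
  | add v w hv hw => simp only [map_add, hv, hw]
  | tmul u β =>
    rcases int_cases m with ⟨j, rfl⟩ | rfl | ⟨j, rfl⟩
    · omega
    · rcases int_cases n with ⟨k, rfl⟩ | rfl | ⟨k, rfl⟩
      · omega
      · simp only [heis_zero_tmul, map_smul, smul_comm (B.baseChange ℂ h (toCartan β))]
      · simp only [heis_neg_tmul, heis_zero_tmul, map_smul]
    · rcases int_cases n with ⟨k, rfl⟩ | rfl | ⟨k, rfl⟩
      · omega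
      · simp only [heis_neg_tmul, heis_zero_tmul, map_smul]
      · simp only [heis_neg_tmul, mul_left_comm]

lemma commute_heis_of_pos_of_nonneg (h h' : Cartan L) {m n : ℤ} (hm : 0 < m) (hn : 0 ≤ n) :
    Commute (heis B h m) (heis B h' n) := by
  obtain ⟨j, rfl⟩ : ∃ j : ℕ, m = j + 1 := ⟨(m - 1).toNat, by omega⟩
  refine LinearMap.ext fun v => ?_
  simp only [Module.End.mul_apply]
  rw [heis_commutator_of_pos, if_neg (by omega), zero_smul, add_zero]

theorem heis_commutator (hsymm : B.IsSymm) (h h' : Cartan L) (m n : ℤ) (v : VSpace L) :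
    heis B h m (heis B h' n v) = heis B h' n (heis B h m v) +
      (if m + n = 0 then (m : ℂ) * B.baseChange ℂ h h' else 0) • v := by
  rcases lt_or_ge 0 m with hm | hm
  · obtain ⟨j, rfl⟩ : ∃ j : ℕ, m = j + 1 := ⟨(m - 1).toNat, by omega⟩
    rw [heis_commutator_of_pos]
    push_cast
    rfl
  rcases lt_or_ge 0 n with hn | hn
  · obtain ⟨k, rfl⟩ : ∃ k : ℕ, n = k + 1 := ⟨(n - 1).toNat, by omega⟩
    rw [heis_commutator_of_pos, baseChange_comm hsymm h' h, add_assoc, ← add_smul]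
    split_ifs with h₁ h₂ h₂
    · rw [show m = -(k + 1) by omega]
      push_cast
      rw [neg_mul, add_neg_cancel, zero_smul, add_zero]
    · omega
    · omega
    · rw [add_zero, zero_smul, add_zero]
  · have hcomm : heis B h m (heis B h' n v) = heis B h' n (heis B h m v) :=
      congr($((commute_heis_of_nonpos h h' hm hn).eq) v)
    rw [hcomm, left_eq_add]
    split_ifs with hmn
    · rw [show m = 0 by omega, Int.cast_zero, zero_mul, zero_smul]
    · exact zero_smul _ _

lemma heis_eV_pos (h : Cartan L) {n : ℤ} (hn : 0 < n) (γ : L) : heis B h n (eV γ) = 0 := by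
  obtain ⟨k, rfl⟩ : ∃ k : ℕ, n = k + 1 := ⟨(n - 1).toNat, by omega⟩
  rw [eV, heis_pos_tmul]
  simp

lemma heis_zero_eV (h : Cartan L) (γ : L) :
    heis B h 0 (eV γ) = B.baseChange ℂ h (toCartan γ) • eV γ := heis_zero_tmul B h 1 γ 1

lemma baseChange_toCartan (α β : L) :
    B.baseChange ℂ (toCartan α) (toCartan β) = (B α β : ℂ) := by
  simp [toCartan, LinearMap.BilinForm.baseChange_tmul]

lemma heis_toCartan_add_neg (α β : L) (n : ℕ) (v : VSpace L) :
    heis B (toCartan (α + β)) (-(n + 1)) v =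
      heis B (toCartan α) (-(n + 1)) v + heis B (toCartan β) (-(n + 1)) v := by
  induction v using vSpace_induction_tmul with
  | zero => simp
  | add v w hv hw => simp only [map_add, hv, hw]; abel
  | tmul u γ => simp only [heis_neg_tmul, neg_toCartan_add, add_mul, TensorProduct.add_tmul]

/-! ### The translation operator -/

variable (L) in
/-- The identification of the spaces underlying `B_L` and `V_L`. -/
def bEquivV : BSpace L ≃ₗ[ℂ] VSpace L :=
  TensorProduct.congr (LinearEquiv.refl ℂ (Fock L)) (AddMonoidAlgebra.coeffLinearEquiv ℂ)

lemma bEquivV_tmul_single (u : Fock L) (α : L) (c : ℂ) :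
    bEquivV L (u ⊗ₜ AddMonoidAlgebra.single α c) = u ⊗ₜ Finsupp.single α c := by
  simp [bEquivV]

lemma bEquivV_eB (α : L) : bEquivV L (eB α) = eV α := bEquivV_tmul_single 1 α 1

lemma bEquivV_neg_mul (h : Cartan L) (n : ℕ) (x : BSpace L) :
    bEquivV L ((neg h n ⊗ₜ[ℂ] 1) * x) = heis B h (-(n + 1)) (bEquivV L x) := by
  induction x using TensorProduct.induction_on with
  | zero => simp
  | add x y hx hy => simp only [mul_add, map_add, hx, hy]
  | tmul u f =>
    rw [Algebra.TensorProduct.tmul_mul_tmul, one_mul]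
    simp only [bEquivV, TensorProduct.congr_tmul, LinearEquiv.refl_apply, heis_neg_tmul]

variable (L) in
/-- The translation operator of `V_L`. -/
def transV : Module.End ℂ (VSpace L) :=
  (bEquivV L).toLinearMap ∘ₗ (bDeriv : Derivation ℂ (BSpace L) (BSpace L)).toLinearMap ∘ₗ
    (bEquivV L).symm.toLinearMap

lemma transV_bEquivV (x : BSpace L) : transV L (bEquivV L x) = bEquivV L (bDeriv x) := by
  simp [transV]

lemma transV_eV (γ : L) : transV L (eV γ) = heis B (toCartan γ) (-1) (eV γ) := by
  rw [← bEquivV_eB, transV_bEquivV, bDeriv_eB, bEquivV_neg_mul (B := B)]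
  simp

lemma transV_heis_neg (h : Cartan L) (n : ℕ) (v : VSpace L) :
    transV L (heis B h (-(n + 1)) v) = heis B h (-(n + 1)) (transV L v) +
      ((n : ℂ) + 1) • heis B h (-(n + 1) - 1) v := by
  obtain ⟨x, rfl⟩ := (bEquivV L).surjective v
  rw [← bEquivV_neg_mul, transV_bEquivV, transV_bEquivV, ← bEquivV_neg_mul, Derivation.leibniz,
    bDeriv_neg, map_add, smul_eq_mul, smul_eq_mul, mul_smul_comm, map_smul, mul_comm x,
    bEquivV_neg_mul (B := B) h (n + 1)]
  congr 4

lemma transV_heis_of_nonneg (hsymm : B.IsSymm) (h : Cartan L) {n : ℤ} (hn : 0 ≤ n)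
    (v : VSpace L) :
    transV L (heis B h n v) = heis B h n (transV L v) - n • heis B h (n - 1) v := by
  induction v using vSpace_induction (B := B) with
  | zero => simp
  | add v w hv hw => simp only [map_add, hv, hw, smul_add]; abel
  | smul c v hv => simp only [map_smul, hv, smul_sub, smul_comm n c]
  | eV γ =>
    rw [transV_eV (B := B), heis_commutator hsymm]
    rcases eq_or_ne n 0 with rfl | h0
    · simp [heis_zero_eV, transV_eV (B := B)]
    rw [heis_eV_pos h (by omega), map_zero, map_zero, zero_add]
    rcases eq_or_ne n 1 with rfl | h1
    · simp [heis_zero_eV]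
    · rw [heis_eV_pos h (by omega : 0 < n - 1), if_neg (by omega)]
      simp
  | heis h' k v hv =>
    rw [heis_commutator hsymm, map_add, map_smul, transV_heis_neg, transV_heis_neg, hv, map_add,
      map_smul, map_sub, map_zsmul, heis_commutator hsymm h h' n _ (transV L v),
      heis_commutator hsymm h h' n _ v, heis_commutator hsymm h h' (n - 1) _ v,
      ← Int.cast_smul_eq_zsmul ℂ, ← Int.cast_smul_eq_zsmul ℂ]
    by_cases hk : n = k + 1 + 1
    · subst hk
      rw [if_neg (show ¬ (k : ℤ) + 1 + 1 + -(k + 1) = 0 by omega),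
        if_pos (show (k : ℤ) + 1 + 1 + (-(k + 1) - 1) = 0 by ring),
        if_pos (show (k : ℤ) + 1 + 1 - 1 + -(k + 1) = 0 by ring)]
      push_cast
      module
    · rw [if_neg (show ¬ n + (-(k + 1) - 1) = 0 by omega),
        if_neg (show ¬ n - 1 + -(k + 1 : ℤ) = 0 by omega)]
      module

lemma transV_heis (hsymm : B.IsSymm) (h : Cartan L) (n : ℤ) (v : VSpace L) :
    transV L (heis B h n v) = heis B h n (transV L v) - n • heis B h (n - 1) v := by
  rcases le_or_gt 0 n with hn | hn
  · exact transV_heis_of_nonneg hsymm h hn v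
  · obtain ⟨k, rfl⟩ : ∃ k : ℕ, n = -(k + 1) := ⟨(-n - 1).toNat, by omega⟩
    rw [transV_heis_neg, ← Int.cast_smul_eq_zsmul ℂ]
    push_cast
    module

/-! ### The exponentials -/

variable (B) in
/-- The coefficient of `zⁿ` in `E⁻(-α,z)`, for `n ∈ ℤ`. -/
def eminusCoeff (α : L) (n : ℤ) : Module.End ℂ (VSpace L) :=
  if 0 ≤ n then PowerSeries.coeff n.toNat (Eminus B α) else 0

variable (B) in
/-- The coefficient of `z⁻ⁿ` in `E⁺(-α,z)`, for `n ∈ ℤ`. -/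
def eplusCoeff (α : L) (n : ℤ) : Module.End ℂ (VSpace L) :=
  if 0 ≤ n then PowerSeries.coeff n.toNat (Eplus B α) else 0

variable (B)

lemma isExpSeq_eminusCoeff (α : L) :
    IsExpSeq (fun k : ℕ => heis B (toCartan α) (-(k + 1))) (eminusCoeff B α) :=
  isExpSeq_expSeries (X := fun n : ℕ => heis B (toCartan α) (-n)) fun _ _ =>
    commute_heis_of_nonpos _ _ (by omega) (by omega)

lemma isExpSeq_eplusCoeff (α : L) :
    IsExpSeq (fun k : ℕ => -heis B (toCartan α) (k + 1)) (eplusCoeff B α) :=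
  isExpSeq_expSeries_neg (X := fun n : ℕ => heis B (toCartan α) n) fun _ _ =>
    commute_heis_of_pos_of_nonneg _ _ (by omega) (by omega)

lemma heis_pos_eminusCoeff (h : Cartan L) (α : L) (j : ℕ) (n : ℤ) (v : VSpace L) :
    heis B h (j + 1) (eminusCoeff B α n v) = eminusCoeff B α n (heis B h (j + 1) v) +
      B.baseChange ℂ h (toCartan α) • eminusCoeff B α (n - (j + 1)) v := by
  refine congr($((isExpSeq_eminusCoeff B α).commutator (H := heis B h (j + 1)) (j := j)
    (c := B.baseChange ℂ h (toCartan α)) (fun k => ?_) n) v)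
  refine LinearMap.ext fun w => ?_
  simp only [Module.End.mul_apply, LinearMap.add_apply, heis_commutator_of_pos]
  by_cases hk : k = j
  · subst hk; simp
  · rw [if_neg hk, if_neg (by omega), zero_smul, LinearMap.zero_apply]

lemma heis_neg_eplusCoeff (h : Cartan L) (α : L) (j : ℕ) (n : ℤ) (v : VSpace L) :
    heis B h (-(j + 1)) (eplusCoeff B α n v) = eplusCoeff B α n (heis B h (-(j + 1)) v) +
      B.baseChange ℂ (toCartan α) h • eplusCoeff B α (n - (j + 1)) v := by
  refine congr($((isExpSeq_eplusCoeff B α).commutator (H := heis B h (-(j + 1))) (j := j)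
    (c := B.baseChange ℂ (toCartan α) h) (fun k => ?_) n) v)
  refine LinearMap.ext fun w => ?_
  simp only [Module.End.mul_apply, LinearMap.add_apply, LinearMap.neg_apply, map_neg,
    heis_commutator_of_pos]
  by_cases hk : k = j
  · subst hk; simp
  · rw [if_neg hk, if_neg (by omega), zero_smul, add_zero, LinearMap.zero_apply, add_zero]

variable {B}

lemma heis_eminusCoeff_comm (h : Cartan L) (α : L) {m : ℤ} (hm : m ≤ 0) (n : ℤ)
    (v : VSpace L) : heis B h m (eminusCoeff B α n v) = eminusCoeff B α n (heis B h m v) :=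
  congr($(((isExpSeq_eminusCoeff B α).commute (H := heis B h m) fun _ =>
    commute_heis_of_nonpos _ _ hm (by omega)) n) v)

lemma heis_eplusCoeff_comm (h : Cartan L) (α : L) {m : ℤ} (hm : 0 ≤ m) (n : ℤ)
    (v : VSpace L) : heis B h m (eplusCoeff B α n v) = eplusCoeff B α n (heis B h m v) := by
  refine congr($(((isExpSeq_eplusCoeff B α).commute (H := heis B h m) fun k => ?_) n) v)
  have hcomm : Commute (heis B h m) (heis B (toCartan α) (k + 1)) :=
    (commute_heis_of_pos_of_nonneg _ _ (by omega) hm).symm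
  refine LinearMap.ext fun w => ?_
  simp only [Module.End.mul_apply, LinearMap.neg_apply, map_neg]
  exact congr(-$(hcomm.eq) w)

lemma eminusCoeff_comm (α β : L) (m n : ℤ) (v : VSpace L) :
    eminusCoeff B α m (eminusCoeff B β n v) = eminusCoeff B β n (eminusCoeff B α m v) := by
  refine congr($(((isExpSeq_eminusCoeff B β).commute (H := eminusCoeff B α m) fun k => ?_) n) v)
  refine LinearMap.ext fun w => ?_
  exact (heis_eminusCoeff_comm _ α (by omega) m w).symm

lemma eplusCoeff_eV (α γ : L) (n : ℤ) :
    eplusCoeff B α n (eV γ) = if n = 0 then eV γ else 0 := by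
  have hE := isExpSeq_eplusCoeff B α
  rcases lt_trichotomy n 0 with hn | rfl | hn
  · rw [hE.of_neg n hn, if_neg hn.ne, LinearMap.zero_apply]
  · rw [hE.zero, if_pos rfl, Module.End.one_apply]
  · lift n to ℕ using hn.le
    rw [if_neg hn.ne']
    have h := congr($(hE.recurrence n) (eV γ))
    rw [LinearMap.smul_apply, LinearMap.sum_apply, Finset.sum_eq_zero] at h
    · exact (smul_eq_zero.mp h).resolve_left (by exact_mod_cast hn.ne')
    · intro k _
      rw [Module.End.mul_apply, LinearMap.neg_apply, heis_eplusCoeff_comm _ _ (by omega),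
        heis_eV_pos _ (by omega), map_zero, neg_zero]

variable (B)

lemma exists_eplusCoeff_eq_zero (α : L) (v : VSpace L) :
    ∃ N : ℤ, ∀ n, N ≤ n → eplusCoeff B α n v = 0 := by
  induction v using vSpace_induction (B := B) with
  | zero => exact ⟨0, by simp⟩
  | eV γ => exact ⟨1, fun n hn => by rw [eplusCoeff_eV, if_neg (by omega)]⟩
  | add v w hv hw =>
    obtain ⟨N, hN⟩ := hv
    obtain ⟨M, hM⟩ := hw
    exact ⟨max N M, fun n hn => by rw [map_add, hN n (by omega), hM n (by omega), add_zero]⟩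
  | smul c v hv =>
    obtain ⟨N, hN⟩ := hv
    exact ⟨N, fun n hn => by rw [map_smul, hN n hn, smul_zero]⟩
  | heis h k v hv =>
    obtain ⟨N, hN⟩ := hv
    refine ⟨N + (k + 1), fun n hn => ?_⟩
    have h := heis_neg_eplusCoeff B h α k n v
    rw [hN n (by omega), hN (n - (k + 1)) (by omega), map_zero, smul_zero, add_zero] at h
    exact h.symm

/-! ### The normally ordered product `E⁻(-α,z)E⁺(-α,z)` -/

lemma finite_support_eminusCoeff_eplusCoeff (α : L) (n : ℤ) (v : VSpace L) :
    (Function.support fun p : ℤ => eminusCoeff B α (n + p) (eplusCoeff B α p v)).Finite := by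
  obtain ⟨N, hN⟩ := exists_eplusCoeff_eq_zero B α v
  refine (Set.finite_Ico 0 N).subset fun p hp => ?_
  by_contra h
  apply hp
  rcases lt_or_ge p 0 with h0 | h0
  · simp [(isExpSeq_eplusCoeff B α).of_neg p h0]
  · rw [Set.mem_Ico] at h
    simp [hN p (by omega)]

/-- The coefficient of `zⁿ` in `E⁻(-α,z)E⁺(-α,z)`. -/
def expCoeff (α : L) (n : ℤ) : Module.End ℂ (VSpace L) where
  toFun v := ∑ᶠ p : ℤ, eminusCoeff B α (n + p) (eplusCoeff B α p v)
  map_add' v w := by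
    simp only [map_add]
    exact finsum_add_distrib (finite_support_eminusCoeff_eplusCoeff B α n v)
      (finite_support_eminusCoeff_eplusCoeff B α n w)
  map_smul' c v := by
    simp only [map_smul, RingHom.id_apply]
    exact (smul_finsum' c (finite_support_eminusCoeff_eplusCoeff B α n v)).symm

lemma expCoeff_apply (α : L) (n : ℤ) (v : VSpace L) :
    expCoeff B α n v = ∑ᶠ p : ℤ, eminusCoeff B α (n + p) (eplusCoeff B α p v) := rfl

lemma expCoeff_eV (α γ : L) (n : ℤ) :
    expCoeff B α n (eV γ) = eminusCoeff B α n (eV γ) := by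
  rw [expCoeff_apply, finsum_eq_single _ 0]
  · simp [eplusCoeff_eV]
  · intro p hp
    simp [eplusCoeff_eV, hp]

lemma exists_expCoeff_eq_zero (α : L) (v : VSpace L) :
    ∃ N : ℤ, ∀ n, n ≤ N → expCoeff B α n v = 0 := by
  obtain ⟨N, hN⟩ := exists_eplusCoeff_eq_zero B α v
  refine ⟨-N, fun n hn => ?_⟩
  rw [expCoeff_apply]
  refine finsum_eq_zero_of_forall_eq_zero fun p => ?_
  rcases lt_or_ge p N with h | h
  · rw [(isExpSeq_eminusCoeff B α).of_neg _ (by omega), LinearMap.zero_apply]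
  · rw [hN p h, map_zero]

variable {B}

lemma heis_zero_expCoeff (h : Cartan L) (α : L) (n : ℤ) (v : VSpace L) :
    heis B h 0 (expCoeff B α n v) = expCoeff B α n (heis B h 0 v) := by
  simp only [expCoeff_apply]
  rw [map_finsum _ (finite_support_eminusCoeff_eplusCoeff B α n v)]
  simp only [heis_eminusCoeff_comm h α le_rfl, heis_eplusCoeff_comm h α le_rfl]

lemma heis_expCoeff (hsymm : B.IsSymm) (h : Cartan L) (α : L) {m : ℤ} (hm : m ≠ 0) (n : ℤ)
    (v : VSpace L) :
    heis B h m (expCoeff B α n v) = expCoeff B α n (heis B h m v) +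
      B.baseChange ℂ h (toCartan α) • expCoeff B α (n - m) v := by
  have hfin := finite_support_eminusCoeff_eplusCoeff B α (n - m) v
  simp only [expCoeff_apply]
  rw [map_finsum _ (finite_support_eminusCoeff_eplusCoeff B α n v)]
  rcases int_cases m with ⟨j, rfl⟩ | rfl | ⟨j, rfl⟩
  · simp only [heis_pos_eminusCoeff, heis_eplusCoeff_comm h α (by omega : (0 : ℤ) ≤ j + 1)]
    rw [finsum_add_distrib (finite_support_eminusCoeff_eplusCoeff B α n _) _]
    · rw [smul_finsum' _ hfin]
      simp only [add_sub_right_comm]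
    · refine hfin.subset fun p hp => ?_
      contrapose! hp
      rw [Function.notMem_support, add_sub_right_comm] at *
      rw [hp, smul_zero]
  · exact absurd rfl hm
  · have hs (p : ℤ) : eminusCoeff B α (n + p) (eplusCoeff B α (p - (j + 1)) v) =
        eminusCoeff B α (n - -(j + 1) + (p - (j + 1))) (eplusCoeff B α (p - (j + 1)) v) := by
      congr 2
      ring
    have hfin' : (Function.support fun p : ℤ =>
        eminusCoeff B α (n + p) (eplusCoeff B α (p - (j + 1)) v)).Finite := by
      simp only [hs]
      exact hfin.preimage (f := fun p : ℤ => p - (j + 1)) (sub_left_injective.injOn)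
    simp only [heis_eminusCoeff_comm h α (by omega : -((j : ℤ) + 1) ≤ 0), heis_neg_eplusCoeff,
      baseChange_comm hsymm (toCartan α) h, map_add, map_smul]
    rw [finsum_add_distrib (finite_support_eminusCoeff_eplusCoeff B α n _) _,
      ← smul_finsum' _ hfin']
    · simp only [hs]
      congr 2
      exact finsum_comp_equiv (Equiv.subRight ((j : ℤ) + 1))
        (f := fun p : ℤ => eminusCoeff B α (n - -(j + 1) + p) (eplusCoeff B α p v))
    · refine hfin'.subset fun p hp => ?_
      contrapose! hp
      rw [Function.notMem_support] at *
      rw [hp, smul_zero]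

/-! ### The vertex operators of the `e_α` -/

lemma heis_tmul_of_ne_zero (h : Cartan L) {m : ℤ} (hm : m ≠ 0) (u : Fock L) :
    ∃ u' : Fock L, ∀ f : L →₀ ℂ, heis B h m (u ⊗ₜ[ℂ] f) = u' ⊗ₜ[ℂ] f := by
  rcases int_cases m with ⟨j, rfl⟩ | rfl | ⟨j, rfl⟩
  · exact ⟨_, heis_pos_tmul B h j u⟩
  · exact absurd rfl hm
  · exact ⟨_, heis_neg_tmul B h j u⟩

variable (B) in
/-- The mode `(e_α)_n` on `V_L`: the coefficient of `z^{-n-1}` in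
`E⁻(-α,z)E⁺(-α,z)e_α z^α`. -/
def eMode (ε : L → L → ℂˣ) (α : L) (n : ℤ) : Module.End ℂ (VSpace L) :=
  TensorProduct.lift (LinearMap.flip (Finsupp.lsum ℂ fun β : L =>
    LinearMap.toSpanSingleton ℂ (Fock L →ₗ[ℂ] VSpace L)
      (expCoeff B α (-n - 1 - B α β) ∘ₗ
        (TensorProduct.mk ℂ (Fock L) (L →₀ ℂ)).flip (Finsupp.single (α + β) (ε α β : ℂ)))))

lemma eMode_tmul (ε : L → L → ℂˣ) (α β : L) (n : ℤ) (u : Fock L) :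
    eMode B ε α n (u ⊗ₜ[ℂ] Finsupp.single β 1) =
      (ε α β : ℂ) • expCoeff B α (-n - 1 - B α β) (u ⊗ₜ[ℂ] Finsupp.single (α + β) 1) := by
  rw [← map_smul, ← TensorProduct.tmul_smul, Finsupp.smul_single, smul_eq_mul, mul_one]
  simp [eMode]

lemma eMode_eV (ε : L → L → ℂˣ) (α γ : L) (n : ℤ) :
    eMode B ε α n (eV γ) = (ε α γ : ℂ) • eminusCoeff B α (-n - 1 - B α γ) (eV (α + γ)) := by
  rw [← expCoeff_eV B]
  exact eMode_tmul ε α γ n 1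

lemma exists_eMode_eq_zero (ε : L → L → ℂˣ) (α : L) (v : VSpace L) :
    ∃ N : ℤ, ∀ n, N ≤ n → eMode B ε α n v = 0 := by
  induction v using vSpace_induction_tmul with
  | zero => exact ⟨0, by simp⟩
  | add v w hv hw =>
    obtain ⟨N, hN⟩ := hv
    obtain ⟨M, hM⟩ := hw
    exact ⟨max N M, fun n hn => by rw [map_add, hN n (by omega), hM n (by omega), add_zero]⟩
  | tmul u β =>
    obtain ⟨N, hN⟩ := exists_expCoeff_eq_zero B α (u ⊗ₜ[ℂ] Finsupp.single (α + β) (1 : ℂ))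
    refine ⟨-N - 1 - B α β, fun n hn => ?_⟩
    rw [eMode_tmul, hN _ (by omega), smul_zero]

lemma toCartan_add (α β : L) : toCartan (α + β) = toCartan α + toCartan β := by
  simp [toCartan, TensorProduct.tmul_add]

lemma heis_eMode (hsymm : B.IsSymm) (ε : L → L → ℂˣ) (h : Cartan L) (α : L) (m n : ℤ)
    (v : VSpace L) :
    heis B h m (eMode B ε α n v) = eMode B ε α n (heis B h m v) +
      B.baseChange ℂ h (toCartan α) • eMode B ε α (n + m) v := by
  induction v using vSpace_induction_tmul with
  | zero => simp
  | add v w hv hw => simp only [map_add, hv, hw, smul_add]; abel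
  | tmul u β =>
    rcases eq_or_ne m 0 with rfl | hm
    · rw [heis_zero_tmul, map_smul, eMode_tmul, map_smul, heis_zero_expCoeff, heis_zero_tmul,
        add_zero, eMode_tmul, map_smul, toCartan_add, map_add]
      module
    · obtain ⟨u', hu'⟩ := heis_tmul_of_ne_zero (B := B) h hm u
      rw [hu', eMode_tmul, eMode_tmul, eMode_tmul, map_smul, heis_expCoeff hsymm h α hm, hu',
        show -(n + m) - 1 - B α β = -n - 1 - B α β - m by ring]
      module

lemma transV_eminusCoeff (α : L) (n : ℤ) (v : VSpace L) :
    transV L (eminusCoeff B α n v) = eminusCoeff B α n (transV L v) -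
      heis B (toCartan α) (-1) (eminusCoeff B α n v) + (n + 1) • eminusCoeff B α (n + 1) v := by
  have h := congr($((isExpSeq_eminusCoeff B α).derivation (T := transV L)
    (fun k => commute_heis_of_nonpos _ _ (by omega) (by omega)) (fun k => by
      refine LinearMap.ext fun v => ?_
      simp only [Module.End.mul_apply, LinearMap.add_apply, LinearMap.smul_apply]
      rw [transV_heis_neg]
      push_cast
      ring_nf) n) v)
  simpa [← Int.cast_smul_eq_zsmul ℂ] using h

lemma transV_eMode_eV (hsymm : B.IsSymm) (ε : L → L → ℂˣ) (α γ : L) (n : ℤ) :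
    transV L (eMode B ε α n (eV γ)) =
      eMode B ε α n (transV L (eV γ)) - n • eMode B ε α (n - 1) (eV γ) := by
  have h_add := heis_toCartan_add_neg (B := B) α γ 0 (eV (α + γ))
  simp only [CharP.cast_eq_zero, zero_add] at h_add
  have h_comm := heis_eMode hsymm ε (toCartan γ) α (-1) n (eV γ)
  rw [baseChange_toCartan, hsymm.eq γ α] at h_comm
  rw [transV_eV (B := B) γ, ← sub_eq_iff_eq_add.mpr h_comm, eMode_eV, map_smul,
    transV_eminusCoeff, transV_eV (B := B), h_add, map_add,
    ← heis_eminusCoeff_comm _ _ (by omega), ← heis_eminusCoeff_comm _ _ (by omega), map_smul,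
    ← sub_eq_add_neg, eMode_eV, show -(n - 1) - 1 - B α γ = -n - 1 - B α γ + 1 by ring]
  simp only [← Int.cast_smul_eq_zsmul ℂ]
  push_cast
  module

lemma transV_eMode (hsymm : B.IsSymm) (ε : L → L → ℂˣ) (α : L) (n : ℤ) (v : VSpace L) :
    transV L (eMode B ε α n v) =
      eMode B ε α n (transV L v) - n • eMode B ε α (n - 1) v := by
  induction v using vSpace_induction (B := B) generalizing n with
  | zero => simp
  | add v w hv hw => simp only [map_add, hv, hw, smul_add]; abel
  | smul c v hv => simp only [map_smul, hv, smul_sub, smul_comm n c]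
  | eV γ => exact transV_eMode_eV hsymm ε α γ n
  | heis h k v hv =>
    have h_comm (n : ℤ) (w : VSpace L) (m : ℤ) :=
      sub_eq_iff_eq_add.mpr (heis_eMode hsymm ε h α m n w)
    rw [transV_heis hsymm, ← h_comm, map_sub, map_smul, transV_heis hsymm, hv, hv, map_sub, map_sub,
      map_zsmul, map_zsmul, ← h_comm, ← h_comm, ← h_comm]
    simp only [← Int.cast_smul_eq_zsmul ℂ]
    rw [show n + -(k + 1 : ℤ) - 1 = n - 1 + -(k + 1) by ring,
      show n + (-(k + 1 : ℤ) - 1) = n - 1 + -(k + 1) by ring]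
    push_cast
    module

/-! ### Locality of the lattice fields -/

variable (B) in
lemma exists_eminusCoeff_eV (α : L) (n : ℤ) :
    ∃ u : Fock L, ∀ γ, eminusCoeff B α n (eV γ) = u ⊗ₜ[ℂ] Finsupp.single γ 1 := by
  have hE := isExpSeq_eminusCoeff B α
  have of_neg {n : ℤ} (hn : n < 0) :
      ∃ u : Fock L, ∀ γ, eminusCoeff B α n (eV γ) = u ⊗ₜ[ℂ] Finsupp.single γ 1 :=
    ⟨0, fun γ => by rw [hE.of_neg n hn, TensorProduct.zero_tmul, LinearMap.zero_apply]⟩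
  rcases lt_or_ge n 0 with hn | hn
  · exact of_neg hn
  lift n to ℕ using hn
  induction n using Nat.strong_induction_on with
  | _ n ih =>
    rcases Nat.eq_zero_or_pos n with rfl | hpos
    · exact ⟨1, fun γ => by rw [Nat.cast_zero, hE.zero]; rfl⟩
    have ih' (k : ℕ) : ∃ u : Fock L, ∀ γ,
        eminusCoeff B α (n - 1 - k) (eV γ) = u ⊗ₜ[ℂ] Finsupp.single γ 1 := by
      rcases lt_or_ge k n with hk | hk
      · simpa [Nat.cast_sub hk.le, show n - 1 - k = (n - (k + 1)) by omega, Nat.cast_sub hk,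
          sub_add_eq_sub_sub_swap] using ih (n - 1 - k) (by omega)
      · exact of_neg (by omega)
    choose u hu using ih'
    refine ⟨(n : ℂ)⁻¹ • ∑ k ∈ Finset.range n, neg (toCartan α) k * u k, fun γ => ?_⟩
    have h := congr($(hE.recurrence n) (eV γ))
    simp only [LinearMap.smul_apply, LinearMap.sum_apply, Module.End.mul_apply, hu,
      heis_neg_tmul, ← TensorProduct.sum_tmul] at h
    rw [← TensorProduct.smul_tmul', ← h, smul_smul, inv_mul_cancel₀ (by exact_mod_cast hpos.ne'),
      one_smul]

lemma eplusCoeff_eminusCoeff_eV (α β γ : L) (p : ℕ) (n : ℤ) :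
    eplusCoeff B α p (eminusCoeff B β n (eV γ)) =
      signedChoose (B α β) p • eminusCoeff B β (n - p) (eV γ) := by
  have hE := isExpSeq_eplusCoeff B α
  induction p using Nat.strong_induction_on generalizing n with
  | _ p ih =>
    rcases Nat.eq_zero_or_pos p with rfl | hpos
    · rw [Nat.cast_zero, hE.zero]
      simp
    have hp : (p : ℂ) ≠ 0 := by exact_mod_cast hpos.ne'
    have h := congr($(hE.recurrence p) (eminusCoeff B β n (eV γ)))
    rw [LinearMap.smul_apply, LinearMap.sum_apply] at h
    have hterm (k : ℕ) (hk : k ∈ Finset.range p) :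
        ((-heis B (toCartan α) (k + 1)) * eplusCoeff B α (p - 1 - k))
            (eminusCoeff B β n (eV γ)) =
          (-B α β * signedChoose (B α β) (p - 1 - k)) • eminusCoeff B β (n - p) (eV γ) := by
      rw [Finset.mem_range] at hk
      rw [show (p : ℤ) - 1 - k = (p - 1 - k : ℕ) by omega, Module.End.mul_apply,
        ih (p - 1 - k) (by omega), LinearMap.neg_apply, map_zsmul, heis_pos_eminusCoeff,
        heis_eV_pos _ (by omega), map_zero, zero_add, baseChange_toCartan,
        show n - (p - 1 - k : ℕ) - (k + 1) = n - p by omega, ← Int.cast_smul_eq_zsmul ℂ,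
        ← Int.cast_smul_eq_zsmul ℂ]
      push_cast
      module
    rw [Finset.sum_congr rfl hterm, ← Finset.sum_smul, ← Finset.mul_sum,
      Finset.sum_range_reflect (fun j => signedChoose (B α β) j), neg_mul_sum_signedChoose,
      mul_smul, ← Int.cast_smul_eq_zsmul ℂ] at h
    exact smul_right_injective _ hp (by simpa using h)

variable (B) in
/-- The coefficient of `x^{-m-1} y^{-n-1}` in
`x^{⟨α,γ⟩} y^{⟨β,γ⟩} E⁻(-α,x) E⁻(-β,y) e_{α+β+γ}`. -/
def eminusPair (α β γ : L) (m n : ℤ) : VSpace L :=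
  eminusCoeff B α (-m - 1 - B α γ) (eminusCoeff B β (-n - 1 - B β γ) (eV (α + β + γ)))

variable (B) in
lemma isTruncated_eminusPair (α β γ : L) : IsTruncated (eminusPair B α β γ) :=
  ⟨-B β γ, fun m n hn => by
    rw [eminusPair, (isExpSeq_eminusCoeff B β).of_neg _ (by omega), LinearMap.zero_apply,
      map_zero]⟩

variable (B) in
lemma eminusPair_swap (α β γ : L) :
    eminusPair B β α γ = fun n m => eminusPair B α β γ m n := by
  funext n m
  rw [eminusPair, eminusPair, eminusCoeff_comm, add_comm β α]

/-- The vertex operators `Y(e_α,x)Y(e_β,y)` differ from their normally ordered product by the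
factor `(x - y)^{⟨α,β⟩}`, up to the cocycle. -/
lemma eMode_eMode_eV (ε : L → L → ℂˣ) (α β γ : L) (m n : ℤ) :
    eMode B ε α m (eMode B ε β n (eV γ)) =
      ((ε β γ : ℂ) * ε α (β + γ)) • expand (B α β) (eminusPair B α β γ) m n := by
  rw [eMode_eV, map_smul]
  obtain ⟨u, hu⟩ := exists_eminusCoeff_eV B β (-n - 1 - B β γ)
  rw [hu, eMode_tmul, ← hu, smul_smul, expCoeff_apply, finsum_int_eq_finsum_nat, expand]
  · congr 1
    refine finsum_congr fun p => ?_
    rw [eplusCoeff_eminusCoeff_eV, map_zsmul, map_add, eminusPair, add_assoc α,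
      show -m - 1 - (B α β + B α γ) + p = -(m + B α β - p) - 1 - B α γ by ring,
      show -n - 1 - B β γ - p = -(n + p) - 1 - B β γ by ring]
  · intro p hp
    rw [(isExpSeq_eplusCoeff B α).of_neg p hp, LinearMap.zero_apply, map_zero]

variable (B) in
/-- The vertex operator `Y(e_α,z)`. -/
def eField (ε : L → L → ℂˣ) (α : L) : VertexOperator ℂ (VSpace L) :=
  ofModes (eMode B ε α) (exists_eMode_eq_zero ε α)

variable (B) in
lemma exists_heis_eq_zero (h : Cartan L) (v : VSpace L) :
    ∃ N : ℤ, ∀ n, N ≤ n → heis B h n v = 0 := by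
  induction v using vSpace_induction (B := B) with
  | zero => exact ⟨0, by simp⟩
  | eV γ => exact ⟨1, fun n hn => heis_eV_pos h (by omega) γ⟩
  | add v w hv hw =>
    obtain ⟨N, hN⟩ := hv
    obtain ⟨M, hM⟩ := hw
    exact ⟨max N M, fun n hn => by rw [map_add, hN n (by omega), hM n (by omega), add_zero]⟩
  | smul c v hv =>
    obtain ⟨N, hN⟩ := hv
    exact ⟨N, fun n hn => by rw [map_smul, hN n hn, smul_zero]⟩
  | heis h' k v hv =>
    obtain ⟨N, hN⟩ := hv
    refine ⟨max N (k + 2), fun n hn => ?_⟩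
    obtain ⟨j, rfl⟩ : ∃ j : ℕ, n = j + 1 := ⟨(n - 1).toNat, by omega⟩
    rw [heis_commutator_of_pos, hN _ (by omega), if_neg (by omega), map_zero, zero_smul, add_zero]

variable (B) in
/-- The vertex operator `Y(h,z)`. -/
def hField (h : Cartan L) : VertexOperator ℂ (VSpace L) :=
  ofModes (heis B h) (exists_heis_eq_zero B h)

@[simp] lemma ncoeff_eField (ε : L → L → ℂˣ) (α : L) (n : ℤ) :
    ncoeff (eField B ε α) n = eMode B ε α n := ncoeff_ofModes _ _ n

@[simp] lemma ncoeff_hField (h : Cartan L) (n : ℤ) :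
    ncoeff (hField B h) n = heis B h n := ncoeff_ofModes _ _ n

lemma isLocal_hField_hField (hsymm : B.IsSymm) (h h' : Cartan L) :
    IsLocal (hField B h) (hField B h') := by
  have h_comm (m n : ℤ) : borcherdsProd 0 m n (hField B h) (hField B h') =
      (if m + n = 0 then (m : ℂ) * B.baseChange ℂ h h' else 0) • 1 := by
    refine LinearMap.ext fun w => ?_
    simp only [borcherdsProd_zero, ncoeff_hField, LinearMap.sub_apply, Module.End.mul_apply,
      heis_commutator hsymm h h' m n w, add_sub_cancel_left, LinearMap.smul_apply,
      Module.End.one_apply]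
  refine ⟨2, fun m n => ?_⟩
  rw [show ((2 : ℕ) : ℤ) = 0 + 1 + 1 by norm_num]
  simp only [borcherdsProd_succ, h_comm]
  by_cases hmn : m + n = -2
  · rw [if_pos (by omega), if_pos (by omega), if_pos (by omega)]
    push_cast
    module
  · rw [if_neg (by omega), if_neg (by omega), if_neg (by omega)]
    module

lemma isLocal_hField_eField (hsymm : B.IsSymm) (ε : L → L → ℂˣ) (h : Cartan L) (α : L) :
    IsLocal (hField B h) (eField B ε α) := by
  have h_comm (m n : ℤ) : borcherdsProd 0 m n (hField B h) (eField B ε α) =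
      B.baseChange ℂ h (toCartan α) • eMode B ε α (n + m) := by
    refine LinearMap.ext fun w => ?_
    simp [borcherdsProd_zero, heis_eMode hsymm ε h α m n w]
  refine ⟨1, fun m n => ?_⟩
  rw [show ((1 : ℕ) : ℤ) = 0 + 1 by norm_num, borcherdsProd_succ, h_comm, h_comm,
    show n + (m + 1) = n + 1 + m by ring]
  exact sub_self (G := Module.End ℂ (VSpace L)) _

lemma orderedProd_eField_eField_eV (ε : L → L → ℂˣ) {α β : L} {N M : ℕ} (hNM : B α β + N = M)
    (γ : L) (m n : ℤ) :
    orderedProd N m n (eField B ε α) (eField B ε β) (eV γ) =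
      ((ε β γ : ℂ) * ε α (β + γ)) • expand M (eminusPair B α β γ) m n := by
  have h := isTruncated_eminusPair B α β γ
  simp only [orderedProd_apply, ncoeff_eField, eMode_eMode_eV]
  rw [← hNM, ← expand_expand h, ← LinearMap.lsmul_apply, map_expand (h.expand _)]
  rfl

lemma borcherdsProd_eField_eField_eV (hsymm : B.IsSymm) {ε : L → L → ℂˣ}
    (hcocycle : ∀ α β γ : L, ε α β * ε (α + β) γ = ε β γ * ε α (β + γ))
    (hcomm : ∀ α β : L, ε α β * (ε β α)⁻¹ = (-1) ^ (B α β))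
    {α β : L} {N M : ℕ} (hNM : B α β + N = M) (γ : L) (m n : ℤ) :
    borcherdsProd N m n (eField B ε α) (eField B ε β) (eV γ) = 0 := by
  have h_swap : expand M (eminusPair B β α γ) n m =
      Int.negOnePow M • expand M (eminusPair B α β γ) m n := by
    have h := isTruncated_eminusPair B β α γ
    rw [eminusPair_swap] at h ⊢
    exact expand_swap (isTruncated_eminusPair B α β γ) h M m n
  have hsign : (-1 : ℂ) ^ (N : ℤ) * (-1) ^ (M : ℤ) = (-1) ^ (B α β) := by
    rw [← hNM, ← zpow_add₀ (by norm_num), show (N : ℤ) + (B α β + N) = B α β + 2 * N by ring,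
      zpow_add₀ (by norm_num), zpow_mul]
    norm_num
  have hε : ε β γ * ε α (β + γ) = (-1) ^ (B α β) * (ε α γ * ε β (α + γ)) := by
    rw [← hcocycle, ← hcocycle, ← hcomm α β, add_comm β α, mul_assoc, inv_mul_cancel_left]
  have hε' := congrArg (Units.val : ℂˣ → ℂ) hε
  push_cast at hε'
  rw [borcherdsProd_apply, LinearMap.sub_apply, LinearMap.smul_apply,
    orderedProd_eField_eField_eV ε hNM, orderedProd_eField_eField_eV ε (hsymm.eq α β ▸ hNM),
    h_swap]
  simp only [Units.smul_def, ← Int.cast_smul_eq_zsmul ℂ, Int.cast_negOnePow, smul_smul]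
  rw [hε', ← hsign]
  module

lemma isLocal_eField_eField (hsymm : B.IsSymm) {ε : L → L → ℂˣ}
    (hcocycle : ∀ α β γ : L, ε α β * ε (α + β) γ = ε β γ * ε α (β + γ))
    (hcomm : ∀ α β : L, ε α β * (ε β α)⁻¹ = (-1) ^ (B α β)) (α β : L) :
    IsLocal (eField B ε α) (eField B ε β) := by
  obtain ⟨N, M, hNM⟩ : ∃ N M : ℕ, B α β + N = M :=
    ⟨(-B α β).toNat, (B α β).toNat, by omega⟩
  refine ⟨N, fun m n => LinearMap.ext fun w => ?_⟩
  rw [LinearMap.zero_apply]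
  induction w using vSpace_induction (B := B) generalizing m n with
  | zero => rw [map_zero]
  | eV γ => exact borcherdsProd_eField_eField_eV hsymm hcocycle hcomm hNM γ m n
  | add v w hv hw => rw [map_add, hv, hw, add_zero]
  | smul c v hv => rw [map_smul, hv, smul_zero]
  | heis h k v hv =>
    have h_eMode (α : L) (n : ℤ) : heis B h (-(k + 1)) * ncoeff (eField B ε α) n =
        ncoeff (eField B ε α) n * heis B h (-(k + 1)) +
          B.baseChange ℂ h (toCartan α) • ncoeff (eField B ε α) (n + -(k + 1)) := by
      simpa only [ncoeff_eField] using LinearMap.ext (heis_eMode hsymm ε h α (-(k + 1)) n)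
    have h_comm := congr($(borcherdsProd_commutator (h_eMode α) (h_eMode β) N m n) v)
    simp only [LinearMap.add_apply, Module.End.mul_apply, LinearMap.smul_apply, hv, map_zero,
      smul_zero, add_zero] at h_comm
    exact h_comm.symm

/-! ### The lattice vertex algebra -/

lemma heis_neg_one_eV_zero (h : Cartan L) : heis B h (-1) (eV 0) = hV h := by
  simpa [eV, hV] using heis_neg_tmul B h 0 1 (Finsupp.single (0 : L) (1 : ℂ))

lemma eMode_neg_one_eV_zero {ε : L → L → ℂˣ} (hright : ∀ α : L, ε α 0 = 1) (α : L) :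
    eMode B ε α (-1) (eV 0) = eV α := by
  rw [eMode_eV, hright, map_zero, show -(-1 : ℤ) - 1 - 0 = 0 by norm_num,
    (isExpSeq_eminusCoeff B α).zero, add_zero, Units.val_one, one_smul, Module.End.one_apply]

lemma transV_eV_zero : transV L (eV 0) = 0 := by
  rw [← bEquivV_eB, transV_bEquivV, bDeriv_eB]
  simp [toCartan, neg]

lemma finsum_coeff_eq_expCoeff (α : L) (c m : ℤ) (v : VSpace L) :
    (∑ᶠ p : ℕ × ℕ, if c + (p.1 : ℤ) - (p.2 : ℤ) = m then
      PowerSeries.coeff p.1 (Eminus B α) (PowerSeries.coeff p.2 (Eplus B α) v) else 0) =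
        expCoeff B α (m - c) v := by
  have h_eminus (n : ℕ) : PowerSeries.coeff n (Eminus B α) = eminusCoeff B α n := by
    simp [eminusCoeff]
  have h_eplus (n : ℕ) : PowerSeries.coeff n (Eplus B α) = eplusCoeff B α n := by
    simp [eplusCoeff]
  simp only [h_eminus, h_eplus]
  let g (q : ℕ) : ℕ × ℕ := ((m - c + q).toNat, q)
  have hg : Function.Injective g := fun q q' h => congrArg Prod.snd h
  rw [expCoeff_apply, finsum_int_eq_finsum_nat, ← finsum_mem_univ,
    finsum_mem_inter_support_eq' _ _ (Set.range g), finsum_mem_range hg]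
  · refine finsum_congr fun q => ?_
    dsimp only [g]
    rcases lt_or_ge (m - c + q) 0 with h | h
    · rw [(isExpSeq_eminusCoeff B α).of_neg _ h, LinearMap.zero_apply]
      rw [if_neg (by omega)]
    · rw [if_pos (by omega), Int.toNat_of_nonneg h]
  · intro p hp
    refine iff_of_true (Set.mem_univ p) ⟨p.2, Prod.ext ?_ rfl⟩
    have hm : c + (p.1 : ℤ) - p.2 = m := of_not_not fun h => hp (if_neg h)
    simp only [g]
    omega
  · intro p hp
    rw [(isExpSeq_eplusCoeff B α).of_neg p hp, LinearMap.zero_apply, map_zero]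

lemma mode_eV_eq_eMode_iff {ε : L → L → ℂˣ} {𝒱 : VertexData (VSpace L)} {α : L} :
    (∀ n, 𝒱.mode (eV α) n = eMode B ε α n) ↔ ∀ (β : L) (u : Fock L) (m : ℤ),
      HVertexOperator.coeff (𝒱.Y (eV α)) m (u ⊗ₜ[ℂ] Finsupp.single β 1) =
        ∑ᶠ p : ℕ × ℕ, if B α β + (p.1 : ℤ) - (p.2 : ℤ) = m then
          PowerSeries.coeff p.1 (Eminus B α) (PowerSeries.coeff p.2 (Eplus B α)
            ((ε α β : ℂ) • (u ⊗ₜ[ℂ] Finsupp.single (α + β) (1 : ℂ)))) else 0 := by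
  have h_coeff (m : ℤ) : HVertexOperator.coeff (𝒱.Y (eV α)) m = 𝒱.mode (eV α) (-m - 1) := by
    rw [mode, VertexOperator.coeff_eq_ncoeff]
  simp only [finsum_coeff_eq_expCoeff, h_coeff]
  simp only [map_smul]
  constructor
  · intro h β u m
    rw [h, eMode_tmul]
    congr 3
    ring
  · intro h n
    refine LinearMap.ext fun v => ?_
    induction v using vSpace_induction_tmul with
    | zero => simp only [map_zero]
    | add v w hv hw => rw [map_add, map_add, hv, hw]
    | tmul u β =>
      have h' := h β u (-n - 1)
      rwa [show -(-n - 1) - 1 = n by ring, ← eMode_tmul] at h'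

lemma isLatticeVertexAlgebra_iff {ε : L → L → ℂˣ} {𝒱 : VertexData (VSpace L)} :
    IsLatticeVertexAlgebra B ε 𝒱 ↔ 𝒱.IsVertexAlgebra ∧ 𝒱.vac = eV 0 ∧
      (∀ h n, 𝒱.mode (hV h) n = heis B h n) ∧ ∀ α n, 𝒱.mode (eV α) n = eMode B ε α n :=
  ⟨fun ⟨hva, hvac, hh, he⟩ => ⟨hva, hvac, hh, fun α => mode_eV_eq_eMode_iff.mpr (he α)⟩,
    fun ⟨hva, hvac, hh, he⟩ => ⟨hva, hvac, hh, fun α => mode_eV_eq_eMode_iff.mp (he α)⟩⟩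

variable (B) in
/-- The fields `Y(h,z)` and `Y(e_α,z)`, which generate `V_L` from the vacuum. -/
def generators (ε : L → L → ℂˣ) : Set (VertexOperator ℂ (VSpace L)) :=
  Set.range (hField B) ∪ Set.range (eField B ε)

lemma isLocal_of_mem_generators (hsymm : B.IsSymm) {ε : L → L → ℂˣ}
    (hcocycle : ∀ α β γ : L, ε α β * ε (α + β) γ = ε β γ * ε α (β + γ))
    (hcomm : ∀ α β : L, ε α β * (ε β α)⁻¹ = (-1) ^ (B α β)) :
    ∀ A ∈ generators B ε, ∀ C ∈ generators B ε, IsLocal A C := by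
  rintro _ (⟨h, rfl⟩ | ⟨α, rfl⟩) _ (⟨h', rfl⟩ | ⟨β, rfl⟩)
  · exact isLocal_hField_hField hsymm h h'
  · exact isLocal_hField_eField hsymm ε h β
  · exact (isLocal_hField_eField hsymm ε h' α).symm
  · exact isLocal_eField_eField hsymm hcocycle hcomm α β

lemma isCovariant_of_mem_generators (hsymm : B.IsSymm) (ε : L → L → ℂˣ) :
    ∀ A ∈ generators B ε, IsCovariant (transV L) A := by
  rintro _ (⟨h, rfl⟩ | ⟨α, rfl⟩) n
  · simpa only [ncoeff_hField] using LinearMap.ext (transV_heis hsymm h n)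
  · simpa only [ncoeff_eField] using LinearMap.ext (transV_eMode hsymm ε α n)

lemma isCreative_of_mem_generators (ε : L → L → ℂˣ) :
    ∀ A ∈ generators B ε, IsCreative (eV 0) A := by
  rintro _ (⟨h, rfl⟩ | ⟨α, rfl⟩) n hn
  · rw [ncoeff_hField]
    rcases hn.eq_or_lt with rfl | hn
    · simp [heis_zero_eV, toCartan]
    · exact heis_eV_pos h hn 0
  · rw [ncoeff_eField, eMode_eV, (isExpSeq_eminusCoeff B α).of_neg _ (by rw [map_zero]; omega),
      LinearMap.zero_apply, smul_zero]

lemma eq_top_of_generators {ε : L → L → ℂˣ} (hright : ∀ α : L, ε α 0 = 1)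
    (p : Submodule ℂ (VSpace L)) (hvac : eV 0 ∈ p)
    (hp : ∀ A ∈ generators B ε, ∀ n : ℤ, ∀ v ∈ p, ncoeff A n v ∈ p) : p = ⊤ := by
  refine (Submodule.eq_top_iff').mpr fun v => ?_
  induction v using vSpace_induction (B := B) with
  | zero => exact p.zero_mem
  | eV α =>
    have h := hp _ (Or.inr ⟨α, rfl⟩) (-1) _ hvac
    rwa [ncoeff_eField, eMode_neg_one_eV_zero hright] at h
  | add v w hv hw => exact p.add_mem hv hw
  | smul c v hv => exact p.smul_mem c hv
  | heis h k v hv =>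
    have h := hp _ (Or.inl ⟨h, rfl⟩) (-(k + 1)) _ hv
    rwa [ncoeff_hField] at h

theorem exists_isLatticeVertexAlgebra (hsymm : B.IsSymm) {ε : L → L → ℂˣ}
    (hcocycle : ∀ α β γ : L, ε α β * ε (α + β) γ = ε β γ * ε α (β + γ))
    (hcomm : ∀ α β : L, ε α β * (ε β α)⁻¹ = (-1) ^ (B α β)) (hright : ∀ α : L, ε α 0 = 1) :
    ∃ 𝒱 : VertexData (VSpace L), IsLatticeVertexAlgebra B ε 𝒱 := by
  obtain ⟨𝒱, h𝒱, hvac, hY⟩ := exists_isVertexAlgebra transV_eV_zero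
    (isLocal_of_mem_generators hsymm hcocycle hcomm) (isCovariant_of_mem_generators hsymm ε)
    (isCreative_of_mem_generators ε) (eq_top_of_generators hright)
  refine ⟨𝒱, isLatticeVertexAlgebra_iff.mpr ⟨h𝒱, hvac, fun h n => ?_, fun α n => ?_⟩⟩
  · have hYh := hY _ (Or.inl ⟨h, rfl⟩)
    rw [ncoeff_hField, heis_neg_one_eV_zero] at hYh
    rw [mode, hYh, ncoeff_hField]
  · have hYe := hY _ (Or.inr ⟨α, rfl⟩)
    rw [ncoeff_eField, eMode_neg_one_eV_zero hright] at hYe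
    rw [mode, hYe, ncoeff_eField]

theorem IsLatticeVertexAlgebra.unique {ε : L → L → ℂˣ} {𝒱 𝒲 : VertexData (VSpace L)}
    (h𝒱 : IsLatticeVertexAlgebra B ε 𝒱) (h𝒲 : IsLatticeVertexAlgebra B ε 𝒲) : 𝒱 = 𝒲 := by
  obtain ⟨h𝒱va, h𝒱vac, h𝒱h, h𝒱e⟩ := isLatticeVertexAlgebra_iff.mp h𝒱
  obtain ⟨h𝒲va, h𝒲vac, h𝒲h, h𝒲e⟩ := isLatticeVertexAlgebra_iff.mp h𝒲
  refine ext_mode (fun v => ?_) (h𝒱vac.trans h𝒲vac.symm)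
  induction v using vSpace_induction (B := B) with
  | zero => simp only [mode_zero_left, implies_true]
  | eV α => simp only [h𝒱e, h𝒲e, implies_true]
  | add v w hv hw => intro n; rw [mode_add_left, mode_add_left, hv, hw]
  | smul c v hv => intro n; rw [mode_smul_left, mode_smul_left, hv]
  | heis h k v hv =>
    intro n
    refine LinearMap.ext fun w => ?_
    have h_eq := h𝒱va.map_mode_mode h𝒲va LinearMap.id (u := hV h) (v := v)
      (fun n w => by simp only [h𝒱h, h𝒲h, LinearMap.id_apply])
      (fun n w => by simp only [hv, LinearMap.id_apply]) (-(k + 1)) n w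
    simpa only [h𝒱h, LinearMap.id_apply] using h_eq

/-! ### The coaction -/

lemma eB_zero : (eB 0 : BSpace L) = 1 := rfl

lemma iterate_bDeriv_hB (h : Cartan L) (k : ℕ) :
    (bDeriv : Derivation ℂ (BSpace L) (BSpace L)).toLinearMap^[k] (hB h) =
      (k.factorial : ℂ) • (neg h k ⊗ₜ[ℂ] (1 : AddMonoidAlgebra ℂ L)) := by
  induction k with
  | zero => rw [Nat.factorial_zero, Nat.cast_one, one_smul]; rfl
  | succ k ih =>
    rw [Function.iterate_succ_apply', ih, map_smul, Derivation.coeFn_coe, bDeriv_neg, smul_smul,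
      Nat.factorial_succ]
    push_cast
    rw [mul_comm]

lemma vertexB_mode_hB_neg (h : Cartan L) (k : ℕ) (y : BSpace L) :
    (vertexB L).mode (hB h) (-(k + 1)) y = (neg h k ⊗ₜ[ℂ] 1) * y := by
  rw [show -((k : ℤ) + 1) = -1 - k by ring, vertexB,
    borcherds_mode_neg_one_sub (A := BSpace L) bDeriv, iterate_bDeriv_hB, smul_smul,
    inv_mul_cancel₀ (by exact_mod_cast k.factorial_ne_zero), one_smul, LinearMap.mulLeft_apply]

lemma vertexB_mode_of_nonneg (x y : BSpace L) {n : ℤ} (hn : 0 ≤ n) :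
    (vertexB L).mode x n y = 0 :=
  LinearMap.congr_fun (borcherds_mode_of_nonneg (A := BSpace L) bDeriv x hn) y

lemma vertexB_mode_neg_one (x y : BSpace L) : (vertexB L).mode x (-1) y = x * y := by
  simpa [vertexB] using
    LinearMap.congr_fun (borcherds_mode_neg_one_sub (A := BSpace L) bDeriv x 0) y

lemma vertexB_isVertexAlgebra : (vertexB L).IsVertexAlgebra :=
  vertexB_isVertexBialgebra.isVertexAlgebra

lemma vertexB_translation :
    (vertexB L).translation = (bDeriv : Derivation ℂ (BSpace L) (BSpace L)).toLinearMap :=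
  (borcherds_isLocalFieldAlgebra (A := BSpace L) bDeriv).translation_eq

variable (L) in
/-- The coaction of `B_L` on `V_L`: the comultiplication of `B_L`, with `B_L` identified with `V_L`
as the source and as the left tensor factor of the target. -/
def coaction : VSpace L →ₗ[ℂ] VSpace L ⊗[ℂ] BSpace L := coactionOfEquiv (bEquivV L)

lemma coaction_eV (α : L) : coaction L (eV α) = eV α ⊗ₜ[ℂ] eB α := by
  rw [coaction, ← bEquivV_eB, coactionOfEquiv_apply, comul_eB]
  rfl

variable (B) in
/-- The operator `h(n) ⊗ 1 + 1 ⊗ h(n)` on `V_L ⊗ B_L`, where `h(n)` acts on `B_L` as a mode of the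
vector `h(-1)`. -/
def heisTensor (h : Cartan L) (n : ℤ) : Module.End ℂ (VSpace L ⊗[ℂ] BSpace L) :=
  (heis B h n).rTensor (BSpace L) + ((vertexB L).mode (hB h) n).lTensor (VSpace L)

lemma heisTensor_tmul (h : Cartan L) (n : ℤ) (x : VSpace L) (y : BSpace L) :
    heisTensor B h n (x ⊗ₜ y) = heis B h n x ⊗ₜ y + x ⊗ₜ (vertexB L).mode (hB h) n y := rfl

lemma heisTensor_of_nonneg (h : Cartan L) {n : ℤ} (hn : 0 ≤ n) :
    heisTensor B h n = (heis B h n).rTensor (BSpace L) := by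
  refine TensorProduct.ext' fun x y => ?_
  rw [heisTensor_tmul, vertexB_mode_of_nonneg _ _ hn, TensorProduct.tmul_zero, add_zero,
    LinearMap.rTensor_tmul]

lemma coaction_heis_neg (h : Cartan L) (k : ℕ) (v : VSpace L) :
    coaction L (heis B h (-(k + 1)) v) = heisTensor B h (-(k + 1)) (coaction L v) := by
  obtain ⟨c, rfl⟩ := (bEquivV L).surjective v
  rw [← bEquivV_neg_mul, coaction, coactionOfEquiv_apply, coactionOfEquiv_apply,
    Bialgebra.comul_mul, comul_neg]
  generalize Coalgebra.comul (R := ℂ) c = z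
  induction z using TensorProduct.induction_on with
  | zero => simp only [mul_zero, map_zero]
  | add x y hx hy => rw [mul_add, map_add, hx, hy, map_add, map_add]
  | tmul x y =>
    rw [add_mul, Algebra.TensorProduct.tmul_mul_tmul, Algebra.TensorProduct.tmul_mul_tmul, one_mul,
      one_mul, map_add, LinearMap.rTensor_tmul, LinearMap.rTensor_tmul, LinearMap.rTensor_tmul,
      heisTensor_tmul, vertexB_mode_hB_neg]
    congr 2
    exact bEquivV_neg_mul h k x

lemma coaction_heis_of_nonneg (hsymm : B.IsSymm) (h : Cartan L) {n : ℤ} (hn : 0 ≤ n)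
    (v : VSpace L) :
    coaction L (heis B h n v) = (heis B h n).rTensor (BSpace L) (coaction L v) := by
  induction v using vSpace_induction (B := B) with
  | zero => simp only [map_zero]
  | add v w hv hw => simp only [map_add, hv, hw]
  | smul c v hv => simp only [map_smul, hv]
  | eV γ =>
    rw [coaction_eV, LinearMap.rTensor_tmul]
    rcases hn.eq_or_lt with rfl | hn
    · rw [heis_zero_eV, map_smul, coaction_eV, TensorProduct.smul_tmul']
    · rw [heis_eV_pos h hn, map_zero, TensorProduct.zero_tmul]
  | heis h' k v hv =>
    rw [heis_commutator hsymm, map_add, map_smul, coaction_heis_neg, coaction_heis_neg, hv]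
    generalize coaction L v = z
    induction z using TensorProduct.induction_on with
    | zero => simp only [map_zero, smul_zero, add_zero]
    | add x y hx hy => simp only [map_add, smul_add, ← hx, ← hy]; abel
    | tmul x y =>
      simp only [LinearMap.rTensor_tmul, heisTensor_tmul, map_add, heis_commutator hsymm h h' n,
        TensorProduct.add_tmul, TensorProduct.smul_tmul']
      abel

lemma coaction_heis (hsymm : B.IsSymm) (h : Cartan L) (n : ℤ) (v : VSpace L) :
    coaction L (heis B h n v) = heisTensor B h n (coaction L v) := by
  rcases le_or_gt 0 n with hn | hn
  · rw [coaction_heis_of_nonneg hsymm h hn, heisTensor_of_nonneg h hn]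
  · obtain ⟨k, rfl⟩ : ∃ k : ℕ, n = -(k + 1) := ⟨(-n - 1).toNat, by omega⟩
    exact coaction_heis_neg h k v

lemma coaction_hV (h : Cartan L) :
    coaction L (hV h) = hV h ⊗ₜ[ℂ] 1 + eV 0 ⊗ₜ[ℂ] hB h := by
  have h_coaction := coaction_heis_neg (B := 0) h 0 (eV 0)
  rw [coaction_eV, heisTensor_tmul, vertexB_mode_hB_neg, eB_zero, mul_one] at h_coaction
  simp only [CharP.cast_eq_zero, zero_add, heis_neg_one_eV_zero] at h_coaction
  exact h_coaction

lemma coaction_transV (v : VSpace L) :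
    coaction L (transV L v) =
      ((transV L).rTensor (BSpace L) +
        (bDeriv : Derivation ℂ (BSpace L) (BSpace L)).toLinearMap.lTensor (VSpace L))
        (coaction L v) := by
  obtain ⟨c, rfl⟩ := (bEquivV L).surjective v
  rw [transV_bEquivV, coaction, coactionOfEquiv_apply, coactionOfEquiv_apply, comul_bDeriv]
  generalize Coalgebra.comul (R := ℂ) c = z
  induction z using TensorProduct.induction_on with
  | zero => simp only [map_zero]
  | add x y hx hy => simp only [map_add, hx, hy]
  | tmul x y =>
    simp only [tensorDeriv_tmul, map_add, LinearMap.add_apply, LinearMap.rTensor_tmul,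
      LinearMap.lTensor_tmul, LinearEquiv.coe_coe, transV_bEquivV, Derivation.coeFn_coe]

variable {ε : L → L → ℂˣ} {𝒱 : VertexData (VSpace L)}

lemma IsLatticeVertexAlgebra.mode_eV (h𝒱 : IsLatticeVertexAlgebra B ε 𝒱) (α : L) (n : ℤ) :
    𝒱.mode (eV α) n = eMode B ε α n :=
  mode_eV_eq_eMode_iff.mpr (h𝒱.Y_e α) n

lemma IsLatticeVertexAlgebra.isHighestWeight (h𝒱 : IsLatticeVertexAlgebra B ε 𝒱) (h : Cartan L)
    (α : L) : 𝒱.IsHighestWeight (hV h) (eV α) (B.baseChange ℂ h (toCartan α)) where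
  mode_zero := by rw [h𝒱.Y_h, heis_zero_eV]
  mode_pos n hn := by rw [h𝒱.Y_h, heis_eV_pos h hn]

lemma eminusCoeff_one (α : L) : eminusCoeff B α 1 = heis B (toCartan α) (-1) := by
  simpa [(isExpSeq_eminusCoeff B α).zero] using (isExpSeq_eminusCoeff B α).recurrence 1

lemma IsLatticeVertexAlgebra.translation_eq (hsymm : B.IsSymm) (hright : ∀ α : L, ε α 0 = 1)
    (h𝒱 : IsLatticeVertexAlgebra B ε 𝒱) : 𝒱.translation = transV L := by
  refine LinearMap.ext fun v => ?_
  induction v using vSpace_induction (B := B) with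
  | zero => simp only [map_zero]
  | add v w hv hw => rw [map_add, map_add, hv, hw]
  | smul c v hv => rw [map_smul, map_smul, hv]
  | eV γ =>
    change 𝒱.mode (eV γ) (-2) 𝒱.vac = _
    rw [h𝒱.mode_eV, h𝒱.vac_eq, eMode_eV, hright, map_zero, show -(-2 : ℤ) - 1 - 0 = 1 by norm_num,
      eminusCoeff_one, add_zero, Units.val_one, one_smul, transV_eV (B := B)]
  | heis h k v hv =>
    have h_cov := (h𝒱.isVertexAlgebra.isCovariant (hV h)).apply (-(k + 1)) v
    rw [← mode, ← mode, h𝒱.Y_h, h𝒱.Y_h] at h_cov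
    rw [h_cov, hv, transV_heis hsymm]

lemma IsLatticeVertexAlgebra.tensor_isVertexAlgebra (h𝒱 : IsLatticeVertexAlgebra B ε 𝒱) :
    (𝒱.tensor (vertexB L)).IsVertexAlgebra :=
  h𝒱.isVertexAlgebra.tensor vertexB_isVertexAlgebra

lemma coaction_translation (hsymm : B.IsSymm) (hright : ∀ α : L, ε α 0 = 1)
    (h𝒱 : IsLatticeVertexAlgebra B ε 𝒱) (v : VSpace L) :
    coaction L (𝒱.translation v) = (𝒱.tensor (vertexB L)).translation (coaction L v) := by
  rw [h𝒱.isVertexAlgebra.tensor_translation vertexB_isVertexAlgebra, vertexB_translation,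
    h𝒱.translation_eq hsymm hright, coaction_transV]

lemma tensor_mode_coaction_hV (h𝒱 : IsLatticeVertexAlgebra B ε 𝒱) (h : Cartan L) (n : ℤ) :
    (𝒱.tensor (vertexB L)).mode (coaction L (hV h)) n = heisTensor B h n := by
  refine TensorProduct.ext' fun x y => ?_
  have h_left := tensor_mode_tmul_vac 𝒱 (vertexB_isVertexAlgebra (L := L)) (hV h) x y n
  have h_right := tensor_mode_vac_tmul h𝒱.isVertexAlgebra (vertexB L) x (hB h) y n
  rw [h𝒱.Y_h] at h_left
  rw [h𝒱.vac_eq] at h_right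
  rw [coaction_hV, mode_add_left, LinearMap.add_apply, heisTensor_tmul, ← h_left, ← h_right]
  rfl

lemma coaction_mode_hV (hsymm : B.IsSymm) (h𝒱 : IsLatticeVertexAlgebra B ε 𝒱) (h : Cartan L)
    (n : ℤ) (v : VSpace L) :
    coaction L (𝒱.mode (hV h) n v) =
      (𝒱.tensor (vertexB L)).mode (coaction L (hV h)) n (coaction L v) := by
  rw [h𝒱.Y_h, tensor_mode_coaction_hV h𝒱, coaction_heis hsymm]

lemma coaction_mode_eV_eV_of_le (h𝒱 : IsLatticeVertexAlgebra B ε 𝒱) (α γ : L) {n : ℤ}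
    (hn : -B α γ - 1 ≤ n) :
    coaction L (𝒱.mode (eV α) n (eV γ)) =
      (𝒱.tensor (vertexB L)).mode (coaction L (eV α)) n (coaction L (eV γ)) := by
  have h_zero (j : ℤ) (hj : -B α γ ≤ j) : 𝒱.mode (eV α) j (eV γ) = 0 := by
    rw [h𝒱.mode_eV, eMode_eV, (isExpSeq_eminusCoeff B α).of_neg _ (by omega),
      LinearMap.zero_apply, smul_zero]
  rw [coaction_eV, coaction_eV, tensor_mode_tmul, finsum_eq_single _ n]
  · rw [show n - 1 - n = -1 by ring, vertexB_mode_neg_one]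
    rcases hn.eq_or_lt with rfl | hn
    · rw [h𝒱.mode_eV, eMode_eV, show -(-B α γ - 1) - 1 - B α γ = 0 by ring,
        (isExpSeq_eminusCoeff B α).zero, map_smul, Module.End.one_apply, coaction_eV,
        TensorProduct.smul_tmul']
      congr 1
      simp [eB, AddMonoidAlgebra.single_mul_single]
    · rw [h_zero n (by omega), map_zero, TensorProduct.zero_tmul]
  · intro j hj
    rcases lt_or_gt_of_ne hj with h | h
    · rw [vertexB_mode_of_nonneg _ _ (by omega), TensorProduct.tmul_zero]
    · rw [h_zero j (by omega), TensorProduct.zero_tmul]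

lemma coaction_mode_eV_eV (hsymm : B.IsSymm) (hright : ∀ α : L, ε α 0 = 1)
    (h𝒱 : IsLatticeVertexAlgebra B ε 𝒱) (α γ : L) (n : ℤ) :
    coaction L (𝒱.mode (eV α) n (eV γ)) =
      (𝒱.tensor (vertexB L)).mode (coaction L (eV α)) n (coaction L (eV γ)) := by
  rcases le_or_gt (-B α γ - 1) n with hn | hn
  · exact coaction_mode_eV_eV_of_le h𝒱 α γ hn
  replace hn := hn.le
  induction n, hn using Int.leInductionDown with
  | base => exact coaction_mode_eV_eV_of_le h𝒱 α γ le_rfl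
  | pred n hn ih =>
    refine (h𝒱.isHighestWeight (toCartan γ) α).map_mode_sub_one h𝒱.isVertexAlgebra
      h𝒱.tensor_isVertexAlgebra (coaction_translation hsymm hright h𝒱)
      (coaction_mode_hV hsymm h𝒱 _) ?_ ?_ ih
    · rw [h𝒱.translation_eq hsymm hright, transV_eV (B := B), h𝒱.Y_h]
    · rw [baseChange_toCartan, hsymm.eq γ α]
      exact_mod_cast (show B α γ + n ≠ 0 by omega)

lemma coaction_mode_eV (hsymm : B.IsSymm) (hright : ∀ α : L, ε α 0 = 1)
    (h𝒱 : IsLatticeVertexAlgebra B ε 𝒱) (α : L) (n : ℤ) (v : VSpace L) :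
    coaction L (𝒱.mode (eV α) n v) =
      (𝒱.tensor (vertexB L)).mode (coaction L (eV α)) n (coaction L v) := by
  induction v using vSpace_induction (B := B) generalizing n with
  | zero => simp only [map_zero]
  | add v w hv hw => rw [map_add, map_add, hv, hw, map_add, map_add]
  | smul c v hv => rw [map_smul, map_smul, hv, map_smul, map_smul]
  | eV γ => exact coaction_mode_eV_eV hsymm hright h𝒱 α γ n
  | heis h k v hv =>
    rw [← h𝒱.Y_h]
    exact (h𝒱.isHighestWeight h α).map_mode_mode h𝒱.isVertexAlgebra h𝒱.tensor_isVertexAlgebra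
      (coaction_mode_hV hsymm h𝒱 h) hv (-(k + 1)) n

theorem coaction_isHom (hsymm : B.IsSymm) (hright : ∀ α : L, ε α 0 = 1)
    (h𝒱 : IsLatticeVertexAlgebra B ε 𝒱) : IsHom 𝒱 (𝒱.tensor (vertexB L)) (coaction L) where
  map_vac := by
    rw [h𝒱.vac_eq, coaction_eV, eB_zero, ← h𝒱.vac_eq]
    rfl
  map_mode u v n := by
    induction u using vSpace_induction (B := B) generalizing v n with
    | zero => simp only [mode_zero_left, LinearMap.zero_apply, map_zero]
    | add u u' hu hu' =>
      rw [mode_add_left, LinearMap.add_apply, map_add, hu, hu', map_add, mode_add_left,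
        LinearMap.add_apply]
    | smul c u hu =>
      rw [mode_smul_left, LinearMap.smul_apply, map_smul, hu, map_smul, mode_smul_left,
        LinearMap.smul_apply]
    | heis h k u hu =>
      rw [← h𝒱.Y_h]
      exact h𝒱.isVertexAlgebra.map_mode_mode h𝒱.tensor_isVertexAlgebra (coaction L)
        (coaction_mode_hV hsymm h𝒱 h) (fun n w => hu w n) (-(k + 1)) n v
    | eV α => exact coaction_mode_eV hsymm hright h𝒱 α n v

theorem coaction_unique (h𝒱 : IsLatticeVertexAlgebra B ε 𝒱)
    {ρ ρ' : VSpace L →ₗ[ℂ] VSpace L ⊗[ℂ] BSpace L} (hρ : IsHom 𝒱 (𝒱.tensor (vertexB L)) ρ)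
    (hρ' : IsHom 𝒱 (𝒱.tensor (vertexB L)) ρ') (hh : ∀ h, ρ (hV h) = ρ' (hV h))
    (he : ∀ α, ρ (eV α) = ρ' (eV α)) : ρ = ρ' := by
  refine LinearMap.ext fun v => ?_
  induction v using vSpace_induction (B := B) with
  | zero => simp only [map_zero]
  | eV α => exact he α
  | add v w hv hw => rw [map_add, map_add, hv, hw]
  | smul c v hv => rw [map_smul, map_smul, hv]
  | heis h k v hv => rw [← h𝒱.Y_h, hρ.map_mode, hρ'.map_mode, hh, hv]

theorem coaction_isRightComoduleVertexAlgebra (hsymm : B.IsSymm) (hright : ∀ α : L, ε α 0 = 1)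
    (h𝒱 : IsLatticeVertexAlgebra B ε 𝒱) :
    𝒱.IsRightComoduleVertexAlgebra (vertexB L) (coaction L) :=
  ⟨h𝒱.isVertexAlgebra, vertexB_isVertexBialgebra, coaction_isHom hsymm hright h𝒱,
    coactionOfEquiv_coassoc _, coactionOfEquiv_counit _⟩

end LatticeVA

end

open LatticeVA in
theorem theorem5p4_general {L : Type*} [AddCommGroup L] (B : LinearMap.BilinForm ℤ L)
    (hsymm : B.IsSymm) (ε : L → L → ℂˣ)
    (hcocycle : ∀ α β γ : L, ε α β * ε (α + β) γ = ε β γ * ε α (β + γ))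
    (hcomm : ∀ α β : L, ε α β * (ε β α)⁻¹ = (-1) ^ (B α β)) (hright : ∀ α : L, ε α 0 = 1) :
    (∃! 𝒱 : VertexData (VSpace L), IsLatticeVertexAlgebra B ε 𝒱) ∧
    (vertexB L).IsVertexBialgebra ∧ (vertexB L).IsCommutative ∧
    Coalgebra.IsCocomm ℂ (BSpace L) ∧
    ∀ 𝒱 : VertexData (VSpace L), IsLatticeVertexAlgebra B ε 𝒱 →
      ∃! ρ : VSpace L →ₗ[ℂ] VSpace L ⊗[ℂ] BSpace L,
        𝒱.IsRightComoduleVertexAlgebra (vertexB L) ρ ∧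
        (∀ h : Cartan L, ρ (hV h) = hV h ⊗ₜ[ℂ] 1 + 𝒱.vac ⊗ₜ[ℂ] hB h) ∧
        (∀ α : L, ρ (eV α) = eV α ⊗ₜ[ℂ] eB α) := by
  refine ⟨?_, vertexB_isVertexBialgebra,
    VertexData.borcherds_isCommutative (A := BSpace L) bDeriv, inferInstance,
    fun 𝒱 h𝒱 => ?_⟩
  · obtain ⟨𝒱, h𝒱⟩ := exists_isLatticeVertexAlgebra hsymm hcocycle hcomm hright
    exact ⟨𝒱, h𝒱, fun 𝒲 h𝒲 => h𝒲.unique h𝒱⟩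
  have h_hV (h : Cartan L) : coaction L (hV h) = hV h ⊗ₜ[ℂ] 1 + 𝒱.vac ⊗ₜ[ℂ] hB h := by
    rw [coaction_hV, h𝒱.vac_eq]
  refine ⟨coaction L, ⟨coaction_isRightComoduleVertexAlgebra hsymm hright h𝒱,
    h_hV, coaction_eV⟩, fun ρ ⟨hρ, hρh, hρe⟩ => ?_⟩
  exact coaction_unique h𝒱 hρ.isHom (coaction_isHom hsymm hright h𝒱)
    (fun h => (hρh h).trans (h_hV h).symm) fun α => (hρe α).trans (coaction_eV α).symm

theorem theorem5p4 {L : Type*} [AddCommGroup L] [Module.Free ℤ L] [Module.Finite ℤ L]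
    (B : LinearMap.BilinForm ℤ L) (hsymm : B.IsSymm) (hnondeg : B.Nondegenerate)
    (heven : ∀ α : L, Even (B α α))
    (ε : L → L → ℂˣ)
    (hcocycle : ∀ α β γ : L, ε α β * ε (α + β) γ = ε β γ * ε α (β + γ))
    (hcomm : ∀ α β : L, ε α β * (ε β α)⁻¹ = (-1) ^ (B α β))
    (hright : ∀ α : L, ε α 0 = 1) (hleft : ∀ α : L, ε 0 α = 1) :
    (∃! 𝒱 : VertexData (LatticeVA.VSpace L), LatticeVA.IsLatticeVertexAlgebra B ε 𝒱) ∧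
    (LatticeVA.vertexB L).IsVertexBialgebra ∧ (LatticeVA.vertexB L).IsCommutative ∧
    Coalgebra.IsCocomm ℂ (LatticeVA.BSpace L) ∧
    ∀ 𝒱 : VertexData (LatticeVA.VSpace L), LatticeVA.IsLatticeVertexAlgebra B ε 𝒱 →
      ∃! ρ : LatticeVA.VSpace L →ₗ[ℂ] LatticeVA.VSpace L ⊗[ℂ] LatticeVA.BSpace L,
        𝒱.IsRightComoduleVertexAlgebra (LatticeVA.vertexB L) ρ ∧
        (∀ h : LatticeVA.Cartan L, ρ (LatticeVA.hV h) =
          LatticeVA.hV h ⊗ₜ[ℂ] 1 + 𝒱.vac ⊗ₜ[ℂ] LatticeVA.hB h) ∧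
        (∀ α : L, ρ (LatticeVA.eV α) = LatticeVA.eV α ⊗ₜ[ℂ] LatticeVA.eB α) :=
  theorem5p4_general B hsymm ε hcocycle hcomm hright
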